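/- Let $n\ge 2$. Periodic distributions are the continuous linear functionals on the space $C^\infty_\#$ of complex-valued $C^\infty$ functions on $\mathbb R^n$ that are $1$-periodic in each variable; $\hat g(\xi)=\langle g,e^{-2\pi i x\cdot\xi}\rangle$ for $\xi\in\mathbb Z^n$, and $\rho(\xi)=(1+|\xi|^2)^{1/2}$. For $s\in\mathbb R$ let $\dot H^s_\#$ be the space of periodic distributions $g$ with $\langle g,1\rangle=0$ and $\|g\|_{\dot H^s_\#}^2=\sum_{\xi\in\mathbb Z^n}\rho(\xi)^{2s}|\hat g(\xi)|^2<\infty$, let $\dot{\mathbf H}^s_\#=(\dot H^s_\#)^n$ with norm $\|\mathbf u\|_{\dot{\mathbf H}^s_\#}=(\sum_k\|u_k\|^2_{\dot H^s_\#})^{1/2}$, and let $\dot C^\infty_\#$, $\dot{\mathbf C}^\infty_\#=(\dot C^\infty_\#)^n$ be the smooth periodic functions with zero mean. Let $\mathbb A=(a_{kj}^{\alpha\beta})_{1\le k,j,\alpha,\beta\le n}$ be a constant real tensor with $a_{kj}^{\alpha\beta}=a_{\alpha j}^{k\beta}=a_{k\beta}^{\alpha j}$, put $\|\mathbb A\|=\max|a_{kj}^{\alpha\beta}|$,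 and assume (summing over repeated indices) that for some $C_{\mathbb A}>0$ $$C_{\mathbb A}\,a_{kj}^{\alpha\beta}\zeta_{k\alpha}\zeta_{j\beta}\ge|\zeta|^2\quad\text{for all symmetric }\zeta\in\mathbb R^{n\times n}\text{ with zero trace.}$$ Let $\mathbf U$ be a real-valued smooth periodic vector field with $\operatorname{div}\mathbf U=0$. With $(\mathfrak L\mathbf u)_k=\partial_\alpha\big(a_{kj}^{\alpha\beta}\tfrac12(\partial_ju_\beta+\partial_\beta u_j)\big)$, consider the anisotropic Oseen system, in the sense of distributions, $$S_U(\mathbf u,p):=\big(-\mathfrak L\mathbf u+\nabla p+(\mathbf U\cdot\nabla)\mathbf u,\ \operatorname{div}\mathbf u\big)=(\mathbf f,g).$$ (i) Let $s\ge1$. For any $(\mathbf f,g)\in\dot{\mathbf H}^{s-2}_\#\times\dot H^{s-1}_\#$ the system has a unique solution $(\mathbf u,p)\in\dot{\mathbf H}^s_\#\times\dot H^{s-1}_\#$. There is a constant $C_s>0$ depending only on $C_{\mathbb A},\|\mathbb A\|,n,\mathbf U,s$ such that $$\|\mathbf u\|_{\dot{\mathbf H}^s_\#}+\|p\|_{\dot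 H^{s-1}_\#}\le C_s\big(\|\mathbf f\|_{\dot{\mathbf H}^{s-2}_\#}+\|g\|_{\dot H^{s-1}_\#}\big),$$ and $S_U:\dot{\mathbf H}^s_\#\times\dot H^{s-1}_\#\to\dot{\mathbf H}^{s-2}_\#\times\dot H^{s-1}_\#$ is an isomorphism (a bounded linear bijection with bounded inverse). The solution $(\mathbf u,p)$ is real if and only if the data $(\mathbf f,g)$ are real, so that the same holds for the spaces of real distributions. (ii) If $(\mathbf f,g)\in\dot{\mathbf C}^\infty_\#\times\dot C^\infty_\#$, then the solution satisfies $(\mathbf u,p)\in\dot{\mathbf C}^\infty_\#\times\dot C^\infty_\#$. -/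

import Mathlib

open scoped ContDiff

noncomputable section

namespace PeriodicOseen

/-! ### Smooth periodic functions on `ℝⁿ` -/

/-- The algebra of complex-valued `C^∞` functions on `ℝⁿ` that are `1`-periodic in each variable,
i.e. of the smooth functions on the torus `ℝⁿ / ℤⁿ`. -/
def PSmooth (n : ℕ) : Subalgebra ℂ ((Fin n → ℝ) → ℂ) where
  carrier := {φ | ContDiff ℝ ∞ φ ∧ ∀ (ξ : Fin n → ℤ) (x : Fin n → ℝ), φ (fun i => x i + ξ i) = φ x}
  mul_mem' := by
    rintro φ ψ ⟨hφ, hφ'⟩ ⟨hψ, hψ'⟩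
    exact ⟨hφ.mul hψ, fun ξ x => by simp only [Pi.mul_apply, hφ', hψ']⟩
  add_mem' := by
    rintro φ ψ ⟨hφ, hφ'⟩ ⟨hψ, hψ'⟩
    exact ⟨hφ.add hψ, fun ξ x => by simp only [Pi.add_apply, hφ', hψ']⟩
  algebraMap_mem' := fun c => ⟨contDiff_const, fun _ _ => rfl⟩

/-- The exponential `x ↦ exp (2 π i x · ξ)`, for `ξ ∈ ℤⁿ`. -/
def expo {n : ℕ} (ξ : Fin n → ℤ) : PSmooth n :=
  ⟨fun x => Complex.exp (2 * Real.pi * Complex.I * ∑ i, (x i : ℂ) * (ξ i : ℂ)), by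
    constructor
    · refine Complex.contDiff_exp.comp (contDiff_const.mul (ContDiff.sum fun i _ => ?_))
      exact (Complex.ofRealCLM.contDiff.comp (contDiff_apply ℝ ℝ i)).mul contDiff_const
    · intro η x
      have h : 2 * Real.pi * Complex.I * ∑ i, ((x i + η i : ℝ) : ℂ) * (ξ i : ℂ)
          = 2 * Real.pi * Complex.I * ∑ i, (x i : ℂ) * (ξ i : ℂ)
            + ((∑ i, η i * ξ i : ℤ) : ℂ) * (2 * Real.pi * Complex.I) := by
        push_cast
        simp only [add_mul, Finset.sum_add_distrib]
        ring
      show Complex.exp (2 * Real.pi * Complex.I * ∑ i, ((x i + η i : ℝ) : ℂ) * (ξ i : ℂ)) = _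
      rw [h, Complex.exp_add, Complex.exp_int_mul_two_pi_mul_I, mul_one]⟩

/-- The partial derivative `∂ⱼ φ` of a smooth periodic function. -/
def pderivFun {n : ℕ} (j : Fin n) : PSmooth n →ₗ[ℂ] PSmooth n where
  toFun φ := ⟨fun x => fderiv ℝ φ.1 x (Pi.single j 1), by
    constructor
    · exact (φ.2.1.fderiv_right (m := ∞) (by simp)).clm_apply contDiff_const
    · intro ξ x
      have h : φ.1 = fun y => φ.1 (y + fun i => (ξ i : ℝ)) := by
        funext y
        exact (φ.2.2 ξ y).symm
      have h' : fderiv ℝ φ.1 x = fderiv ℝ φ.1 (x + fun i => (ξ i : ℝ)) := by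
        conv_lhs => rw [h]
        exact fderiv_comp_add_right _
      show _ = fderiv ℝ φ.1 x (Pi.single j 1)
      rw [h']
      rfl⟩
  map_add' φ ψ := by
    ext x
    have hφ := (φ.2.1.differentiable (by simp)) x
    have hψ := (ψ.2.1.differentiable (by simp)) x
    show fderiv ℝ (φ.1 + ψ.1) x _ = fderiv ℝ φ.1 x _ + fderiv ℝ ψ.1 x _
    rw [fderiv_add hφ hψ]
    rfl
  map_smul' c φ := by
    ext x
    have hφ := (φ.2.1.differentiable (by simp)) x
    show fderiv ℝ (c • φ.1) x _ = c • fderiv ℝ φ.1 x _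
    rw [fderiv_const_smul hφ]
    rfl

/-- Each derivative of a smooth periodic function is bounded. -/
theorem bounded_iteratedFDeriv {n : ℕ} (φ : PSmooth n) (N : ℕ) :
    ∃ B : ℝ, 0 ≤ B ∧ ∀ k ≤ N, ∀ x, ‖iteratedFDeriv ℝ k φ.1 x‖ ≤ B := by
  have one : ∀ k : ℕ, ∃ B : ℝ, ∀ x, ‖iteratedFDeriv ℝ k φ.1 x‖ ≤ B := by
    intro k
    have hc : Continuous (iteratedFDeriv ℝ k φ.1) :=
      φ.2.1.continuous_iteratedFDeriv (by exact_mod_cast le_top)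
    obtain ⟨B, hB⟩ := (isCompact_Icc (a := (0 : Fin n → ℝ)) (b := 1)).exists_bound_of_continuousOn
      hc.continuousOn
    refine ⟨B, fun x => ?_⟩
    have h : φ.1 = fun y => φ.1 (y + fun i => ((-⌊x i⌋ : ℤ) : ℝ)) := by
      funext y
      exact (φ.2.2 (fun i => -⌊x i⌋) y).symm
    rw [h, iteratedFDeriv_comp_add_right]
    refine hB _ ⟨fun i => ?_, fun i => ?_⟩
    · have := Int.floor_le (x i)
      simp only [Pi.zero_apply, Pi.add_apply, Int.cast_neg]
      linarith
    · have := Int.lt_floor_add_one (x i)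
      simp only [Pi.one_apply, Pi.add_apply, Int.cast_neg]
      linarith
  choose B hB using one
  refine ⟨∑ k ∈ Finset.range (N + 1), |B k|, Finset.sum_nonneg fun _ _ => abs_nonneg _,
    fun k hk x => ?_⟩
  exact ((hB k x).trans (le_abs_self _)).trans
    (Finset.single_le_sum (f := fun k => |B k|) (fun _ _ => abs_nonneg _)
      (Finset.mem_range.2 (Nat.lt_succ_of_le hk)))

/-! ### Periodic distributions -/

/-- The space of periodic (torus) distributions: the linear functionals `g` on the smooth periodic
functions that are continuous for the usual Fréchet topology, i.e. for some `N` and `C`,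
`|g φ| ≤ C · max_{k ≤ N} sup_x ‖D^k φ (x)‖` for all `φ`. -/
def PDist (n : ℕ) : Submodule ℂ (Module.Dual ℂ (PSmooth n)) where
  carrier := {g | ∃ (N : ℕ) (C : ℝ), 0 ≤ C ∧ ∀ (φ : PSmooth n) (M : ℝ),
    (∀ k ≤ N, ∀ x, ‖iteratedFDeriv ℝ k φ.1 x‖ ≤ M) → ‖g φ‖ ≤ C * M}
  zero_mem' := ⟨0, 0, le_rfl, fun φ M _ => by simp⟩
  add_mem' := by
    rintro g h ⟨N, C, hC, hg⟩ ⟨N', C', hC', hh⟩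
    refine ⟨max N N', C + C', add_nonneg hC hC', fun φ M hM => ?_⟩
    have h1 := hg φ M fun k hk => hM k (hk.trans (le_max_left _ _))
    have h2 := hh φ M fun k hk => hM k (hk.trans (le_max_right _ _))
    calc ‖(g + h) φ‖ ≤ ‖g φ‖ + ‖h φ‖ := norm_add_le _ _
      _ ≤ (C + C') * M := by linarith
  smul_mem' := by
    rintro c g ⟨N, C, hC, hg⟩
    refine ⟨N, ‖c‖ * C, mul_nonneg (norm_nonneg _) hC, fun φ M hM => ?_⟩
    rw [LinearMap.smul_apply, norm_smul, mul_assoc]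
    exact mul_le_mul_of_nonneg_left (hg φ M hM) (norm_nonneg _)

/-- The distributional derivative, `⟨∂ⱼ g, φ⟩ = -⟨g, ∂ⱼ φ⟩`. -/
def pderiv {n : ℕ} (j : Fin n) : PDist n →ₗ[ℂ] PDist n where
  toFun g := ⟨-(g.1 ∘ₗ pderivFun j), by
    obtain ⟨N, C, hC, hg⟩ := g.2
    refine ⟨N + 1, C * ‖(Pi.single j 1 : Fin n → ℝ)‖, by positivity, fun φ M hM => ?_⟩
    have h := hg (pderivFun j φ) (‖(Pi.single j 1 : Fin n → ℝ)‖ * M) fun k hk x => by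
      have h1 : ‖iteratedFDeriv ℝ k (fun y => fderiv ℝ φ.1 y (Pi.single j 1)) x‖
          ≤ ‖(Pi.single j 1 : Fin n → ℝ)‖ * ‖iteratedFDeriv ℝ k (fderiv ℝ φ.1) x‖ :=
        norm_iteratedFDeriv_clm_apply_const
          ((φ.2.1.fderiv_right (m := ∞) (by simp)).contDiffAt) (by exact_mod_cast le_top)
      rw [norm_iteratedFDeriv_fderiv] at h1
      exact h1.trans (mul_le_mul_of_nonneg_left (hM (k + 1) (by omega) x) (norm_nonneg _))
    rw [LinearMap.neg_apply, norm_neg, mul_assoc]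
    exact h⟩
  map_add' g h := by
    ext φ
    show -(g.1 _ + h.1 _) = -(g.1 _) + -(h.1 _)
    ring
  map_smul' c g := by
    ext φ
    show -(c * g.1 _) = c * -(g.1 _)
    ring

/-- The product `ψ g` of a distribution and a smooth function, `⟨ψ g, φ⟩ = ⟨g, ψ φ⟩`. -/
def mulSmooth {n : ℕ} (ψ : PSmooth n) : PDist n →ₗ[ℂ] PDist n where
  toFun g := ⟨g.1 ∘ₗ LinearMap.mulLeft ℂ ψ, by
    obtain ⟨N, C, hC, hg⟩ := g.2
    obtain ⟨B, hB, hψ⟩ := bounded_iteratedFDeriv ψ N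
    refine ⟨N, C * (2 ^ N * B), by positivity, fun φ M hM => ?_⟩
    have hM0 : 0 ≤ M := (norm_nonneg _).trans (hM 0 (Nat.zero_le _) 0)
    have h := hg (ψ * φ) (2 ^ N * B * M) fun k hk x => by
      have h1 : ‖iteratedFDeriv ℝ k (fun y => ψ.1 y * φ.1 y) x‖ ≤ _ :=
        norm_iteratedFDeriv_mul_le (N := (k : WithTop ℕ∞))
          (ψ.2.1.of_le (by exact_mod_cast le_top)) (φ.2.1.of_le (by exact_mod_cast le_top)) x le_rfl
      refine h1.trans ?_
      calc _ ≤ ∑ i ∈ Finset.range (k + 1), (k.choose i : ℝ) * B * M := by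
            refine Finset.sum_le_sum fun i hi => ?_
            have hi' : i ≤ k := Nat.lt_succ_iff.1 (Finset.mem_range.1 hi)
            gcongr
            · exact hψ i (hi'.trans hk) x
            · exact hM (k - i) ((Nat.sub_le _ _).trans hk) x
        _ = 2 ^ k * B * M := by
            rw [← Finset.sum_mul, ← Finset.sum_mul]
            congr 2
            exact_mod_cast Nat.sum_range_choose k
        _ ≤ 2 ^ N * B * M := by
            gcongr
            norm_num
    rw [LinearMap.comp_apply, mul_assoc]
    exact h⟩
  map_add' _ _ := rfl
  map_smul' _ _ := rfl

/-- The Fourier coefficient `ĝ(ξ) = ⟨g, exp (-2 π i x · ξ)⟩`. -/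
def fourierCoeff {n : ℕ} (g : PDist n) (ξ : Fin n → ℤ) : ℂ := g.1 (expo (-ξ))

/-- The distribution `g` is (represented by) a smooth periodic function `ψ`:
`⟨g, φ⟩ = ∫_{[0,1]ⁿ} ψ φ`. -/
def IsSmooth {n : ℕ} (g : PDist n) : Prop :=
  ∃ ψ : PSmooth n, ∀ φ : PSmooth n,
    g.1 φ = ∫ x in Set.Icc (0 : Fin n → ℝ) 1, ψ.1 x * φ.1 x

/-- A distribution is real if it takes real values on real test functions. -/
def IsReal {n : ℕ} (g : PDist n) : Prop :=
  ∀ φ : PSmooth n, (∀ x, (φ.1 x).im = 0) → (g.1 φ).im = 0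

/-! ### Periodic Sobolev spaces -/

/-- `ρ(ξ) = (1 + |ξ|²)^{1/2}`. -/
def rho {n : ℕ} (ξ : Fin n → ℤ) : ℝ := Real.sqrt (1 + ∑ i, (ξ i : ℝ) ^ 2)

/-- The periodic Sobolev (Bessel-potential) space `H^s_#`: the periodic distributions with
`∑_ξ ρ(ξ)^{2s} |ĝ(ξ)|² < ∞`. -/
def H (n : ℕ) (s : ℝ) : Submodule ℂ (PDist n) where
  carrier := {g | Summable fun ξ : Fin n → ℤ => rho ξ ^ (2 * s) * ‖fourierCoeff g ξ‖ ^ 2}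
  zero_mem' := by
    have h : ∀ ξ : Fin n → ℤ, fourierCoeff (0 : PDist n) ξ = 0 := fun _ => rfl
    simp [h, summable_zero]
  add_mem' := by
    intro g h hg hh
    refine Summable.of_nonneg_of_le (fun ξ => ?_) (fun ξ => ?_) ((hg.add hh).mul_left 2)
    · exact mul_nonneg (Real.rpow_nonneg (Real.sqrt_nonneg _) _) (sq_nonneg _)
    · have h1 : ‖fourierCoeff (g + h) ξ‖ ≤ ‖fourierCoeff g ξ‖ + ‖fourierCoeff h ξ‖ :=
        norm_add_le _ _
      have h2 : ‖fourierCoeff (g + h) ξ‖ ^ 2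
          ≤ 2 * (‖fourierCoeff g ξ‖ ^ 2 + ‖fourierCoeff h ξ‖ ^ 2) := by
        nlinarith [norm_nonneg (fourierCoeff (g + h) ξ),
          sq_nonneg (‖fourierCoeff g ξ‖ - ‖fourierCoeff h ξ‖)]
      have h3 := mul_le_mul_of_nonneg_left h2
        (show 0 ≤ rho ξ ^ (2 * s) from Real.rpow_nonneg (Real.sqrt_nonneg _) _)
      linarith
  smul_mem' := by
    intro c g hg
    have h : ∀ ξ, ‖fourierCoeff (c • g) ξ‖ ^ 2 = ‖c‖ ^ 2 * ‖fourierCoeff g ξ‖ ^ 2 := by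
      intro ξ
      rw [← mul_pow, ← norm_mul]
      rfl
    refine (Summable.mul_left (‖c‖ ^ 2) hg).congr fun ξ => ?_
    rw [h]
    ring

/-- The square of the norm of `H^s_#`. -/
def normSqH {n : ℕ} (s : ℝ) (g : PDist n) : ℝ :=
  ∑' ξ : Fin n → ℤ, rho ξ ^ (2 * s) * ‖fourierCoeff g ξ‖ ^ 2

/-- The norm `(∑_ξ ρ(ξ)^{2s} |ĝ(ξ)|²)^{1/2}` of `H^s_#`. -/
def normH {n : ℕ} (s : ℝ) (g : PDist n) : ℝ := Real.sqrt (normSqH s g)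

/-- The norm of `(H^s_#)ⁿ`, i.e. `(∑_ξ ρ(ξ)^{2s} |û(ξ)|²)^{1/2}` with `|û(ξ)|` Euclidean. -/
def normHVec {n : ℕ} (s : ℝ) (u : Fin n → PDist n) : ℝ := Real.sqrt (∑ k, normSqH s (u k))

/-- The periodic distributions with zero mean, `⟨g, 1⟩ = 0`. -/
def zeroMean (n : ℕ) : Submodule ℂ (PDist n) where
  carrier := {g | g.1 1 = 0}
  zero_mem' := rfl
  add_mem' := by
    intro g h (hg : g.1 1 = 0) (hh : h.1 1 = 0)
    show g.1 1 + h.1 1 = 0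
    rw [hg, hh, add_zero]
  smul_mem' := by
    intro c g (hg : g.1 1 = 0)
    show c * g.1 1 = 0
    rw [hg, mul_zero]

/-- The space of the elements of `H^s_#` with zero mean. -/
def Hdot (n : ℕ) (s : ℝ) : Submodule ℂ (PDist n) := H n s ⊓ zeroMean n

/-- The corresponding space of `n`-component vector distributions. -/
def HdotVec (n : ℕ) (s : ℝ) : Submodule ℂ (Fin n → PDist n) :=
  Submodule.pi Set.univ fun _ => Hdot n s

/-! ### The anisotropic Oseen operator

A viscosity tensor with components `a_{kj}^{αβ}` is written `a k j α β`. -/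

/-- The symmetry conditions `a_{kj}^{αβ} = a_{αj}^{kβ} = a_{kβ}^{αj}`. -/
def TensorSymmetric {n : ℕ} (a : Fin n → Fin n → Fin n → Fin n → ℝ) : Prop :=
  ∀ k j α β, a k j α β = a α j k β ∧ a k j α β = a k β α j

/-- The relaxed ellipticity condition with constant `CA`:
`CA a_{kj}^{αβ} ζ_{kα} ζ_{jβ} ≥ |ζ|²` for all real symmetric matrices `ζ` with zero trace. -/
def TensorElliptic {n : ℕ} (a : Fin n → Fin n → Fin n → Fin n → ℝ) (CA : ℝ) : Prop :=
  ∀ ζ : Matrix (Fin n) (Fin n) ℝ, ζ.transpose = ζ → ζ.trace = 0 →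
    ∑ k, ∑ α, ζ k α ^ 2 ≤ CA * ∑ k, ∑ j, ∑ α, ∑ β, a k j α β * ζ k α * ζ j β

/-- `E_{jβ}(u) = (∂ⱼ u_β + ∂_β uⱼ) / 2`. -/
def strain {n : ℕ} (u : Fin n → PDist n) (j β : Fin n) : PDist n :=
  (1 / 2 : ℂ) • (pderiv j (u β) + pderiv β (u j))

/-- `(𝔏 u)_k = ∂_α (a_{kj}^{αβ} E_{jβ}(u))`. -/
def viscous {n : ℕ} (a : Fin n → Fin n → Fin n → Fin n → ℝ) (u : Fin n → PDist n) (k : Fin n) :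
    PDist n :=
  ∑ α, pderiv α (∑ j, ∑ β, (a k j α β : ℂ) • strain u j β)

/-- `((U · ∇) u)_k = ∑ⱼ Uⱼ ∂ⱼ u_k`. -/
def advect {n : ℕ} (U : Fin n → PSmooth n) (u : Fin n → PDist n) (k : Fin n) : PDist n :=
  ∑ j, mulSmooth (U j) (pderiv j (u k))

/-- The Oseen operator `S_U (u, p) = (-𝔏 u + ∇p + (U · ∇) u, div u)`. -/
def oseen {n : ℕ} (a : Fin n → Fin n → Fin n → Fin n → ℝ) (U : Fin n → PSmooth n) :
    ((Fin n → PDist n) × PDist n) →ₗ[ℂ] ((Fin n → PDist n) × PDist n) where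
  toFun x := (fun k => -viscous a x.1 k + pderiv k x.2 + advect U x.1 k, ∑ j, pderiv j (x.1 j))
  map_add' x y := by
    refine Prod.ext (funext fun k => ?_) ?_
    · simp only [viscous, strain, advect, Prod.fst_add, Prod.snd_add, Pi.add_apply, map_add,
        smul_add, Finset.sum_add_distrib, map_sum, map_smul]
      abel
    · simp only [Prod.fst_add, Prod.snd_add, Pi.add_apply, map_add, Finset.sum_add_distrib]
  map_smul' c x := by
    refine Prod.ext (funext fun k => ?_) ?_
    · simp only [viscous, strain, advect, Prod.smul_fst, Prod.smul_snd, Pi.smul_apply, map_add,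
        smul_add, map_sum, map_smul, RingHom.id_apply, Finset.smul_sum, smul_neg]
      simp only [smul_comm c]
    · simp only [Prod.smul_fst, Prod.smul_snd, Pi.smul_apply, map_smul, Finset.smul_sum,
        RingHom.id_apply]

/-- The vector field `U` is real-valued and divergence-free. -/
def RealDivFree {n : ℕ} (U : Fin n → PSmooth n) : Prop :=
  (∀ j x, ((U j).1 x).im = 0) ∧ ∑ j, pderivFun j (U j) = 0

/-- The space of pairs `(u, p)`, with `u` in the vector version of `Hdot n s` and `p` in
`Hdot n t`. -/
def PairSpace (n : ℕ) (s t : ℝ) : Submodule ℂ ((Fin n → PDist n) × PDist n) :=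
  (HdotVec n s).prod (Hdot n t)

/-- The sum of the norms of the components of a pair. -/
def pairNorm {n : ℕ} (s t : ℝ) (x : (Fin n → PDist n) × PDist n) : ℝ :=
  normHVec s x.1 + normH t x.2

/-- Both components of a pair are zero-mean smooth functions. -/
def SmoothPair {n : ℕ} (x : (Fin n → PDist n) × PDist n) : Prop :=
  (∀ k, IsSmooth (x.1 k) ∧ x.1 k ∈ zeroMean n) ∧ IsSmooth x.2 ∧ x.2 ∈ zeroMean n

/-- Both components of a pair are real distributions. -/
def RealPair {n : ℕ} (x : (Fin n → PDist n) × PDist n) : Prop :=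
  (∀ k, IsReal (x.1 k)) ∧ IsReal x.2

end PeriodicOseen

end

open PeriodicOseen

noncomputable section

namespace PeriodicOseen

/-! ### The weight -/

/-! The system is solved on the Fourier side. A periodic distribution is determined by its
coefficients (`fourierCoeff_injective`), and every sequence of polynomial growth occurs (`ofCoeff`),
so `oseen_eq_iff` turns the system into the relations `Solves` between weighted `ℓ²` sequences.
Viscosity, pressure and divergence act on each frequency separately; only advection, a convolution
with the coefficients of `U`, couples frequencies.

At a single frequency `ξ ≠ 0`, a real vector `v ⊥ ξ` gives the symmetric matrix `(ξ ⊗ v + v ⊗ ξ) /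
2`, whose trace is `ξ · v = 0` and whose squared norm is `|ξ|² |v|² / 2`. Relaxed ellipticity
therefore makes the viscous symbol coercive on `ξ^⊥` (`isEllipticSymbol_viscSymbol`; real and
imaginary parts are treated separately). The component of `u` along `ξ` is given by the divergence,
and the pressure by the component of the momentum equation along `ξ`. This yields the Stokes
estimate `IsEllipticSymbol.stokes_le`, with a gain of two derivatives for `u`.

For `s = 1`, advection by a real divergence-free field is skew (`re_inner_advOp`), so the projected
operator `energyOp` is coercive on `ℓ²` with the same constant as without advection. The Lax–Milgram
argument makes it surjective (`energyOp_surjective`), which gives existence in `H¹`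
(`exists_solves_one`), while coercivity gives the a priori bound (`Solves.energy_le`).

For `s > 1`, Peetre's inequality shows that advection costs one derivative in every `H^t`. Since
Stokes gains two, moving advection to the right-hand side improves regularity by up to one order at
a time (`Solves.regularity_step`, iterated in `exists_apriori`). All constants depend on the tensor
only through its coercivity constant and its upper bound. The estimate contains uniqueness.

Uniqueness gives the remaining claims. Complex conjugation commutes with the operator because `a`
and `U` are real, so real data force real solutions. Smoothness means membership in `H^r` for all
`r`, and the solution in `H^r` must coincide with the one in `H^s`. -/

theorem rho_sq {n : ℕ} (ξ : Fin n → ℤ) : rho ξ ^ 2 = 1 + ∑ i, (ξ i : ℝ) ^ 2 :=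
  Real.sq_sqrt (by positivity)

theorem one_le_rho {n : ℕ} (ξ : Fin n → ℤ) : 1 ≤ rho ξ :=
  Real.one_le_sqrt.2 (le_add_of_nonneg_right (Finset.sum_nonneg fun _ _ => sq_nonneg _))

theorem rho_pos {n : ℕ} (ξ : Fin n → ℤ) : 0 < rho ξ := one_pos.trans_le (one_le_rho ξ)

theorem rho_neg {n : ℕ} (ξ : Fin n → ℤ) : rho (-ξ) = rho ξ := by simp [rho]

theorem abs_coord_le_rho {n : ℕ} (ξ : Fin n → ℤ) (i : Fin n) : |(ξ i : ℝ)| ≤ rho ξ := by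
  refine abs_le_of_sq_le_sq ?_ (rho_pos ξ).le
  rw [rho_sq]
  have := Finset.single_le_sum (f := fun i => (ξ i : ℝ) ^ 2) (fun _ _ => sq_nonneg _)
    (Finset.mem_univ i)
  linarith

/-- A finite set of indices lies in the box spanned by its coordinate projections, and over a box
the sum of products factors. -/
theorem summable_pi_prod {n : ℕ} {f : ℤ → ℝ} (hf : Summable f) (h0 : ∀ k, 0 ≤ f k) :
    Summable fun ξ : Fin n → ℤ => ∏ i, f (ξ i) := by
  classical
  refine summable_of_sum_le (c := ∏ _i : Fin n, ∑' k, f k)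
    (fun ξ => Finset.prod_nonneg fun i _ => h0 _) fun F => ?_
  have hsub : F ⊆ Fintype.piFinset fun i => F.image fun ξ => ξ i := fun ξ hξ =>
    Fintype.mem_piFinset.2 fun i => Finset.mem_image_of_mem (fun ξ : Fin n → ℤ => ξ i) hξ
  refine (Finset.sum_le_sum_of_subset_of_nonneg hsub
    fun ξ _ _ => Finset.prod_nonneg fun i _ => h0 (ξ i)).trans ?_
  rw [← Finset.prod_univ_sum (fun i : Fin n => F.image fun ξ => ξ i) fun _ k => f k]
  exact Finset.prod_le_prod (fun i _ => Finset.sum_nonneg fun _ _ => h0 _)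
    fun i _ => hf.sum_le_tsum _ fun _ _ => h0 _

/-- Each factor `1 + ξᵢ²` is at most `ρ(ξ)²`, so `ρ^{2n}` dominates a product of one-dimensional
weights. The exponent is not optimal, but any fixed power suffices for rapidly decreasing
coefficients. -/
theorem summable_rho_inv (n : ℕ) : Summable fun ξ : Fin n → ℤ => (rho ξ ^ (2 * n))⁻¹ := by
  have h1 : Summable fun k : ℤ => (1 + (k : ℝ) ^ 2)⁻¹ := by
    have h : Summable fun k : ℕ => (1 + (k : ℝ) ^ 2)⁻¹ := by
      refine Summable.of_nonneg_of_le (fun k => by positivity) (fun k => ?_)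
        ((summable_nat_add_iff 1).2 (Real.summable_nat_pow_inv.2 one_lt_two) |>.mul_left 2)
      rw [← div_eq_mul_inv, inv_eq_one_div, div_le_div_iff₀ (by positivity) (by positivity)]
      push_cast
      nlinarith [sq_nonneg ((k : ℝ) - 1)]
    exact Summable.of_nat_of_neg (by simpa using h) (by simpa using h)
  refine Summable.of_nonneg_of_le (fun ξ => by have := rho_pos ξ; positivity) (fun ξ => ?_)
    (summable_pi_prod h1 fun k => by positivity)
  rw [Finset.prod_inv_distrib]
  refine inv_anti₀ (Finset.prod_pos fun i _ => by positivity) ?_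
  calc ∏ i, (1 + (ξ i : ℝ) ^ 2) ≤ ∏ _i : Fin n, rho ξ ^ 2 := by
        refine Finset.prod_le_prod (fun i _ => by positivity) fun i _ => ?_
        rw [rho_sq]
        have := Finset.single_le_sum (f := fun i => (ξ i : ℝ) ^ 2) (fun _ _ => sq_nonneg _)
          (Finset.mem_univ i)
        linarith
    _ = rho ξ ^ (2 * n) := by simp [pow_mul]

theorem rpow_rho_le_pow {n : ℕ} (ξ : Fin n → ℤ) {t : ℝ} {N : ℕ} (h : t ≤ N) :
    rho ξ ^ t ≤ rho ξ ^ N := by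
  rw [← Real.rpow_natCast]
  exact Real.rpow_le_rpow_of_exponent_le (one_le_rho ξ) h

/-! ### Exponentials and derivatives -/

theorem expo_apply {n : ℕ} (ξ : Fin n → ℤ) (x : Fin n → ℝ) :
    (expo ξ).1 x = Complex.exp (2 * Real.pi * Complex.I * ∑ i, (x i : ℂ) * (ξ i : ℂ)) := rfl

theorem expo_add {n : ℕ} (ξ η : Fin n → ℤ) : expo (ξ + η) = expo ξ * expo η := by
  ext x
  show _ = (expo ξ).1 x * (expo η).1 x
  rw [expo_apply, expo_apply, expo_apply, ← Complex.exp_add]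
  congr 1
  simp only [Pi.add_apply, Int.cast_add, mul_add, Finset.sum_add_distrib]

theorem expo_zero {n : ℕ} : expo (0 : Fin n → ℤ) = 1 := by
  ext x
  show (expo 0).1 x = 1
  simp [expo_apply]

theorem conj_expo {n : ℕ} (ξ : Fin n → ℤ) (x : Fin n → ℝ) :
    (starRingEnd ℂ) ((expo ξ).1 x) = (expo (-ξ)).1 x := by
  rw [expo_apply, expo_apply, ← Complex.exp_conj]
  congr 1
  simp only [map_mul, map_sum, Complex.conj_ofReal, Complex.conj_I, map_ofNat, map_intCast,
    Pi.neg_apply, Int.cast_neg, mul_neg, Finset.sum_neg_distrib, neg_mul]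

theorem norm_expo {n : ℕ} (ξ : Fin n → ℤ) (x : Fin n → ℝ) : ‖(expo ξ).1 x‖ = 1 := by
  rw [expo_apply]
  have : 2 * Real.pi * Complex.I * ∑ i, (x i : ℂ) * (ξ i : ℂ)
      = ((2 * Real.pi * ∑ i, x i * ξ i : ℝ) : ℂ) * Complex.I := by push_cast; ring
  rw [this, Complex.norm_exp_ofReal_mul_I]

/-- The linear form `x ↦ x · ξ`. -/
def dotCLM {n : ℕ} (ξ : Fin n → ℤ) : (Fin n → ℝ) →L[ℝ] ℝ :=
  ∑ i, (ξ i : ℝ) • ContinuousLinearMap.proj i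

theorem dotCLM_apply {n : ℕ} (ξ : Fin n → ℤ) (x : Fin n → ℝ) : dotCLM ξ x = ∑ i, (ξ i : ℝ) * x i := by
  simp [dotCLM]

/-- The factor `n` appears because `Fin n → ℝ` carries the sup norm. -/
theorem norm_dotCLM_le {n : ℕ} (ξ : Fin n → ℤ) : ‖dotCLM ξ‖ ≤ n * rho ξ := by
  refine ContinuousLinearMap.opNorm_le_bound _ (mul_nonneg n.cast_nonneg (rho_pos ξ).le) fun x => ?_
  rw [dotCLM_apply]
  calc ‖∑ i, (ξ i : ℝ) * x i‖ ≤ ∑ _i : Fin n, rho ξ * ‖x‖ := by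
        refine norm_sum_le_of_le _ fun i _ => ?_
        rw [norm_mul]
        exact mul_le_mul (abs_coord_le_rho ξ i) (norm_le_pi_norm x i) (norm_nonneg _)
          (rho_pos ξ).le
    _ = n * rho ξ * ‖x‖ := by simp [mul_assoc]

theorem iteratedDeriv_exp_real (c : ℂ) (k : ℕ) :
    iteratedDeriv k (fun t : ℝ => Complex.exp (c * t)) = fun t : ℝ => c ^ k * Complex.exp (c * t) := by
  induction k with
  | zero => simp
  | succ k ih =>
    rw [iteratedDeriv_succ, ih]
    funext t
    have h : HasDerivAt (fun t : ℝ => Complex.exp (c * t)) (Complex.exp (c * t) * c) t := by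
      have := ((hasDerivAt_id t).ofReal_comp.const_mul c).cexp
      simpa using this
    rw [(h.const_mul (c ^ k)).deriv]
    ring

theorem expo_eq_comp {n : ℕ} (ξ : Fin n → ℤ) :
    (expo ξ).1 = (fun t : ℝ => Complex.exp (2 * Real.pi * Complex.I * t)) ∘ dotCLM ξ := by
  funext x
  simp only [expo_apply, Function.comp, dotCLM_apply]
  push_cast
  simp only [mul_comm]

/-- The exponential is a one-variable exponential composed with a linear form. Using `n + 1` instead
of `n` keeps the base at least `1` in every dimension, so the bound is monotone in `k`. -/
theorem norm_iteratedFDeriv_expo_le {n : ℕ} (ξ : Fin n → ℤ) (k : ℕ) (x : Fin n → ℝ) :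
    ‖iteratedFDeriv ℝ k (expo ξ).1 x‖ ≤ (2 * Real.pi * (n + 1) * rho ξ) ^ k := by
  have hsm : ContDiff ℝ ∞ fun t : ℝ => Complex.exp (2 * Real.pi * Complex.I * t) :=
    Complex.contDiff_exp.comp (contDiff_const.mul Complex.ofRealCLM.contDiff)
  rw [expo_eq_comp, (dotCLM ξ).iteratedFDeriv_comp_right hsm x (by exact_mod_cast le_top)]
  refine (ContinuousMultilinearMap.norm_compContinuousLinearMap_le _ _).trans ?_
  rw [norm_iteratedFDeriv_eq_norm_iteratedDeriv, iteratedDeriv_exp_real]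
  have h1 : ‖(2 * Real.pi * Complex.I) ^ k * Complex.exp (2 * Real.pi * Complex.I * (dotCLM ξ x : ℝ))‖
      = (2 * Real.pi) ^ k := by
    have : 2 * Real.pi * Complex.I * (dotCLM ξ x : ℝ)
        = ((2 * Real.pi * dotCLM ξ x : ℝ) : ℂ) * Complex.I := by push_cast; ring
    rw [norm_mul, this, Complex.norm_exp_ofReal_mul_I]
    simp [abs_of_pos Real.pi_pos]
  rw [h1, Finset.prod_const, Finset.card_univ, Fintype.card_fin, ← mul_pow]
  have h2 : ‖dotCLM ξ‖ ≤ (n + 1) * rho ξ := by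
    have := norm_dotCLM_le ξ
    have := rho_pos ξ
    linarith
  rw [mul_assoc (2 * Real.pi)]
  have := Real.pi_pos
  gcongr

theorem pderivFun_apply {n : ℕ} (j : Fin n) (φ : PSmooth n) (x : Fin n → ℝ) :
    (pderivFun j φ).1 x = fderiv ℝ φ.1 x (Pi.single j 1) := rfl

theorem psmooth_differentiableAt {n : ℕ} (φ : PSmooth n) (x : Fin n → ℝ) :
    DifferentiableAt ℝ φ.1 x := φ.2.1.differentiable (by simp) x

theorem psmooth_continuous {n : ℕ} (φ : PSmooth n) : Continuous φ.1 := φ.2.1.continuous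

theorem pderivFun_mul {n : ℕ} (j : Fin n) (φ ψ : PSmooth n) :
    pderivFun j (φ * ψ) = φ * pderivFun j ψ + pderivFun j φ * ψ := by
  ext x
  show fderiv ℝ (fun y => φ.1 y * ψ.1 y) x _ =
    φ.1 x * fderiv ℝ ψ.1 x _ + fderiv ℝ φ.1 x _ * ψ.1 x
  rw [fderiv_fun_mul (psmooth_differentiableAt φ x) (psmooth_differentiableAt ψ x)]
  simp only [add_apply, smul_apply, smul_eq_mul]
  ring

theorem pderivFun_expo {n : ℕ} (j : Fin n) (ξ : Fin n → ℤ) :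
    pderivFun j (expo ξ) = (2 * Real.pi * Complex.I * ξ j) • expo ξ := by
  ext x
  show fderiv ℝ (expo ξ).1 x (Pi.single j 1) = (2 * Real.pi * Complex.I * ξ j) * (expo ξ).1 x
  have h : HasDerivAt (fun t : ℝ => Complex.exp (2 * Real.pi * Complex.I * t))
      (Complex.exp (2 * Real.pi * Complex.I * (dotCLM ξ x : ℝ)) * (2 * Real.pi * Complex.I))
      (dotCLM ξ x) := by
    have := ((hasDerivAt_id (dotCLM ξ x)).ofReal_comp.const_mul (2 * Real.pi * Complex.I)).cexp
    simpa using this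
  have h2 := (h.hasFDerivAt.comp x (dotCLM ξ).hasFDerivAt).fderiv
  rw [expo_eq_comp]
  refine (congrArg (fun L => L (Pi.single j 1)) h2).trans ?_
  simp only [ContinuousLinearMap.comp_apply, dotCLM_apply, Function.comp, Pi.single_apply,
    mul_ite, mul_one, mul_zero, Finset.sum_ite_eq', Finset.mem_univ, if_true,
    ContinuousLinearMap.toSpanSingleton_apply, Complex.real_smul]
  push_cast
  ring

open MeasureTheory

/-! ### Fourier coefficients of smooth functions -/

/-- The Fourier coefficient of a smooth periodic function. -/
def coeff {n : ℕ} (φ : PSmooth n) (ξ : Fin n → ℤ) : ℂ :=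
  ∫ x in Set.Icc (0 : Fin n → ℝ) 1, φ.1 x * (expo (-ξ)).1 x

theorem integrableOn_cube {n : ℕ} {f : (Fin n → ℝ) → ℂ} (hf : Continuous f) :
    IntegrableOn f (Set.Icc (0 : Fin n → ℝ) 1) :=
  hf.continuousOn.integrableOn_compact isCompact_Icc

theorem integrableOn_mul {n : ℕ} (φ ψ : PSmooth n) :
    IntegrableOn (fun x => φ.1 x * ψ.1 x) (Set.Icc (0 : Fin n → ℝ) 1) :=
  integrableOn_cube ((psmooth_continuous φ).mul (psmooth_continuous ψ))

/-- Divergence theorem on the unit cube for the field whose only nonzero component is the `j`-th: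
the contributions of opposite faces cancel by periodicity. -/
theorem integral_pderivFun {n : ℕ} (j : Fin n) (φ : PSmooth n) :
    ∫ x in Set.Icc (0 : Fin n → ℝ) 1, (pderivFun j φ).1 x = 0 := by
  obtain _ | m := n
  · exact j.elim0
  have key := integral_divergence_of_hasFDerivAt_off_countable' (0 : Fin (m + 1) → ℝ) 1
    zero_le_one (fun i => if i = j then φ.1 else 0)
    (fun i x => if i = j then fderiv ℝ φ.1 x else 0) ∅ Set.countable_empty
    (fun i => by
      split_ifs
      · exact (psmooth_continuous φ).continuousOn
      · exact continuousOn_const)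
    (fun x _ i => by
      split_ifs
      · exact (psmooth_differentiableAt φ x).hasFDerivAt
      · exact hasFDerivAt_const 0 x)
    (by
      have : (fun x => ∑ i, (if i = j then fderiv ℝ φ.1 x else 0) (Pi.single i (1 : ℝ)))
          = (pderivFun j φ).1 := by
        funext x
        rw [Finset.sum_eq_single j (fun i _ hi => by simp [hi]) (by simp)]
        simp [pderivFun_apply]
      rw [this]
      exact integrableOn_cube (psmooth_continuous _))
  have h1 : ∀ x, ∑ i, (if i = j then fderiv ℝ φ.1 x else 0) (Pi.single i (1 : ℝ))
      = (pderivFun j φ).1 x := fun x => by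
    rw [Finset.sum_eq_single j (fun i _ hi => by simp [hi]) (by simp)]
    simp [pderivFun_apply]
  simp only [h1] at key
  rw [key]
  refine Finset.sum_eq_zero fun i _ => ?_
  by_cases hi : i = j
  · subst hi
    simp only [if_true]
    rw [sub_eq_zero]
    congr 1
    funext x
    rw [← φ.2.2 (Pi.single i 1) (i.insertNth ((0 : Fin (m + 1) → ℝ) i) x)]
    refine congrArg φ.1 (funext fun k => ?_)
    refine Fin.succAboveCases i ?_ (fun l => ?_) k
    · simp
    · simp
  · simp [hi]

/-- Integration by parts, in the form that the derivative of `φ · expo (-ξ)` has zero integral. -/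
theorem coeff_pderivFun {n : ℕ} (j : Fin n) (φ : PSmooth n) (ξ : Fin n → ℤ) :
    coeff (pderivFun j φ) ξ = 2 * Real.pi * Complex.I * ξ j * coeff φ ξ := by
  have h := integral_pderivFun j (φ * expo (-ξ))
  rw [pderivFun_mul, pderivFun_expo] at h
  have h2 : ∀ x, (φ * (2 * Real.pi * Complex.I * ((-ξ) j : ℤ)) • expo (-ξ)
      + pderivFun j φ * expo (-ξ) : PSmooth n).1 x
      = -(2 * Real.pi * Complex.I * ξ j) * (φ.1 x * (expo (-ξ)).1 x)
        + (pderivFun j φ).1 x * (expo (-ξ)).1 x := fun x => by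
    show φ.1 x * ((2 * Real.pi * Complex.I * ((-ξ) j : ℤ)) * (expo (-ξ)).1 x)
      + (pderivFun j φ).1 x * (expo (-ξ)).1 x = _
    rw [Pi.neg_apply]
    push_cast
    ring
  simp only [h2] at h
  rw [integral_add ((integrableOn_mul φ (expo (-ξ))).const_mul _)
    (integrableOn_mul (pderivFun j φ) (expo (-ξ))), integral_const_mul] at h
  unfold coeff
  linear_combination h

theorem coeff_add {n : ℕ} (φ ψ : PSmooth n) (ξ : Fin n → ℤ) :
    coeff (φ + ψ) ξ = coeff φ ξ + coeff ψ ξ := by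
  unfold coeff
  rw [← integral_add (integrableOn_mul φ (expo (-ξ))) (integrableOn_mul ψ (expo (-ξ)))]
  refine integral_congr_ae (ae_of_all _ fun x => ?_)
  show (φ.1 x + ψ.1 x) * _ = _
  ring

theorem coeff_smul {n : ℕ} (c : ℂ) (φ : PSmooth n) (ξ : Fin n → ℤ) :
    coeff (c • φ) ξ = c * coeff φ ξ := by
  unfold coeff
  rw [← integral_const_mul]
  refine integral_congr_ae (ae_of_all _ fun x => ?_)
  show (c * φ.1 x) * _ = _
  ring

/-- The linear functional `φ ↦ coeff φ ξ`. -/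
def coeffLin {n : ℕ} (ξ : Fin n → ℤ) : PSmooth n →ₗ[ℂ] ℂ where
  toFun φ := coeff φ ξ
  map_add' φ ψ := coeff_add φ ψ ξ
  map_smul' c φ := coeff_smul c φ ξ

/-- All derivatives of `φ` of order at most `N` are bounded by `M`. -/
def DerivBound {n : ℕ} (N : ℕ) (φ : PSmooth n) (M : ℝ) : Prop :=
  ∀ k ≤ N, ∀ x, ‖iteratedFDeriv ℝ k φ.1 x‖ ≤ M

theorem DerivBound.norm_le {n N : ℕ} {φ : PSmooth n} {M : ℝ} (h : DerivBound N φ M)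
    (x : Fin n → ℝ) : ‖φ.1 x‖ ≤ M := by
  simpa using h 0 (Nat.zero_le _) x

theorem DerivBound.nonneg {n N : ℕ} {φ : PSmooth n} {M : ℝ} (h : DerivBound N φ M) : 0 ≤ M :=
  (norm_nonneg _).trans (h 0 (Nat.zero_le _) 0)

theorem DerivBound.mono {n N N' : ℕ} {φ : PSmooth n} {M : ℝ} (h : DerivBound N φ M)
    (hN : N' ≤ N) : DerivBound N' φ M := fun k hk => h k (hk.trans hN)

theorem DerivBound.add {n N : ℕ} {φ ψ : PSmooth n} {M M' : ℝ} (h : DerivBound N φ M)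
    (h' : DerivBound N ψ M') : DerivBound N (φ + ψ) (M + M') := fun k hk x => by
  show ‖iteratedFDeriv ℝ k (φ.1 + ψ.1) x‖ ≤ _
  rw [iteratedFDeriv_add_apply (φ.2.1.of_le (by exact_mod_cast le_top)).contDiffAt
    (ψ.2.1.of_le (by exact_mod_cast le_top)).contDiffAt]
  exact (norm_add_le _ _).trans (add_le_add (h k hk x) (h' k hk x))

theorem DerivBound.smul {n N : ℕ} {φ : PSmooth n} {M : ℝ} (h : DerivBound N φ M) (c : ℂ) :
    DerivBound N (c • φ) (‖c‖ * M) := fun k hk x => by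
  show ‖iteratedFDeriv ℝ k (c • φ.1) x‖ ≤ _
  rw [iteratedFDeriv_const_smul_apply (φ.2.1.of_le (by exact_mod_cast le_top)).contDiffAt,
    norm_smul]
  exact mul_le_mul_of_nonneg_left (h k hk x) (norm_nonneg _)

theorem DerivBound.sum {n N : ℕ} {ι : Type*} (s : Finset ι) {φ : ι → PSmooth n} {M : ι → ℝ}
    (h : ∀ i ∈ s, DerivBound N (φ i) (M i)) : DerivBound N (∑ i ∈ s, φ i) (∑ i ∈ s, M i) := by
  classical
  induction s using Finset.induction_on with
  | empty =>
    intro k _ x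
    have h0 : ((0 : PSmooth n).1) = fun _ => 0 := rfl
    rw [Finset.sum_empty, h0, iteratedFDeriv_fun_zero]
    simp
  | insert a s ha ih =>
    rw [Finset.sum_insert ha, Finset.sum_insert ha]
    exact (h a (Finset.mem_insert_self _ _)).add
      (ih fun i hi => h i (Finset.mem_insert_of_mem hi))

theorem DerivBound.pderivFun {n N : ℕ} {φ : PSmooth n} {M : ℝ} (h : DerivBound (N + 1) φ M)
    (j : Fin n) : DerivBound N (pderivFun j φ) M := fun k hk x => by
  have h1 : ‖iteratedFDeriv ℝ k (fun y => fderiv ℝ φ.1 y (Pi.single j 1)) x‖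
      ≤ ‖(Pi.single j 1 : Fin n → ℝ)‖ * ‖iteratedFDeriv ℝ k (fderiv ℝ φ.1) x‖ :=
    norm_iteratedFDeriv_clm_apply_const
      ((φ.2.1.fderiv_right (m := ∞) (by simp)).contDiffAt) (by exact_mod_cast le_top)
  rw [norm_iteratedFDeriv_fderiv, Pi.norm_single, norm_one, one_mul] at h1
  exact h1.trans (h (k + 1) (by omega) x)

/-- The operator `1 - Δ / (4 π²)`, which multiplies Fourier coefficients by `ρ(ξ)²`. -/
def bessel {n : ℕ} (φ : PSmooth n) : PSmooth n :=
  φ + (-(1 / (4 * Real.pi ^ 2)) : ℂ) • ∑ j, PeriodicOseen.pderivFun j (PeriodicOseen.pderivFun j φ)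

theorem coeff_bessel {n : ℕ} (φ : PSmooth n) (ξ : Fin n → ℤ) :
    coeff (bessel φ) ξ = (rho ξ : ℂ) ^ 2 * coeff φ ξ := by
  have h : coeff (∑ j, pderivFun j (pderivFun j φ)) ξ
      = ∑ j, coeff (pderivFun j (pderivFun j φ)) ξ := map_sum (coeffLin ξ) _ _
  rw [bessel, coeff_add, coeff_smul, h]
  have h2 : (rho ξ : ℂ) ^ 2 = 1 + ∑ i, (ξ i : ℂ) ^ 2 := by exact_mod_cast rho_sq ξ
  simp only [coeff_pderivFun, h2, add_mul, Finset.sum_mul, one_mul, Finset.mul_sum]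
  congr 1
  refine Finset.sum_congr rfl fun j _ => ?_
  have hpi : (Real.pi : ℂ) ≠ 0 := by exact_mod_cast Real.pi_ne_zero
  field_simp
  rw [Complex.I_sq]
  ring

theorem DerivBound.bessel {n N : ℕ} {φ : PSmooth n} {M : ℝ} (h : DerivBound (N + 2) φ M) :
    DerivBound N (bessel φ) ((1 + n) * M) := by
  have h1 : DerivBound N ((-(1 / (4 * Real.pi ^ 2)) : ℂ) •
      ∑ j, PeriodicOseen.pderivFun j (PeriodicOseen.pderivFun j φ)) _ :=
    (DerivBound.sum Finset.univ fun j _ =>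
      DerivBound.pderivFun (DerivBound.pderivFun (N := N + 1) h j) j).smul _
  have h2 := (h.mono (N' := N) (by omega)).add h1
  intro k hk x
  refine (h2 k hk x).trans ?_
  have hc : ‖(-(1 / (4 * Real.pi ^ 2)) : ℂ)‖ ≤ 1 := by
    rw [norm_neg, norm_div, norm_one, norm_mul, norm_pow, Complex.norm_real]
    rw [div_le_one (by have := Real.pi_pos; simp; positivity)]
    have := Real.pi_gt_three
    simp [abs_of_pos Real.pi_pos]
    nlinarith
  have hM := h.nonneg
  simp only [Finset.sum_const, Finset.card_univ, Fintype.card_fin, nsmul_eq_mul]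
  have : ‖(-(1 / (4 * Real.pi ^ 2)) : ℂ)‖ * (n * M) ≤ 1 * (n * M) :=
    mul_le_mul_of_nonneg_right hc (by positivity)
  linarith

theorem norm_coeff_le {n : ℕ} {φ : PSmooth n} {M : ℝ} (h : ∀ x, ‖φ.1 x‖ ≤ M) (ξ : Fin n → ℤ) :
    ‖coeff φ ξ‖ ≤ M := by
  have := norm_setIntegral_le_of_norm_le_const (μ := volume) (s := Set.Icc (0 : Fin n → ℝ) 1)
    (C := M) (f := fun x => φ.1 x * (expo (-ξ)).1 x) isCompact_Icc.measure_lt_top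
    (fun x _ => by rw [norm_mul, norm_expo, mul_one]; exact h x)
  simpa [coeff, measureReal_def, Real.volume_Icc_pi] using this

/-- Rapid decay of the Fourier coefficients of a smooth function. -/
theorem rho_pow_mul_norm_coeff_le {n : ℕ} (N : ℕ) : ∀ {φ : PSmooth n} {M : ℝ},
    DerivBound (2 * N) φ M → ∀ ξ, rho ξ ^ (2 * N) * ‖coeff φ ξ‖ ≤ (1 + n) ^ N * M := by
  induction N with
  | zero =>
    intro φ M h ξ
    simpa using norm_coeff_le h.norm_le ξ
  | succ N ih =>
    intro φ M h ξ
    have := ih (DerivBound.bessel (N := 2 * N) h) ξ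
    rw [coeff_bessel, norm_mul, norm_pow, Complex.norm_real, Real.norm_of_nonneg (rho_pos ξ).le]
      at this
    calc _ = rho ξ ^ (2 * N) * (rho ξ ^ 2 * ‖coeff φ ξ‖) := by ring
      _ ≤ _ := this
      _ = _ := by ring

theorem exists_derivBound {n : ℕ} (φ : PSmooth n) (N : ℕ) : ∃ M, DerivBound N φ M :=
  let ⟨B, _, hB⟩ := bounded_iteratedFDeriv φ N
  ⟨B, hB⟩

theorem exists_rho_pow_mul_norm_coeff_le {n : ℕ} (φ : PSmooth n) (N : ℕ) :
    ∃ K, 0 ≤ K ∧ ∀ ξ, rho ξ ^ N * ‖coeff φ ξ‖ ≤ K := by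
  obtain ⟨M, hM⟩ := exists_derivBound φ (2 * N)
  refine ⟨(1 + n) ^ N * M, mul_nonneg (by positivity) hM.nonneg, fun ξ => ?_⟩
  refine le_trans ?_ (rho_pow_mul_norm_coeff_le N hM ξ)
  exact mul_le_mul_of_nonneg_right (pow_le_pow_right₀ (one_le_rho ξ) (by omega)) (norm_nonneg _)

theorem summable_of_rho_pow_mul_le {n : ℕ} {c : (Fin n → ℤ) → ℝ} (h0 : ∀ ξ, 0 ≤ c ξ) {K : ℝ}
    (h : ∀ ξ, rho ξ ^ (2 * n) * c ξ ≤ K) : Summable c := by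
  refine Summable.of_nonneg_of_le h0 (fun ξ => ?_) ((summable_rho_inv n).mul_left K)
  rw [← div_eq_mul_inv, le_div_iff₀ (pow_pos (rho_pos ξ) _), mul_comm]
  exact h ξ

theorem summable_rho_pow_mul_norm_coeff {n : ℕ} (φ : PSmooth n) (N : ℕ) :
    Summable fun ξ => rho ξ ^ N * ‖coeff φ ξ‖ := by
  obtain ⟨K, -, hK⟩ := exists_rho_pow_mul_norm_coeff_le φ (2 * n + N)
  refine summable_of_rho_pow_mul_le (fun ξ => by have := rho_pos ξ; positivity) (K := K) fun ξ => ?_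
  rw [← mul_assoc, ← pow_add]
  exact hK ξ

/-! ### Fourier series of smooth functions -/

theorem derivConst_pow_mono {n : ℕ} (ξ : Fin n → ℤ) {k N : ℕ} (h : k ≤ N) :
    (2 * Real.pi * (n + 1) * rho ξ) ^ k ≤ (2 * Real.pi * (n + 1) * rho ξ) ^ N := by
  refine pow_le_pow_right₀ ?_ h
  have h1 : (1 : ℝ) ≤ 2 * Real.pi := by linarith [Real.pi_gt_three]
  have h2 : (1 : ℝ) ≤ n + 1 := by simp
  exact one_le_mul_of_one_le_of_one_le (one_le_mul_of_one_le_of_one_le h1 h2) (one_le_rho ξ)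

theorem norm_iteratedFDeriv_smul_expo_le {n : ℕ} (c : ℂ) (ξ : Fin n → ℤ) (k : ℕ)
    (x : Fin n → ℝ) : ‖iteratedFDeriv ℝ k (fun x => c * (expo ξ).1 x) x‖
      ≤ ‖c‖ * (2 * Real.pi * (n + 1) * rho ξ) ^ k := by
  have h := iteratedFDeriv_const_smul_apply (𝕜 := ℝ) (i := k) (a := c) (f := (expo ξ).1) (x := x)
    ((expo ξ).2.1.of_le (by exact_mod_cast le_top)).contDiffAt
  have h2 : (fun x => c * (expo ξ).1 x) = c • (expo ξ).1 := rfl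
  rw [h2, h, norm_smul]
  exact mul_le_mul_of_nonneg_left (norm_iteratedFDeriv_expo_le ξ k x) (norm_nonneg _)

section Series

variable {n : ℕ} {ι : Type*} {κ : ι → Fin n → ℤ} {c : ι → ℂ}

theorem summable_derivConst (h : ∀ N : ℕ, Summable fun i => rho (κ i) ^ N * ‖c i‖) (N : ℕ) :
    Summable fun i => ‖c i‖ * (2 * Real.pi * (n + 1) * rho (κ i)) ^ N := by
  refine ((h N).mul_left ((2 * Real.pi * (n + 1)) ^ N)).congr fun i => ?_
  rw [mul_pow _ (rho (κ i))]
  ring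

/-- A trigonometric series with rapidly decreasing coefficients, as a smooth function. -/
def fourierSum (κ : ι → Fin n → ℤ) (c : ι → ℂ)
    (h : ∀ N : ℕ, Summable fun i => rho (κ i) ^ N * ‖c i‖) : PSmooth n :=
  ⟨fun x => ∑' i, c i * (expo (κ i)).1 x, by
    constructor
    · refine contDiff_tsum (N := (⊤ : ℕ∞)) (v := fun k i => ‖c i‖ * (2 * Real.pi * (n + 1) * rho (κ i)) ^ k)
        (fun i => contDiff_const.mul (expo (κ i)).2.1) (fun k _ => summable_derivConst h k)
        fun k i x _ => norm_iteratedFDeriv_smul_expo_le _ _ _ _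
    · intro ξ x
      simp only [(expo _).2.2 ξ x]⟩

theorem derivBound_fourierSum (h : ∀ N : ℕ, Summable fun i => rho (κ i) ^ N * ‖c i‖) (N : ℕ) :
    DerivBound N (fourierSum κ c h)
      (∑' i, ‖c i‖ * (2 * Real.pi * (n + 1) * rho (κ i)) ^ N) := fun k hk x => by
  have h1 := iteratedFDeriv_tsum_apply (𝕜 := ℝ) (N := (⊤ : ℕ∞)) (f := fun i x => c i * (expo (κ i)).1 x)
    (v := fun k i => ‖c i‖ * (2 * Real.pi * (n + 1) * rho (κ i)) ^ k)
    (fun i => contDiff_const.mul (expo (κ i)).2.1) (fun k _ => summable_derivConst h k)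
    (fun k i x _ => norm_iteratedFDeriv_smul_expo_le _ _ _ _) (k := k) le_top x
  show ‖iteratedFDeriv ℝ k (fun x => ∑' i, c i * (expo (κ i)).1 x) x‖ ≤ _
  rw [h1]
  exact tsum_of_norm_bounded (summable_derivConst h N).hasSum fun i =>
    (norm_iteratedFDeriv_smul_expo_le _ _ _ _).trans
      (mul_le_mul_of_nonneg_left (derivConst_pow_mono _ hk) (norm_nonneg _))

end Series

/-- The projection of `ℝⁿ` onto the torus. -/
def toTorus (n : ℕ) : C(Fin n → ℝ, UnitAddTorus (Fin n)) :=
  ⟨fun x i => (x i : UnitAddCircle),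
    continuous_pi fun i => (AddCircle.continuous_mk' 1).comp (continuous_apply i)⟩

theorem isQuotientMap_toTorus (n : ℕ) : Topology.IsQuotientMap (toTorus n) := by
  have h : IsOpenQuotientMap (Pi.map fun _ : Fin n => ((↑) : ℝ → UnitAddCircle)) :=
    IsOpenQuotientMap.piMap fun _ => QuotientAddGroup.isOpenQuotientMap_mk
  exact h.isQuotientMap

theorem torusLift_factors {n : ℕ} (φ : PSmooth n) :
    Function.FactorsThrough (⟨φ.1, psmooth_continuous φ⟩ : C(Fin n → ℝ, ℂ)) (toTorus n) := by
  intro x y hxy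
  have h : ∀ i, ∃ k : ℤ, y i = x i + k := fun i => by
    have h1 : (x i : UnitAddCircle) = y i := congrFun hxy i
    obtain ⟨k, hk⟩ := AddSubgroup.mem_zmultiples_iff.1 (QuotientAddGroup.eq.1 h1)
    refine ⟨k, ?_⟩
    simp only [zsmul_eq_mul, mul_one] at hk
    linarith
  choose k hk using h
  show φ.1 x = φ.1 y
  rw [funext hk, φ.2.2 k x]

/-- The function on the torus defined by a smooth periodic function. -/
def torusLift {n : ℕ} (φ : PSmooth n) : C(UnitAddTorus (Fin n), ℂ) :=
  (isQuotientMap_toTorus n).lift ⟨φ.1, psmooth_continuous φ⟩ (torusLift_factors φ)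

theorem torusLift_apply {n : ℕ} (φ : PSmooth n) (x : Fin n → ℝ) :
    torusLift φ (toTorus n x) = φ.1 x :=
  congrFun (congrArg DFunLike.coe ((isQuotientMap_toTorus n).lift_comp ⟨φ.1, psmooth_continuous φ⟩ (torusLift_factors φ))) x

theorem mFourier_toTorus {n : ℕ} (ξ : Fin n → ℤ) (x : Fin n → ℝ) :
    UnitAddTorus.mFourier ξ (toTorus n x) = (expo ξ).1 x := by
  show ∏ i, fourier (ξ i) (x i : UnitAddCircle) = _
  simp only [fourier_coe_apply]
  rw [← Complex.exp_sum, expo_apply, Finset.mul_sum]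
  congr 1
  refine Finset.sum_congr rfl fun i _ => ?_
  push_cast
  ring

theorem mFourierCoeff_torusLift {n : ℕ} (φ : PSmooth n) (ξ : Fin n → ℤ) :
    UnitAddTorus.mFourierCoeff (torusLift φ) ξ = coeff φ ξ := by
  rw [UnitAddTorus.mFourierCoeff_eq_integral _ _ 0, coeff]
  have hs : {x : Fin n → ℝ | ∀ i, x i ∈ Set.Ioc ((0 : Fin n → ℝ) i) ((0 : Fin n → ℝ) i + 1)}
      = Set.univ.pi fun i => Set.Ioc ((0 : Fin n → ℝ) i) ((1 : Fin n → ℝ) i) := by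
    ext x
    simp
  rw [hs, volume_pi, setIntegral_congr_set Measure.univ_pi_Ioc_ae_eq_Icc]
  refine integral_congr_ae (ae_of_all _ fun x => ?_)
  show UnitAddTorus.mFourier (-ξ) (toTorus n x) * torusLift φ (toTorus n x) = _
  rw [mFourier_toTorus, torusLift_apply, mul_comm]

/-- The coefficients are absolutely summable, so the Fourier series of the continuous lift to the
torus converges pointwise to that lift. -/
theorem hasSum_coeff_mul_expo {n : ℕ} (φ : PSmooth n) (x : Fin n → ℝ) :
    HasSum (fun ζ => coeff φ ζ * (expo ζ).1 x) (φ.1 x) := by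
  have hc : (UnitAddTorus.mFourierCoeff (torusLift φ)) = coeff φ :=
    funext (mFourierCoeff_torusLift φ)
  have h : Summable (UnitAddTorus.mFourierCoeff (torusLift φ)) := by
    rw [hc]
    exact Summable.of_norm (by simpa using summable_rho_pow_mul_norm_coeff φ 0)
  have h2 := UnitAddTorus.hasSum_mFourier_series_apply_of_summable h (toTorus n x)
  rw [hc, torusLift_apply] at h2
  simpa only [mFourier_toTorus, smul_eq_mul] using h2

/-- The Fourier series of a smooth function can be evaluated under a distribution. -/
theorem hasSum_coeff_mul_dist {n : ℕ} (g : PDist n) (φ : PSmooth n) :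
    HasSum (fun ζ => coeff φ ζ * g.1 (expo ζ)) (g.1 φ) := by
  obtain ⟨N, C, hC, hg⟩ := g.2
  have hs : ∀ (F : Finset (Fin n → ℤ)) (M : ℕ),
      Summable fun i : {ζ // ζ ∉ F} => rho i.1 ^ M * ‖coeff φ i‖ := fun F M =>
    (summable_rho_pow_mul_norm_coeff φ M).comp_injective Subtype.val_injective
  -- The remainder of a partial sum is itself a smooth periodic function, with derivatives bounded
  -- by the tail of a convergent series. Continuity of `g` then sends it to zero.
  have hrem : ∀ F : Finset (Fin n → ℤ), φ = ∑ ζ ∈ F, coeff φ ζ • expo ζ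
      + fourierSum (fun i : {ζ // ζ ∉ F} => i.1) (fun i => coeff φ i) (hs F) := fun F => by
    ext x
    have h1 := (hasSum_coeff_mul_expo φ x)
    have h2 := h1.summable.sum_add_tsum_subtype_compl F
    rw [h1.tsum_eq] at h2
    rw [← h2]
    show _ = (∑ ζ ∈ F, coeff φ ζ • expo ζ : PSmooth n).1 x + ∑' i : {ζ // ζ ∉ F}, _
    congr 1
    rw [AddSubmonoidClass.coe_finsetSum, Finset.sum_apply]
    rfl
  have hlin : ∀ F : Finset (Fin n → ℤ), g.1 φ - ∑ ζ ∈ F, coeff φ ζ * g.1 (expo ζ)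
      = g.1 (fourierSum (fun i : {ζ // ζ ∉ F} => i.1) (fun i => coeff φ i) (hs F)) := fun F => by
    have h1 := congrArg g.1 (hrem F)
    rw [map_add, map_sum] at h1
    simp only [map_smul, smul_eq_mul] at h1
    rw [h1, add_sub_cancel_left]
  rw [HasSum, SummationFilter.unconditional_filter, tendsto_iff_norm_sub_tendsto_zero]
  have ht := (tendsto_tsum_compl_atTop_zero
    fun ζ => ‖coeff φ ζ‖ * (2 * Real.pi * (n + 1) * rho ζ) ^ N).const_mul C
  rw [mul_zero] at ht
  refine squeeze_zero (fun _ => norm_nonneg _) (fun F => ?_) ht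
  rw [norm_sub_rev, hlin]
  exact hg _ _ (derivBound_fourierSum (hs F) N)

/-! ### Distributions and their Fourier coefficients -/

theorem fourierCoeff_add {n : ℕ} (g h : PDist n) (ξ : Fin n → ℤ) :
    fourierCoeff (g + h) ξ = fourierCoeff g ξ + fourierCoeff h ξ := rfl

theorem fourierCoeff_neg {n : ℕ} (g : PDist n) (ξ : Fin n → ℤ) :
    fourierCoeff (-g) ξ = -fourierCoeff g ξ := rfl

theorem fourierCoeff_smul {n : ℕ} (c : ℂ) (g : PDist n) (ξ : Fin n → ℤ) :
    fourierCoeff (c • g) ξ = c * fourierCoeff g ξ := rfl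

/-- The linear functional `g ↦ ĝ(ξ)`. -/
def fourierCoeffLin {n : ℕ} (ξ : Fin n → ℤ) : PDist n →ₗ[ℂ] ℂ where
  toFun g := fourierCoeff g ξ
  map_add' _ _ := rfl
  map_smul' _ _ := rfl

theorem fourierCoeff_sum {n : ℕ} {ι : Type*} (s : Finset ι) (g : ι → PDist n) (ξ : Fin n → ℤ) :
    fourierCoeff (∑ i ∈ s, g i) ξ = ∑ i ∈ s, fourierCoeff (g i) ξ :=
  map_sum (fourierCoeffLin ξ) g s

theorem fourierCoeff_injective {n : ℕ} {g h : PDist n}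
    (H : ∀ ξ, fourierCoeff g ξ = fourierCoeff h ξ) : g = h := by
  refine Subtype.ext (LinearMap.ext fun φ => ?_)
  have h1 : ∀ ζ, g.1 (expo ζ) = h.1 (expo ζ) := fun ζ => by
    have := H (-ζ)
    simpa only [fourierCoeff, neg_neg] using this
  have h2 := hasSum_coeff_mul_dist g φ
  simp only [h1] at h2
  exact h2.unique (hasSum_coeff_mul_dist h φ)

theorem mem_zeroMean_iff {n : ℕ} (g : PDist n) : g ∈ zeroMean n ↔ fourierCoeff g 0 = 0 := by
  rw [fourierCoeff, neg_zero, expo_zero]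
  rfl

theorem fourierCoeff_pderiv {n : ℕ} (j : Fin n) (g : PDist n) (ξ : Fin n → ℤ) :
    fourierCoeff (pderiv j g) ξ = 2 * Real.pi * Complex.I * ξ j * fourierCoeff g ξ := by
  show -(g.1 (pderivFun j (expo (-ξ)))) = _ * g.1 (expo (-ξ))
  rw [pderivFun_expo, map_smul, smul_eq_mul, Pi.neg_apply]
  push_cast
  ring

/-- The convolution formula comes from regarding `⟨ψ g, e⟩` as the distribution `e g` tested against
`ψ`, and expanding `ψ` in its Fourier series. -/
theorem hasSum_fourierCoeff_mulSmooth {n : ℕ} (ψ : PSmooth n) (g : PDist n) (ξ : Fin n → ℤ) :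
    HasSum (fun ζ => coeff ψ ζ * fourierCoeff g (ξ - ζ)) (fourierCoeff (mulSmooth ψ g) ξ) := by
  have h := hasSum_coeff_mul_dist (mulSmooth (expo (-ξ)) g) ψ
  have h1 : ∀ ζ, (mulSmooth (expo (-ξ)) g).1 (expo ζ) = fourierCoeff g (ξ - ζ) := fun ζ => by
    show g.1 (expo (-ξ) * expo ζ) = g.1 _
    rw [← expo_add]
    congr 2
    abel
  have h2 : (mulSmooth (expo (-ξ)) g).1 ψ = fourierCoeff (mulSmooth ψ g) ξ := by
    show g.1 (expo (-ξ) * ψ) = g.1 (ψ * expo (-ξ))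
    rw [mul_comm]
  simpa only [h1, h2] using h

theorem coeff_expo {n : ℕ} (η ζ : Fin n → ℤ) : coeff (expo η) ζ = if ζ = η then 1 else 0 := by
  have h : coeff (expo η) ζ = ∫ x in Set.Icc (0 : Fin n → ℝ) 1, (expo (η - ζ)).1 x := by
    unfold coeff
    rw [sub_eq_add_neg, expo_add]
    rfl
  rw [h]
  split_ifs with he
  · rw [he, sub_self, expo_zero]
    show ∫ x in Set.Icc (0 : Fin n → ℝ) 1, (1 : ℂ) = 1
    simp [measureReal_def, Real.volume_Icc_pi]
  · obtain ⟨j, hj⟩ : ∃ j, (η - ζ) j ≠ 0 := by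
      by_contra! hc
      exact he (sub_eq_zero.1 (funext hc)).symm
    have h1 := integral_pderivFun j (expo (η - ζ))
    rw [pderivFun_expo] at h1
    have h2 : ∫ x in Set.Icc (0 : Fin n → ℝ) 1,
        (2 * Real.pi * Complex.I * ((η - ζ) j : ℤ)) * (expo (η - ζ)).1 x = 0 := h1
    rw [integral_const_mul] at h2
    refine (mul_eq_zero.1 h2).resolve_left ?_
    have hpi : (Real.pi : ℂ) ≠ 0 := by exact_mod_cast Real.pi_ne_zero
    have hj' : (((η - ζ) j : ℤ) : ℂ) ≠ 0 := by exact_mod_cast hj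
    exact mul_ne_zero (mul_ne_zero (mul_ne_zero two_ne_zero hpi) Complex.I_ne_zero) hj'

/-- A bound for the coefficients that yields a distribution. -/
def PolyBounded {n : ℕ} (c : (Fin n → ℤ) → ℂ) : Prop :=
  ∃ (N : ℕ) (K : ℝ), 0 ≤ K ∧ ∀ ξ, ‖c ξ‖ ≤ K * rho ξ ^ N

/-- The derivatives of `φ` pay for `N` powers of growth and for the `2n` powers that make the sum
converge. The order is rounded up to an even number, as the decay of `coeff φ` is obtained through
powers of `bessel`. -/
theorem PolyBounded.norm_coeff_mul_le {n : ℕ} {c : (Fin n → ℤ) → ℂ} {N : ℕ} {K : ℝ} (hK : 0 ≤ K)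
    (hc : ∀ ξ, ‖c ξ‖ ≤ K * rho ξ ^ N) {φ : PSmooth n} {M : ℝ}
    (h : DerivBound (2 * (n + N)) φ M) (ζ : Fin n → ℤ) :
    ‖coeff φ ζ * c (-ζ)‖ ≤ K * ((1 + n) ^ (n + N) * M) * (rho ζ ^ (2 * n))⁻¹ := by
  rw [← div_eq_mul_inv, le_div_iff₀ (pow_pos (rho_pos ζ) _), norm_mul]
  have h1 := rho_pow_mul_norm_coeff_le (n + N) h ζ
  have h2 := hc (-ζ)
  rw [rho_neg] at h2
  have h3 : rho ζ ^ (2 * n + N) ≤ rho ζ ^ (2 * (n + N)) :=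
    pow_le_pow_right₀ (one_le_rho ζ) (by omega)
  have := rho_pos ζ
  calc ‖coeff φ ζ‖ * ‖c (-ζ)‖ * rho ζ ^ (2 * n)
      ≤ ‖coeff φ ζ‖ * (K * rho ζ ^ N) * rho ζ ^ (2 * n) := by gcongr
    _ = K * (rho ζ ^ (2 * n + N) * ‖coeff φ ζ‖) := by ring
    _ ≤ K * (rho ζ ^ (2 * (n + N)) * ‖coeff φ ζ‖) := by gcongr
    _ ≤ _ := by gcongr

theorem PolyBounded.summable {n : ℕ} {c : (Fin n → ℤ) → ℂ} (hc : PolyBounded c) (φ : PSmooth n) :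
    Summable fun ζ => coeff φ ζ * c (-ζ) := by
  obtain ⟨N, K, hK, h⟩ := hc
  obtain ⟨M, hM⟩ := exists_derivBound φ (2 * (n + N))
  exact Summable.of_norm_bounded ((summable_rho_inv n).mul_left _)
    (PolyBounded.norm_coeff_mul_le hK h hM)

/-- The distribution with prescribed Fourier coefficients of polynomial growth. -/
def ofCoeff {n : ℕ} (c : (Fin n → ℤ) → ℂ) (hc : PolyBounded c) : PDist n :=
  ⟨{ toFun := fun φ => ∑' ζ, coeff φ ζ * c (-ζ)
     map_add' := fun φ ψ => by
      rw [← (hc.summable φ).tsum_add (hc.summable ψ)]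
      simp only [coeff_add, add_mul]
     map_smul' := fun a φ => by
      simp only [coeff_smul, mul_assoc, tsum_mul_left, RingHom.id_apply, smul_eq_mul] }, by
    obtain ⟨N, K, hK, h⟩ := hc
    refine ⟨2 * (n + N), K * (1 + n) ^ (n + N) * ∑' ζ : Fin n → ℤ, (rho ζ ^ (2 * n))⁻¹,
      mul_nonneg (by positivity) (tsum_nonneg fun ζ => by have := rho_pos ζ; positivity),
      fun φ M hM => ?_⟩
    have h1 := tsum_of_norm_bounded ((summable_rho_inv n).mul_left _).hasSum
      (PolyBounded.norm_coeff_mul_le hK h (φ := φ) hM)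
    rw [tsum_mul_left] at h1
    refine h1.trans (le_of_eq ?_)
    ring⟩

theorem fourierCoeff_ofCoeff {n : ℕ} (c : (Fin n → ℤ) → ℂ) (hc : PolyBounded c) (ξ : Fin n → ℤ) :
    fourierCoeff (ofCoeff c hc) ξ = c ξ := by
  show ∑' ζ, coeff (expo (-ξ)) ζ * c (-ζ) = c ξ
  rw [tsum_eq_single (-ξ) fun ζ hζ => by rw [coeff_expo, if_neg hζ, zero_mul]]
  simp [coeff_expo]

/-- Rapid decay makes the Fourier series a smooth function; exchanging sum and integral identifies
that function with `g`. -/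
theorem isSmooth_iff {n : ℕ} (g : PDist n) :
    IsSmooth g ↔ ∀ N : ℕ, ∃ K, ∀ ξ, rho ξ ^ N * ‖fourierCoeff g ξ‖ ≤ K := by
  constructor
  · rintro ⟨ψ, hψ⟩ N
    have h : fourierCoeff g = coeff ψ := funext fun ξ => hψ (expo (-ξ))
    obtain ⟨K, -, hK⟩ := exists_rho_pow_mul_norm_coeff_le ψ N
    exact ⟨K, fun ξ => h ▸ hK ξ⟩
  · intro h
    have hs : ∀ N : ℕ, Summable fun ζ => rho ζ ^ N * ‖fourierCoeff g ζ‖ := fun N => by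
      obtain ⟨K, hK⟩ := h (2 * n + N)
      refine summable_of_rho_pow_mul_le (fun ξ => by have := rho_pos ξ; positivity) (K := K)
        fun ξ => ?_
      rw [← mul_assoc, ← pow_add]
      exact hK ξ
    refine ⟨fourierSum id (fourierCoeff g) hs, fun φ => ?_⟩
    obtain ⟨M, hM⟩ := exists_derivBound φ 0
    have h1 := hasSum_coeff_mul_dist g φ
    -- Testing against `expo ζ` produces the coefficient at `-ζ`, hence the reindexing.
    rw [← (Equiv.neg _).hasSum_iff] at h1
    have hint : ∀ ζ : Fin n → ℤ, IntegrableOn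
        (fun x => fourierCoeff g ζ * (expo ζ).1 x * φ.1 x) (Set.Icc (0 : Fin n → ℝ) 1) :=
      fun ζ => integrableOn_cube
        ((continuous_const.mul (psmooth_continuous _)).mul (psmooth_continuous _))
    have hle : ∀ ζ : Fin n → ℤ,
        ∫ x in Set.Icc (0 : Fin n → ℝ) 1, ‖fourierCoeff g ζ * (expo ζ).1 x * φ.1 x‖
          ≤ M * ‖fourierCoeff g ζ‖ := fun ζ => by
      have := setIntegral_mono (hint ζ).norm (g := fun _ => M * ‖fourierCoeff g ζ‖)
        (integrableOn_const isCompact_Icc.measure_lt_top.ne) fun x => by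
          rw [norm_mul, norm_mul, norm_expo, mul_one, mul_comm]
          exact mul_le_mul_of_nonneg_right (hM.norm_le x) (norm_nonneg _)
      simpa [measureReal_def, Real.volume_Icc_pi] using this
    have hs0 : Summable fun ζ => M * ‖fourierCoeff g ζ‖ := by simpa using (hs 0).mul_left M
    have h2 := hasSum_integral_of_summable_integral_norm hint
      (Summable.of_nonneg_of_le (fun ζ => integral_nonneg fun _ => norm_nonneg _) hle hs0)
    have h3 : ∀ x, ∑' ζ, fourierCoeff g ζ * (expo ζ).1 x * φ.1 x
        = (fourierSum id (fourierCoeff g) hs).1 x * φ.1 x := fun x => tsum_mul_right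
    simp only [h3] at h2
    have h4 : ∀ ζ, ∫ x in Set.Icc (0 : Fin n → ℝ) 1, fourierCoeff g ζ * (expo ζ).1 x * φ.1 x
        = coeff φ (-ζ) * g.1 (expo (-ζ)) := fun ζ => by
      simp only [mul_assoc]
      rw [integral_const_mul, mul_comm (coeff φ (-ζ))]
      show fourierCoeff g ζ * _ = fourierCoeff g ζ * _
      congr 1
      unfold coeff
      rw [neg_neg]
      simp only [mul_comm]
    simp only [h4] at h2
    exact h1.unique h2

/-! ### Complex conjugation -/

/-- The complex conjugate of a smooth periodic function. -/
def conjFun {n : ℕ} (φ : PSmooth n) : PSmooth n :=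
  ⟨fun x => (starRingEnd ℂ) (φ.1 x), Complex.conjCLE.contDiff.comp φ.2.1,
    fun ξ x => congrArg _ (φ.2.2 ξ x)⟩

theorem conjFun_conjFun {n : ℕ} (φ : PSmooth n) : conjFun (conjFun φ) = φ := by
  ext x
  exact Complex.conj_conj _

theorem conjFun_add {n : ℕ} (φ ψ : PSmooth n) : conjFun (φ + ψ) = conjFun φ + conjFun ψ := by
  ext x
  exact map_add (starRingEnd ℂ) _ _

theorem conjFun_mul {n : ℕ} (φ ψ : PSmooth n) : conjFun (φ * ψ) = conjFun φ * conjFun ψ := by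
  ext x
  exact map_mul (starRingEnd ℂ) _ _

theorem conjFun_smul {n : ℕ} (c : ℂ) (φ : PSmooth n) :
    conjFun (c • φ) = (starRingEnd ℂ) c • conjFun φ := by
  ext x
  exact map_mul (starRingEnd ℂ) _ _

theorem conjFun_eq_self {n : ℕ} {φ : PSmooth n} : conjFun φ = φ ↔ ∀ x, (φ.1 x).im = 0 := by
  constructor
  · intro h x
    exact Complex.conj_eq_iff_im.1 (congrFun (congrArg Subtype.val h) x)
  · intro h
    ext x
    exact Complex.conj_eq_iff_im.2 (h x)

theorem conjFun_expo {n : ℕ} (ξ : Fin n → ℤ) : conjFun (expo ξ) = expo (-ξ) := by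
  ext x
  exact conj_expo ξ x

theorem pderivFun_conjFun {n : ℕ} (j : Fin n) (φ : PSmooth n) :
    pderivFun j (conjFun φ) = conjFun (pderivFun j φ) := by
  ext x
  show fderiv ℝ (Complex.conjCLE ∘ φ.1) x _ = Complex.conjCLE (fderiv ℝ φ.1 x _)
  rw [ContinuousLinearEquiv.comp_fderiv]
  rfl

theorem DerivBound.conjFun {n N : ℕ} {φ : PSmooth n} {M : ℝ} (h : DerivBound N φ M) :
    DerivBound N (conjFun φ) M := fun k hk x => by
  have : ‖iteratedFDeriv ℝ k (Complex.conjLIE ∘ φ.1) x‖ = ‖iteratedFDeriv ℝ k φ.1 x‖ :=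
    Complex.conjLIE.norm_iteratedFDeriv_comp_left φ.1 x k
  exact this.le.trans (h k hk x)

/-- The complex conjugate of a distribution. -/
def conjDist {n : ℕ} (g : PDist n) : PDist n :=
  ⟨{ toFun := fun φ => (starRingEnd ℂ) (g.1 (conjFun φ))
     map_add' := fun φ ψ => by rw [conjFun_add, map_add, map_add]
     map_smul' := fun c φ => by
      rw [conjFun_smul, map_smul, smul_eq_mul, map_mul, Complex.conj_conj]
      rfl }, by
    obtain ⟨N, C, hC, hg⟩ := g.2
    refine ⟨N, C, hC, fun φ M hM => ?_⟩
    show ‖(starRingEnd ℂ) (g.1 (conjFun φ))‖ ≤ _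
    rw [Complex.norm_conj]
    exact hg _ _ (DerivBound.conjFun hM)⟩

/-- Complex conjugation of distributions, as an additive map. -/
def conjHom (n : ℕ) : PDist n →+ PDist n where
  toFun := conjDist
  map_zero' := Subtype.ext (LinearMap.ext fun _ => map_zero (starRingEnd ℂ))
  map_add' _ _ := Subtype.ext (LinearMap.ext fun _ => map_add (starRingEnd ℂ) _ _)

theorem conjHom_smul {n : ℕ} (c : ℂ) (g : PDist n) :
    conjHom n (c • g) = (starRingEnd ℂ) c • conjHom n g :=
  Subtype.ext (LinearMap.ext fun _ => map_mul (starRingEnd ℂ) _ _)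

theorem conjHom_pderiv {n : ℕ} (j : Fin n) (g : PDist n) :
    conjHom n (pderiv j g) = pderiv j (conjHom n g) := by
  refine Subtype.ext (LinearMap.ext fun φ => ?_)
  show (starRingEnd ℂ) (-(g.1 (pderivFun j (conjFun φ)))) =
    -(starRingEnd ℂ) (g.1 (conjFun (pderivFun j φ)))
  rw [pderivFun_conjFun, map_neg]

theorem conjHom_mulSmooth {n : ℕ} {ψ : PSmooth n} (hψ : ∀ x, (ψ.1 x).im = 0) (g : PDist n) :
    conjHom n (mulSmooth ψ g) = mulSmooth ψ (conjHom n g) := by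
  refine Subtype.ext (LinearMap.ext fun φ => ?_)
  show (starRingEnd ℂ) (g.1 (ψ * conjFun φ)) = (starRingEnd ℂ) (g.1 (conjFun (ψ * φ)))
  rw [conjFun_mul, conjFun_eq_self.2 hψ]

theorem fourierCoeff_conjHom {n : ℕ} (g : PDist n) (ξ : Fin n → ℤ) :
    fourierCoeff (conjHom n g) ξ = (starRingEnd ℂ) (fourierCoeff g (-ξ)) := by
  show (starRingEnd ℂ) (g.1 (conjFun (expo (-ξ)))) = _
  rw [conjFun_expo]
  rfl

/-- Realness is tested on `φ + conj φ` and `i (φ - conj φ)`, which are both real and together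
determine `g φ` and `g (conj φ)` up to the required relation. -/
theorem isReal_iff {n : ℕ} (g : PDist n) : IsReal g ↔ conjHom n g = g := by
  constructor
  · intro h
    refine Subtype.ext (LinearMap.ext fun φ => ?_)
    show (starRingEnd ℂ) (g.1 (conjFun φ)) = g.1 φ
    have h1 := h (φ + conjFun φ) (conjFun_eq_self.1 (by
      rw [conjFun_add, conjFun_conjFun, add_comm]))
    have h2 := h (Complex.I • (φ + (-1 : ℂ) • conjFun φ)) (conjFun_eq_self.1 (by
      rw [conjFun_smul, conjFun_add, conjFun_smul, conjFun_conjFun, Complex.conj_I]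
      simp only [map_neg, map_one]
      module))
    rw [map_add] at h1
    rw [map_smul, map_add, map_smul] at h2
    simp at h1 h2
    apply Complex.ext
    · simp
      linarith
    · simp
      linarith
  · intro h φ hφ
    have h1 : (starRingEnd ℂ) (g.1 (conjFun φ)) = g.1 φ :=
      congrArg (fun g : PDist n => g.1 φ) h
    rw [conjFun_eq_self.2 hφ] at h1
    exact Complex.conj_eq_iff_im.1 h1

theorem coeff_neg_of_real {n : ℕ} {ψ : PSmooth n} (hψ : ∀ x, (ψ.1 x).im = 0) (ξ : Fin n → ℤ) :
    coeff ψ (-ξ) = (starRingEnd ℂ) (coeff ψ ξ) := by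
  unfold coeff
  rw [← integral_conj]
  refine integral_congr_ae (ae_of_all _ fun x => ?_)
  show _ = (starRingEnd ℂ) (ψ.1 x * (expo (-ξ)).1 x)
  rw [map_mul, Complex.conj_eq_iff_im.2 (hψ x), conj_expo]

/-! ### Square-summable sequences -/

/-- Square-summable sequences on `ℤⁿ`. -/
abbrev Ell (n : ℕ) (E : Type) [NormedAddCommGroup E] := lp (fun _ : Fin n → ℤ => E) 2

section Ell

variable {n : ℕ} {E F : Type} [NormedAddCommGroup E] [NormedAddCommGroup F]

theorem memlp_two_iff {f : (Fin n → ℤ) → E} : Memℓp f 2 ↔ Summable fun ξ => ‖f ξ‖ ^ 2 := by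
  rw [memℓp_gen_iff (by norm_num)]
  simp

theorem ell_norm_sq (x : Ell n E) : ‖x‖ ^ 2 = ∑' ξ, ‖x ξ‖ ^ 2 := by
  have := lp.norm_rpow_eq_tsum (p := 2) (by norm_num) x
  simpa using this

theorem ell_summable_sq (x : Ell n E) : Summable fun ξ => ‖x ξ‖ ^ 2 :=
  memlp_two_iff.1 (lp.memℓp x)

variable [NormedSpace ℂ E] [NormedSpace ℂ F]

theorem memlp_shift (η : Fin n → ℤ) {m : (Fin n → ℤ) → E →L[ℂ] F} {M : ℝ} (hm : ∀ ξ, ‖m ξ‖ ≤ M)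
    (x : Ell n E) : Summable (fun ξ => ‖m ξ (x (ξ - η))‖ ^ 2) ∧
      ∑' ξ, ‖m ξ (x (ξ - η))‖ ^ 2 ≤ (M * ‖x‖) ^ 2 := by
  have hM : 0 ≤ M := (norm_nonneg _).trans (hm 0)
  have h1 : Summable fun ξ => M ^ 2 * ‖x (ξ - η)‖ ^ 2 :=
    ((Equiv.subRight η).summable_iff.2 (ell_summable_sq x)).mul_left _
  have h2 : ∀ ξ, ‖m ξ (x (ξ - η))‖ ^ 2 ≤ M ^ 2 * ‖x (ξ - η)‖ ^ 2 := fun ξ => by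
    rw [← mul_pow]
    exact pow_le_pow_left₀ (norm_nonneg _) ((m ξ).le_of_opNorm_le (hm ξ) _) 2
  have h3 := Summable.of_nonneg_of_le (fun ξ => sq_nonneg ‖m ξ (x (ξ - η))‖) h2 h1
  refine ⟨h3, (h3.tsum_le_tsum h2 h1).trans ?_⟩
  rw [tsum_mul_left, mul_pow, ell_norm_sq]
  exact le_of_eq (congrArg _ ((Equiv.subRight η).tsum_eq fun ξ => ‖x ξ‖ ^ 2))

/-- The operator `(T x)(ξ) = m(ξ) x(ξ - η)`, for a bounded family of operators `m(ξ)`. -/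
def shiftOp (η : Fin n → ℤ) (m : (Fin n → ℤ) → E →L[ℂ] F) (M : ℝ) (hm : ∀ ξ, ‖m ξ‖ ≤ M) :
    Ell n E →L[ℂ] Ell n F :=
  LinearMap.mkContinuous
    { toFun := fun x => ⟨fun ξ => m ξ (x (ξ - η)), memlp_two_iff.2 (memlp_shift η hm x).1⟩
      map_add' := fun x y => lp.ext (funext fun ξ => map_add (m ξ) _ _)
      map_smul' := fun c x => lp.ext (funext fun ξ => map_smul (m ξ) c _) } M fun x => by
    refine abs_le_of_sq_le_sq' ?_ (mul_nonneg ((norm_nonneg _).trans (hm 0)) (norm_nonneg _)) |>.2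
    rw [ell_norm_sq]
    exact (memlp_shift η hm x).2

theorem shiftOp_apply (η : Fin n → ℤ) (m : (Fin n → ℤ) → E →L[ℂ] F) (M : ℝ)
    (hm : ∀ ξ, ‖m ξ‖ ≤ M) (x : Ell n E) (ξ : Fin n → ℤ) :
    shiftOp η m M hm x ξ = m ξ (x (ξ - η)) := rfl

theorem norm_shiftOp_le (η : Fin n → ℤ) (m : (Fin n → ℤ) → E →L[ℂ] F) (M : ℝ)
    (hm : ∀ ξ, ‖m ξ‖ ≤ M) : ‖shiftOp η m M hm‖ ≤ M :=
  LinearMap.mkContinuous_norm_le _ ((norm_nonneg _).trans (hm 0)) _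

/-- The diagonal operator `(T x)(ξ) = m(ξ) x(ξ)`. -/
def diagOp (m : (Fin n → ℤ) → E →L[ℂ] F) (M : ℝ) (hm : ∀ ξ, ‖m ξ‖ ≤ M) : Ell n E →L[ℂ] Ell n F :=
  shiftOp 0 m M hm

theorem diagOp_apply (m : (Fin n → ℤ) → E →L[ℂ] F) (M : ℝ) (hm : ∀ ξ, ‖m ξ‖ ≤ M) (x : Ell n E)
    (ξ : Fin n → ℤ) : diagOp m M hm x ξ = m ξ (x ξ) := by
  rw [diagOp, shiftOp_apply, sub_zero]

end Ell

/-! ### Weighted sequences -/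

section Weighted

variable {n : ℕ} {E F G : Type} [NormedAddCommGroup E] [NormedAddCommGroup F]
  [NormedAddCommGroup G]

/-- The sequences with `∑ ρ^{2s} |c|² < ∞`. -/
def HMem (s : ℝ) (c : (Fin n → ℤ) → E) : Prop := Summable fun ξ => rho ξ ^ (2 * s) * ‖c ξ‖ ^ 2

/-- The norm `(∑ ρ^{2s} |c|²)^{1/2}`. -/
def hNorm (s : ℝ) (c : (Fin n → ℤ) → E) : ℝ := Real.sqrt (∑' ξ, rho ξ ^ (2 * s) * ‖c ξ‖ ^ 2)

theorem rho_rpow_pos (ξ : Fin n → ℤ) (s : ℝ) : 0 < rho ξ ^ s := Real.rpow_pos_of_pos (rho_pos ξ) s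

theorem weight_sq (s : ℝ) (ξ : Fin n → ℤ) (a : ℝ) :
    (rho ξ ^ s * a) ^ 2 = rho ξ ^ (2 * s) * a ^ 2 := by
  rw [mul_pow, mul_comm 2 s, Real.rpow_mul (rho_pos ξ).le, Real.rpow_two]

theorem hNorm_nonneg (s : ℝ) (c : (Fin n → ℤ) → E) : 0 ≤ hNorm s c := Real.sqrt_nonneg _

theorem hNorm_sq (s : ℝ) (c : (Fin n → ℤ) → E) :
    hNorm s c ^ 2 = ∑' ξ, rho ξ ^ (2 * s) * ‖c ξ‖ ^ 2 :=
  Real.sq_sqrt (tsum_nonneg fun ξ => mul_nonneg (rho_rpow_pos ξ _).le (sq_nonneg _))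

/-- The weighted absolute values of a sequence, as an element of `ℓ²`. -/
def HMem.absElt {s : ℝ} {c : (Fin n → ℤ) → E} (h : HMem s c) : Ell n ℝ :=
  ⟨fun ξ => rho ξ ^ s * ‖c ξ‖, memlp_two_iff.2 (by
    refine Summable.congr h fun ξ => ?_
    rw [Real.norm_eq_abs, sq_abs, weight_sq])⟩

theorem HMem.norm_absElt {s : ℝ} {c : (Fin n → ℤ) → E} (h : HMem s c) :
    ‖h.absElt‖ = hNorm s c := by
  rw [← abs_of_nonneg (norm_nonneg h.absElt), ← abs_of_nonneg (hNorm_nonneg s c), ← sq_eq_sq_iff_abs_eq_abs,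
    ell_norm_sq, hNorm_sq]
  refine tsum_congr fun ξ => ?_
  show ‖rho ξ ^ s * ‖c ξ‖‖ ^ 2 = _
  rw [Real.norm_eq_abs, sq_abs, weight_sq]

/-- Minkowski's inequality in `ℓ²`, applied to weighted absolute values. It converts estimates at
each frequency into norm estimates with unchanged constants, even when the sequences take values in
different spaces. -/
theorem HMem.of_le_add {s r t a b : ℝ} {c : (Fin n → ℤ) → E} {d : (Fin n → ℤ) → F}
    {e : (Fin n → ℤ) → G} (hc : HMem s c) (hd : HMem r d) (ha : 0 ≤ a) (hb : 0 ≤ b)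
    (h : ∀ ξ, rho ξ ^ t * ‖e ξ‖ ≤ a * (rho ξ ^ s * ‖c ξ‖) + b * (rho ξ ^ r * ‖d ξ‖)) :
    HMem t e ∧ hNorm t e ≤ a * hNorm s c + b * hNorm r d := by
  set z : Ell n ℝ := a • hc.absElt + b • hd.absElt with hz
  have hzξ : ∀ ξ, z ξ = a * (rho ξ ^ s * ‖c ξ‖) + b * (rho ξ ^ r * ‖d ξ‖) := fun ξ => rfl
  have hle : ∀ ξ, rho ξ ^ (2 * t) * ‖e ξ‖ ^ 2 ≤ ‖z ξ‖ ^ 2 := fun ξ => by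
    rw [← weight_sq, Real.norm_eq_abs, sq_abs]
    exact pow_le_pow_left₀ (mul_nonneg (rho_rpow_pos ξ _).le (norm_nonneg _)) (by
      rw [hzξ]; exact h ξ) 2
  have h1 : HMem t e := Summable.of_nonneg_of_le
    (fun ξ => mul_nonneg (rho_rpow_pos ξ _).le (sq_nonneg _)) hle (ell_summable_sq z)
  refine ⟨h1, ?_⟩
  calc hNorm t e ≤ ‖z‖ := by
        refine abs_le_of_sq_le_sq' ?_ (norm_nonneg _) |>.2
        rw [hNorm_sq, ell_norm_sq]
        exact h1.tsum_le_tsum hle (ell_summable_sq z)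
    _ ≤ ‖a • hc.absElt‖ + ‖b • hd.absElt‖ := norm_add_le _ _
    _ = _ := by
        rw [norm_smul, norm_smul, hc.norm_absElt, hd.norm_absElt, Real.norm_of_nonneg ha,
          Real.norm_of_nonneg hb]

theorem HMem.of_le {s t a : ℝ} {c : (Fin n → ℤ) → E} {e : (Fin n → ℤ) → G} (hc : HMem s c)
    (ha : 0 ≤ a) (h : ∀ ξ, rho ξ ^ t * ‖e ξ‖ ≤ a * (rho ξ ^ s * ‖c ξ‖)) :
    HMem t e ∧ hNorm t e ≤ a * hNorm s c := by
  have := HMem.of_le_add hc hc ha le_rfl (e := e) (t := t) fun ξ => by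
    simpa using h ξ
  simpa using this

theorem HMem.add {s : ℝ} {c d : (Fin n → ℤ) → E} (hc : HMem s c) (hd : HMem s d) :
    HMem s (fun ξ => c ξ + d ξ) ∧ hNorm s (fun ξ => c ξ + d ξ) ≤ hNorm s c + hNorm s d := by
  have := HMem.of_le_add hc hd zero_le_one zero_le_one (e := fun ξ => c ξ + d ξ) (t := s) fun ξ => by
    rw [one_mul, one_mul, ← mul_add]
    exact mul_le_mul_of_nonneg_left (norm_add_le _ _) (rho_rpow_pos ξ _).le
  simpa using this

theorem HMem.neg {s : ℝ} {c : (Fin n → ℤ) → E} (hc : HMem s c) :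
    HMem s (fun ξ => -c ξ) ∧ hNorm s (fun ξ => -c ξ) = hNorm s c := by
  simpa [HMem, hNorm] using hc

theorem HMem.sub {s : ℝ} {c d : (Fin n → ℤ) → E} (hc : HMem s c) (hd : HMem s d) :
    HMem s (fun ξ => c ξ - d ξ) ∧ hNorm s (fun ξ => c ξ - d ξ) ≤ hNorm s c + hNorm s d := by
  have := hc.add hd.neg.1
  rw [hd.neg.2] at this
  simpa only [sub_eq_add_neg] using this

theorem HMem.mono {s t : ℝ} {c : (Fin n → ℤ) → E} (hc : HMem s c) (h : t ≤ s) :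
    HMem t c ∧ hNorm t c ≤ hNorm s c := by
  have := hc.of_le zero_le_one (e := c) (t := t) fun ξ => by
    rw [one_mul]
    exact mul_le_mul_of_nonneg_right (Real.rpow_le_rpow_of_exponent_le (one_le_rho ξ) h)
      (norm_nonneg _)
  simpa using this

theorem HMem.norm_le {s : ℝ} {c : (Fin n → ℤ) → E} (hc : HMem s c) (ξ : Fin n → ℤ) :
    rho ξ ^ s * ‖c ξ‖ ≤ hNorm s c := by
  refine abs_le_of_sq_le_sq' ?_ (hNorm_nonneg _ _) |>.2
  rw [hNorm_sq, weight_sq]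
  exact hc.le_tsum ξ fun η _ => mul_nonneg (rho_rpow_pos η _).le (sq_nonneg _)

variable [NormedSpace ℂ E]

/-- The element `ρ^s c` of `ℓ²`. -/
def HMem.toEll {s : ℝ} {c : (Fin n → ℤ) → E} (h : HMem s c) : Ell n E :=
  ⟨fun ξ => ((rho ξ ^ s : ℝ) : ℂ) • c ξ, memlp_two_iff.2 (by
    refine Summable.congr h fun ξ => ?_
    rw [norm_smul, Complex.norm_real, Real.norm_of_nonneg (rho_rpow_pos ξ s).le, weight_sq])⟩

theorem HMem.toEll_apply {s : ℝ} {c : (Fin n → ℤ) → E} (h : HMem s c) (ξ : Fin n → ℤ) :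
    h.toEll ξ = ((rho ξ ^ s : ℝ) : ℂ) • c ξ := rfl

theorem norm_weight_smul (s : ℝ) (ξ : Fin n → ℤ) (v : E) :
    ‖((rho ξ ^ s : ℝ) : ℂ) • v‖ = rho ξ ^ s * ‖v‖ := by
  rw [norm_smul, Complex.norm_real, Real.norm_of_nonneg (rho_rpow_pos ξ s).le]

theorem hNorm_eq_norm {s : ℝ} {c : (Fin n → ℤ) → E} (x : Ell n E)
    (hx : ∀ ξ, x ξ = ((rho ξ ^ s : ℝ) : ℂ) • c ξ) : HMem s c ∧ hNorm s c = ‖x‖ := by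
  have h : ∀ ξ, ‖x ξ‖ ^ 2 = rho ξ ^ (2 * s) * ‖c ξ‖ ^ 2 := fun ξ => by
    rw [hx, norm_weight_smul, weight_sq]
  constructor
  · exact (ell_summable_sq x).congr h
  · rw [hNorm, ← tsum_congr h, ← ell_norm_sq, Real.sqrt_sq (norm_nonneg _)]

theorem HMem.norm_toEll {s : ℝ} {c : (Fin n → ℤ) → E} (h : HMem s c) :
    ‖h.toEll‖ = hNorm s c := (hNorm_eq_norm h.toEll fun _ => rfl).2.symm

end Weighted

/-! ### The advection operator on sequences -/

/-- Complex vectors with the Euclidean norm. -/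
abbrev Vec (n : ℕ) := EuclideanSpace ℂ (Fin n)

theorem rho_add_le {n : ℕ} (ξ η : Fin n → ℤ) : rho (ξ + η) ≤ 2 * rho ξ * rho η := by
  have h := rho_pos ξ
  have h' := rho_pos η
  refine abs_le_of_sq_le_sq' ?_ (by positivity) |>.2
  rw [mul_pow, mul_pow, rho_sq, rho_sq, rho_sq]
  have h1 : ∑ i, (((ξ + η) i : ℤ) : ℝ) ^ 2 ≤ 2 * ∑ i, (ξ i : ℝ) ^ 2 + 2 * ∑ i, (η i : ℝ) ^ 2 := by
    rw [Finset.mul_sum, Finset.mul_sum, ← Finset.sum_add_distrib]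
    refine Finset.sum_le_sum fun i _ => ?_
    rw [Pi.add_apply]
    push_cast
    nlinarith [sq_nonneg ((ξ i : ℝ) - η i)]
  have h2 : 0 ≤ ∑ i, (ξ i : ℝ) ^ 2 := Finset.sum_nonneg fun _ _ => sq_nonneg _
  have h3 : 0 ≤ ∑ i, (η i : ℝ) ^ 2 := Finset.sum_nonneg fun _ _ => sq_nonneg _
  nlinarith [mul_nonneg h2 h3]

/-- Peetre's inequality. -/
theorem rho_rpow_mul_rpow_le {n : ℕ} (ξ ζ : Fin n → ℤ) (t : ℝ) :
    rho ξ ^ t * rho (ξ - ζ) ^ (-t) ≤ (2 * rho ζ) ^ |t| := by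
  have h := rho_pos ξ
  have h' := rho_pos (ξ - ζ)
  have h'' := rho_pos ζ
  rcases le_total 0 t with ht | ht
  · rw [abs_of_nonneg ht, Real.rpow_neg h'.le, ← div_eq_mul_inv, ← Real.div_rpow h.le h'.le]
    refine Real.rpow_le_rpow (by positivity) ?_ ht
    rw [div_le_iff₀ h']
    have := rho_add_le ζ (ξ - ζ)
    rwa [add_sub_cancel] at this
  · rw [abs_of_nonpos ht]
    have h1 : rho ξ ^ t = (rho ξ ^ (-t))⁻¹ := by rw [Real.rpow_neg h.le, inv_inv]
    rw [h1, mul_comm, ← div_eq_mul_inv, ← Real.div_rpow h'.le h.le]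
    refine Real.rpow_le_rpow (by positivity) ?_ (by linarith)
    rw [div_le_iff₀ h]
    have := rho_add_le (-ζ) ξ
    rwa [rho_neg, neg_add_eq_sub] at this

theorem norm_smul_id_le {n : ℕ} (c : ℂ) : ‖c • ContinuousLinearMap.id ℂ (Vec n)‖ ≤ ‖c‖ :=
  ContinuousLinearMap.opNorm_le_bound _ (norm_nonneg _) fun x => norm_smul_le c x

section Advection

variable {n : ℕ} (U : Fin n → PSmooth n)

/-- The symbol of the advection operator. -/
def advSymbol (ζ η : Fin n → ℤ) : ℂ := ∑ j, coeff (U j) ζ * (2 * Real.pi * Complex.I * η j)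

/-- The bound `2 π ∑ |Ûⱼ(ζ)|`. -/
def advBound (ζ : Fin n → ℤ) : ℝ := 2 * Real.pi * ∑ j, ‖coeff (U j) ζ‖

theorem advBound_nonneg (ζ : Fin n → ℤ) : 0 ≤ advBound U ζ :=
  mul_nonneg (by positivity) (Finset.sum_nonneg fun _ _ => norm_nonneg _)

theorem norm_advSymbol_le (ζ η : Fin n → ℤ) : ‖advSymbol U ζ η‖ ≤ advBound U ζ * rho η := by
  unfold advSymbol advBound
  rw [Finset.mul_sum, Finset.sum_mul]
  refine norm_sum_le_of_le _ fun j _ => ?_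
  have h : ‖(2 * Real.pi * Complex.I * η j : ℂ)‖ = 2 * Real.pi * |(η j : ℝ)| := by
    rw [norm_mul, norm_mul, norm_mul, Complex.norm_I, Complex.norm_real,
      Real.norm_of_nonneg Real.pi_pos.le, mul_one, Complex.norm_intCast]
    simp
  rw [norm_mul, h]
  calc ‖coeff (U j) ζ‖ * (2 * Real.pi * |(η j : ℝ)|)
      ≤ ‖coeff (U j) ζ‖ * (2 * Real.pi * rho η) := by
        have := Real.pi_pos
        have := abs_coord_le_rho η j
        gcongr
    _ = _ := by ring

theorem summable_advBound (N : ℕ) : Summable fun ζ => (2 * rho ζ) ^ N * advBound U ζ := by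
  have h : Summable fun ζ => ∑ j, rho ζ ^ N * ‖coeff (U j) ζ‖ :=
    summable_sum fun j _ => summable_rho_pow_mul_norm_coeff (U j) N
  refine (h.mul_left (2 ^ N * (2 * Real.pi))).congr fun ζ => ?_
  rw [advBound, ← Finset.mul_sum, mul_pow]
  ring

/-- The symbol of the advection operator between weighted spaces. -/
def advWeight (s : ℝ) (ζ ξ : Fin n → ℤ) : ℂ :=
  ((rho ξ ^ (s - 1) * rho (ξ - ζ) ^ (-s) : ℝ) : ℂ) * advSymbol U ζ (ξ - ζ)

/-- The derivative contributes one factor `ρ(ξ - ζ)`, after which Peetre's inequality with exponent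
`s - 1` moves the weight onto `ζ`. Rounding the exponent up to a natural number allows the rapid
decay of the coefficients of `U` to be used. -/
theorem norm_advWeight_smul_le (s : ℝ) (ζ ξ : Fin n → ℤ) :
    ‖advWeight U s ζ ξ • ContinuousLinearMap.id ℂ (Vec n)‖
      ≤ (2 * rho ζ) ^ ⌈|s - 1|⌉₊ * advBound U ζ := by
  refine (norm_smul_id_le _).trans ?_
  have h1 := rho_rpow_mul_rpow_le ξ ζ (s - 1)
  have h2 := norm_advSymbol_le U ζ (ξ - ζ)
  have h3 : rho (ξ - ζ) ^ (-(s - 1)) = rho (ξ - ζ) ^ (-s) * rho (ξ - ζ) := by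
    rw [show -(s - 1) = -s + 1 by ring, Real.rpow_add_one (rho_pos _).ne']
  have h4 : (2 * rho ζ) ^ |s - 1| ≤ (2 * rho ζ) ^ ⌈|s - 1|⌉₊ := by
    rw [← Real.rpow_natCast]
    exact Real.rpow_le_rpow_of_exponent_le (by linarith [one_le_rho ζ]) (Nat.le_ceil _)
  have h5 := rho_rpow_pos ξ (s - 1)
  have h6 := rho_rpow_pos (ξ - ζ) (-s)
  have h7 := advBound_nonneg U ζ
  rw [advWeight, norm_mul, Complex.norm_real, Real.norm_of_nonneg (by positivity)]
  calc rho ξ ^ (s - 1) * rho (ξ - ζ) ^ (-s) * ‖advSymbol U ζ (ξ - ζ)‖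
      ≤ rho ξ ^ (s - 1) * rho (ξ - ζ) ^ (-s) * (advBound U ζ * rho (ξ - ζ)) := by gcongr
    _ = rho ξ ^ (s - 1) * rho (ξ - ζ) ^ (-(s - 1)) * advBound U ζ := by rw [h3]; ring
    _ ≤ _ := by gcongr; exact h1.trans h4

/-- One Fourier mode of the advection operator. -/
def advMode (s : ℝ) (ζ : Fin n → ℤ) : Ell n (Vec n) →L[ℂ] Ell n (Vec n) :=
  shiftOp ζ (fun ξ => advWeight U s ζ ξ • ContinuousLinearMap.id ℂ (Vec n)) _
    (norm_advWeight_smul_le U s ζ)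

/-- The advection operator from `H^s` to `H^{s-1}`, both identified with `ℓ²`. -/
def advOp (s : ℝ) : Ell n (Vec n) →L[ℂ] Ell n (Vec n) := ∑' ζ, advMode U s ζ

theorem hasSum_advMode (s : ℝ) : HasSum (advMode U s) (advOp U s) :=
  (Summable.of_norm_bounded (summable_advBound U _) fun ζ => norm_shiftOp_le ζ _ _ _).hasSum

/-- The advection operator on sequences of Fourier coefficients. -/
def advSeq (c : (Fin n → ℤ) → Vec n) (ξ : Fin n → ℤ) : Vec n :=
  ∑' ζ, advSymbol U ζ (ξ - ζ) • c (ξ - ζ)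

variable {U}

/-- The series of modes converges in operator norm, so it can be evaluated at `h.toEll` and at `ξ`.
Cancelling the nonzero weight gives convergence of the unweighted convolution. -/
theorem HMem.hasSum_advSeq {s : ℝ} {c : (Fin n → ℤ) → Vec n} (h : HMem s c) (ξ : Fin n → ℤ) :
    HasSum (fun ζ => advSymbol U ζ (ξ - ζ) • c (ξ - ζ)) (advSeq U c ξ) ∧
      advOp U s h.toEll ξ = ((rho ξ ^ (s - 1) : ℝ) : ℂ) • advSeq U c ξ := by
  have h1 : HasSum (fun η => advMode U s η h.toEll ξ) (advOp U s h.toEll ξ) :=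
    ((hasSum_advMode U s).mapL ((lp.evalCLM ℂ (fun _ : Fin n → ℤ => Vec n) 2 ξ).comp
      (ContinuousLinearMap.apply ℂ _ h.toEll)))
  have h2 : ∀ ζ, advMode U s ζ h.toEll ξ
      = ((rho ξ ^ (s - 1) : ℝ) : ℂ) • (advSymbol U ζ (ξ - ζ) • c (ξ - ζ)) := fun ζ => by
    rw [advMode, shiftOp_apply, HMem.toEll_apply]
    show advWeight U s ζ ξ • ((rho (ξ - ζ) ^ s : ℝ) : ℂ) • c (ξ - ζ) = _
    rw [smul_smul, smul_smul, advWeight]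
    congr 1
    have : ((rho (ξ - ζ) ^ (-s) : ℝ) : ℂ) * ((rho (ξ - ζ) ^ s : ℝ) : ℂ) = 1 := by
      rw [← Complex.ofReal_mul, ← Real.rpow_add (rho_pos _), neg_add_cancel, Real.rpow_zero,
        Complex.ofReal_one]
    push_cast at this ⊢
    linear_combination (((rho ξ ^ (s - 1) : ℝ) : ℂ) * advSymbol U ζ (ξ - ζ)) * this
  simp only [h2] at h1
  have h0 : ((rho ξ ^ (s - 1) : ℝ) : ℂ) ≠ 0 := by exact_mod_cast (rho_rpow_pos ξ (s - 1)).ne'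
  have h3 : Summable fun ζ => advSymbol U ζ (ξ - ζ) • c (ξ - ζ) :=
    (h1.summable.const_smul (((rho ξ ^ (s - 1) : ℝ) : ℂ)⁻¹)).congr fun ζ => inv_smul_smul₀ h0 _
  exact ⟨h3.hasSum, h1.unique (h3.hasSum.const_smul _)⟩

theorem HMem.advSeq {s : ℝ} {c : (Fin n → ℤ) → Vec n} (h : HMem s c) :
    HMem (s - 1) (advSeq U c) ∧ hNorm (s - 1) (PeriodicOseen.advSeq U c) ≤ ‖advOp U s‖ * hNorm s c := by
  have h1 := hNorm_eq_norm (advOp U s h.toEll) fun ξ => (h.hasSum_advSeq ξ).2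
  refine ⟨h1.1, ?_⟩
  rw [h1.2, ← h.norm_toEll]
  exact (advOp U s).le_opNorm _

/-- The symbol on the diagonal is the Fourier coefficient of `div U`. -/
theorem advSymbol_self (hU : RealDivFree U) (ζ : Fin n → ℤ) : advSymbol U ζ ζ = 0 := by
  have h : coeffLin ζ (∑ j, pderivFun j (U j)) = 0 := by rw [hU.2, map_zero]
  rw [map_sum] at h
  rw [← h]
  refine Finset.sum_congr rfl fun j _ => ?_
  show _ = coeff (pderivFun j (U j)) ζ
  rw [coeff_pderivFun]
  ring

theorem conj_advSymbol_neg (hU : RealDivFree U) (ζ η : Fin n → ℤ) :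
    (starRingEnd ℂ) (advSymbol U (-ζ) η) = -advSymbol U ζ η := by
  unfold advSymbol
  rw [map_sum, ← Finset.sum_neg_distrib]
  refine Finset.sum_congr rfl fun j _ => ?_
  rw [coeff_neg_of_real (hU.1 j)]
  simp only [map_mul, Complex.conj_conj, Complex.conj_ofReal, Complex.conj_I, map_ofNat,
    map_intCast]
  ring

/-- The Fourier form of `(U · ∇) u = div (U ⊗ u)`: the symbol is additive in its second argument and
vanishes on the diagonal. -/
theorem advSymbol_sub_self (hU : RealDivFree U) (ζ ξ : Fin n → ℤ) : advSymbol U ζ (ξ - ζ) = advSymbol U ζ ξ := by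
  have : advSymbol U ζ (ξ - ζ) = advSymbol U ζ ξ - advSymbol U ζ ζ := by
    unfold advSymbol
    rw [← Finset.sum_sub_distrib]
    refine Finset.sum_congr rfl fun j _ => ?_
    rw [Pi.sub_apply]
    push_cast
    ring
  rw [this, advSymbol_self hU, sub_zero]

theorem norm_rho_inv_smul_le (ξ : Fin n → ℤ) :
    ‖((rho ξ ^ (-1 : ℝ) : ℝ) : ℂ) • ContinuousLinearMap.id ℂ (Vec n)‖ ≤ 1 := by
  refine (norm_smul_id_le _).trans ?_
  rw [Complex.norm_real, Real.norm_of_nonneg (rho_rpow_pos ξ _).le]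
  exact Real.rpow_le_one_of_one_le_of_nonpos (one_le_rho ξ) (by norm_num)

/-- The embedding of `H¹` into `H⁰`, both identified with `ℓ²`. -/
def embOp (n : ℕ) : Ell n (Vec n) →L[ℂ] Ell n (Vec n) :=
  diagOp (fun ξ => ((rho ξ ^ (-1 : ℝ) : ℝ) : ℂ) • ContinuousLinearMap.id ℂ (Vec n)) 1
    norm_rho_inv_smul_le

theorem embOp_apply (y : Ell n (Vec n)) (ξ : Fin n → ℤ) :
    embOp n y ξ = ((rho ξ ^ (-1 : ℝ) : ℝ) : ℂ) • y ξ := diagOp_apply _ _ _ y ξ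

/-- The identity `Re ∫ (U · ∇) u · conj u = 0`, where `y = ρ u`. Reflecting the mode `ζ` to `-ζ`
negates and conjugates its contribution, so the sum over all modes is purely imaginary. -/
theorem re_inner_advOp (hU : RealDivFree U) (y : Ell n (Vec n)) : (inner ℂ (advOp U 1 y) (embOp n y)).re = 0 := by
  set u : (Fin n → ℤ) → Vec n := fun ξ => ((rho ξ ^ (-1 : ℝ) : ℝ) : ℂ) • y ξ with hu
  set T : (Fin n → ℤ) → ℂ := fun ζ => inner ℂ (embOp n y) (advMode U 1 ζ y) with hT
  have hsum : HasSum T (inner ℂ (embOp n y) (advOp U 1 y)) :=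
    (hasSum_advMode U 1).mapL ((innerSL ℂ (embOp n y)).comp (ContinuousLinearMap.apply ℂ _ y))
  have hTζ : ∀ ζ, HasSum (fun ξ => advSymbol U ζ ξ * inner ℂ (u ξ) (u (ξ - ζ))) (T ζ) := fun ζ => by
    have h := lp.hasSum_inner (𝕜 := ℂ) (embOp n y) (advMode U 1 ζ y)
    refine (congrArg (fun f => HasSum f (T ζ)) (funext fun ξ => ?_)).mpr h
    rw [embOp_apply, advMode, shiftOp_apply]
    show _ = inner ℂ (u ξ) (advWeight U 1 ζ ξ • y (ξ - ζ))
    have : advWeight U 1 ζ ξ • y (ξ - ζ) = advSymbol U ζ ξ • u (ξ - ζ) := by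
      rw [hu, smul_smul, advWeight, sub_self, Real.rpow_zero, one_mul, advSymbol_sub_self hU,
        mul_comm]
    rw [this, inner_smul_right (u ξ) (u (ξ - ζ))]
  -- The shift of `ξ` by `ζ` swaps the two entries of the inner product. Reality of `U` supplies the
  -- conjugation and the sign, and zero divergence absorbs the shift in the symbol.
  have hneg : ∀ ζ, T (-ζ) = -(starRingEnd ℂ) (T ζ) := fun ζ => by
    have h1 := hTζ (-ζ)
    rw [← (Equiv.subRight ζ).hasSum_iff] at h1
    have h2 := HasSum.neg (Complex.hasSum_conj'.2 (hTζ ζ))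
    refine h1.unique ((congrArg (fun f => HasSum f _) (funext fun ξ => ?_)).mpr h2)
    simp only [Function.comp, Equiv.subRight_apply, sub_neg_eq_add, sub_add_cancel, map_mul]
    have e1 := conj_advSymbol_neg hU (-ζ) ξ
    have e2 := advSymbol_sub_self hU (-ζ) (ξ - ζ)
    rw [sub_neg_eq_add, sub_add_cancel] at e2
    rw [neg_neg] at e1
    rw [inner_conj_symm, e1, ← e2, neg_mul, neg_neg]
  have h3 := hsum
  rw [← (Equiv.neg _).hasSum_iff] at h3
  have h4 : (T ∘ Equiv.neg _) = fun ζ => -(starRingEnd ℂ) (T ζ) := funext hneg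
  rw [h4] at h3
  have h5 := h3.unique (HasSum.neg (Complex.hasSum_conj'.2 hsum))
  have h6 := congrArg Complex.re h5
  rw [← inner_conj_symm, Complex.conj_re]
  simp only [Complex.neg_re, Complex.conj_re] at h6
  linarith

end Advection

/-! ### The Stokes system at a single frequency -/

/-- A frequency as a complex vector. -/
def cvec {n : ℕ} (ξ : Fin n → ℤ) : Vec n := WithLp.toLp 2 fun i => (ξ i : ℂ)

theorem cvec_zero {n : ℕ} : cvec (0 : Fin n → ℤ) = 0 := by
  ext i
  simp [cvec]

theorem norm_cvec_sq {n : ℕ} (ξ : Fin n → ℤ) : ‖cvec ξ‖ ^ 2 = ∑ i, (ξ i : ℝ) ^ 2 := by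
  rw [EuclideanSpace.norm_sq_eq]
  simp [cvec]

theorem inner_cvec {n : ℕ} (ξ : Fin n → ℤ) (v : Vec n) :
    inner ℂ (cvec ξ) v = ∑ i, (ξ i : ℂ) * v i := by
  rw [PiLp.inner_apply]
  simp [cvec, mul_comm]

theorem norm_cvec_le {n : ℕ} (ξ : Fin n → ℤ) : ‖cvec ξ‖ ≤ rho ξ := by
  refine abs_le_of_sq_le_sq' ?_ (rho_pos ξ).le |>.2
  rw [norm_cvec_sq, rho_sq]
  linarith

/-- A nonzero integer vector has length at least `1`. This makes the homogeneous symbols control the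
inhomogeneous weight once the mean is removed. -/
theorem rho_sq_le {n : ℕ} {ξ : Fin n → ℤ} (hξ : ξ ≠ 0) : rho ξ ^ 2 ≤ 2 * ‖cvec ξ‖ ^ 2 := by
  rw [norm_cvec_sq, rho_sq]
  obtain ⟨j, hj⟩ : ∃ j, ξ j ≠ 0 := by
    by_contra! hc
    exact hξ (funext hc)
  have h1 : (1 : ℝ) ≤ (ξ j : ℝ) ^ 2 := by
    have : 0 < (ξ j) ^ 2 := by positivity
    have : 1 ≤ (ξ j) ^ 2 := Int.add_one_le_iff.2 this
    exact_mod_cast this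
  have := Finset.single_le_sum (f := fun i => (ξ i : ℝ) ^ 2) (fun _ _ => sq_nonneg _)
    (Finset.mem_univ j)
  linarith

theorem rho_le_two_pi_norm {n : ℕ} {ξ : Fin n → ℤ} (hξ : ξ ≠ 0) :
    rho ξ ≤ 2 * Real.pi * ‖cvec ξ‖ := by
  have hpi := Real.pi_gt_three
  refine abs_le_of_sq_le_sq' ?_ (by positivity) |>.2
  have := rho_sq_le hξ
  nlinarith [sq_nonneg ‖cvec ξ‖, mul_nonneg (sq_nonneg ‖cvec ξ‖) (sub_nonneg.2 hpi.le)]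

theorem norm_cvec_pos {n : ℕ} {ξ : Fin n → ℤ} (hξ : ξ ≠ 0) : 0 < ‖cvec ξ‖ := by
  have := rho_le_two_pi_norm hξ
  have := rho_pos ξ
  by_contra! h
  nlinarith [Real.pi_pos]

/-- The projection onto the vectors orthogonal to `ξ`; it is `0` for `ξ = 0`. -/
def leray {n : ℕ} (ξ : Fin n → ℤ) : Vec n →L[ℂ] Vec n :=
  if ξ = 0 then 0 else (ℂ ∙ cvec ξ)ᗮ.starProjection

theorem norm_leray_le {n : ℕ} (ξ : Fin n → ℤ) : ‖leray ξ‖ ≤ 1 := by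
  unfold leray
  split_ifs
  · simp
  · exact Submodule.starProjection_norm_le _

theorem leray_leray {n : ℕ} (ξ : Fin n → ℤ) (v : Vec n) : leray ξ (leray ξ v) = leray ξ v := by
  unfold leray
  split_ifs
  · simp
  · exact congrArg (fun T => T v) (Submodule.isIdempotentElem_starProjection (K := (ℂ ∙ cvec ξ)ᗮ))

theorem inner_leray {n : ℕ} (ξ : Fin n → ℤ) (v w : Vec n) :
    inner ℂ (leray ξ v) w = inner ℂ v (leray ξ w) := by
  unfold leray
  split_ifs
  · simp
  · exact Submodule.inner_starProjection_left_eq_right _ _ _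

theorem inner_cvec_leray {n : ℕ} (ξ : Fin n → ℤ) (v : Vec n) :
    inner ℂ (cvec ξ) (leray ξ v) = 0 := by
  unfold leray
  split_ifs with h
  · simp
  · exact Submodule.mem_orthogonal_singleton_iff_inner_right.1
      (Submodule.starProjection_apply_mem _ v)

theorem leray_eq_self {n : ℕ} {ξ : Fin n → ℤ} (hξ : ξ ≠ 0) {v : Vec n}
    (h : inner ℂ (cvec ξ) v = 0) : leray ξ v = v := by
  rw [leray, if_neg hξ, Submodule.starProjection_eq_self_iff]
  exact Submodule.mem_orthogonal_singleton_iff_inner_right.2 h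

theorem leray_cvec {n : ℕ} (ξ : Fin n → ℤ) : leray ξ (cvec ξ) = 0 := by
  rw [← inner_self_eq_zero (𝕜 := ℂ), inner_leray, leray_leray, inner_cvec_leray]

theorem sub_leray {n : ℕ} {ξ : Fin n → ℤ} (hξ : ξ ≠ 0) (v : Vec n) :
    v - leray ξ v = (inner ℂ (cvec ξ) v / (‖cvec ξ‖ : ℂ) ^ 2) • cvec ξ := by
  have h0 : (‖cvec ξ‖ : ℂ) ^ 2 ≠ 0 := pow_ne_zero 2 (by exact_mod_cast (norm_cvec_pos hξ).ne')
  have h := leray_eq_self hξ (v := v - (inner ℂ (cvec ξ) v / (‖cvec ξ‖ : ℂ) ^ 2) • cvec ξ) (by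
    rw [inner_sub_right, inner_smul_right, inner_self_eq_norm_sq_to_K]
    simp only [Complex.coe_algebraMap]
    rw [div_mul_cancel₀ _ h0, sub_self])
  rw [map_sub, map_smul, leray_cvec, smul_zero, sub_zero] at h
  rw [h]
  abel

theorem norm_sq_leray_add {n : ℕ} (ξ : Fin n → ℤ) (v : Vec n) :
    ‖v‖ ^ 2 = ‖leray ξ v‖ ^ 2 + ‖v - leray ξ v‖ ^ 2 := by
  have h : inner ℂ (leray ξ v) (v - leray ξ v) = 0 := by
    rw [inner_leray, map_sub, leray_leray, sub_self, inner_zero_right]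
  have := norm_add_sq_eq_norm_sq_add_norm_sq_of_inner_eq_zero _ _ h
  rw [add_sub_cancel] at this
  simpa only [sq] using this

/-- The component along `ξ` has length `|ξ · v| / |ξ|`, so the divergence controls it with a gain of
one power of `ρ`. -/
theorem norm_sub_leray_le {n : ℕ} {ξ : Fin n → ℤ} (hξ : ξ ≠ 0) (v : Vec n) :
    rho ξ * ‖v - leray ξ v‖ ≤ ‖2 * Real.pi * Complex.I * inner ℂ (cvec ξ) v‖ := by
  have h0 := norm_cvec_pos hξ
  have h1 := rho_le_two_pi_norm hξ
  have h2 : ‖(2 * Real.pi * Complex.I : ℂ)‖ = 2 * Real.pi := by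
    simp [abs_of_pos Real.pi_pos]
  rw [sub_leray hξ, norm_smul, norm_div, norm_pow, Complex.norm_real, norm_norm, norm_mul, h2]
  have h3 : ‖inner ℂ (cvec ξ) v‖ / ‖cvec ξ‖ ^ 2 * ‖cvec ξ‖ = ‖inner ℂ (cvec ξ) v‖ / ‖cvec ξ‖ := by
    field_simp
  rw [h3, mul_div_assoc', div_le_iff₀ h0]
  calc rho ξ * ‖inner ℂ (cvec ξ) v‖ ≤ 2 * Real.pi * ‖cvec ξ‖ * ‖inner ℂ (cvec ξ) v‖ := by gcongr
    _ = _ := by ring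

/-- A second-order symbol that is bounded and elliptic on divergence-free vectors. -/
structure IsEllipticSymbol {n : ℕ} (A : (Fin n → ℤ) → Vec n →L[ℂ] Vec n) (c₁ a₂ : ℝ) : Prop where
  pos : 0 < c₁
  nonneg : 0 ≤ a₂
  norm_le : ∀ ξ v, ‖A ξ v‖ ≤ a₂ * rho ξ ^ 2 * ‖v‖
  coercive : ∀ ξ, ξ ≠ 0 → ∀ v, inner ℂ (cvec ξ) v = 0 →
    c₁ * rho ξ ^ 2 * ‖v‖ ^ 2 ≤ (inner ℂ v (A ξ v)).re

/-- The constant of the estimate for the Stokes system. -/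
def stokesConst (c₁ a₂ : ℝ) : ℝ := 1 + (1 + a₂) * (c₁⁻¹ * (1 + a₂) + 1)

theorem IsEllipticSymbol.stokesConst_pos {n : ℕ} {A : (Fin n → ℤ) → Vec n →L[ℂ] Vec n}
    {c₁ a₂ : ℝ} (hA : IsEllipticSymbol A c₁ a₂) : 0 < stokesConst c₁ a₂ := by
  have := hA.pos
  have := hA.nonneg
  unfold stokesConst
  positivity

/-- Split `u = w + v` with `w ⊥ ξ` and `v` along `ξ`. The divergence bounds `v`. Testing the
equation with `w` removes the pressure, and coercivity bounds `w`. The pressure is then read off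
from the equation itself. -/
theorem IsEllipticSymbol.stokes_le {n : ℕ} {A : (Fin n → ℤ) → Vec n →L[ℂ] Vec n} {c₁ a₂ : ℝ}
    (hA : IsEllipticSymbol A c₁ a₂) {ξ : Fin n → ℤ} (hξ : ξ ≠ 0) {u F : Vec n} {p g : ℂ}
    (h1 : A ξ u + (2 * Real.pi * Complex.I * p) • cvec ξ = F)
    (h2 : 2 * Real.pi * Complex.I * inner ℂ (cvec ξ) u = g) :
    rho ξ ^ 2 * ‖u‖ ≤ stokesConst c₁ a₂ * (‖F‖ + rho ξ * ‖g‖) ∧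
      rho ξ * ‖p‖ ≤ stokesConst c₁ a₂ * (‖F‖ + rho ξ * ‖g‖) := by
  have hc := hA.pos
  have ha := hA.nonneg
  have hr := rho_pos ξ
  set w := leray ξ u with hw
  set v := u - w with hv
  have hv1 : rho ξ * ‖v‖ ≤ ‖g‖ := h2 ▸ norm_sub_leray_le hξ u
  have hu : u = w + v := by rw [hv]; abel
  have hwc : inner ℂ w (cvec ξ) = 0 := by rw [hw, inner_leray, leray_cvec, inner_zero_right]
  have h3 : inner ℂ w (A ξ w) + inner ℂ w (A ξ v) = inner ℂ w F := by
    rw [← h1, inner_add_right, inner_smul_right, hwc, mul_zero, add_zero, ← inner_add_right,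
      ← map_add, ← hu]
  have h4 := hA.coercive ξ hξ w (inner_cvec_leray ξ u)
  have h5 : (inner ℂ w (A ξ w)).re ≤ ‖w‖ * (‖F‖ + a₂ * rho ξ ^ 2 * ‖v‖) := by
    have : inner ℂ w (A ξ w) = inner ℂ w (F - A ξ v) := by
      rw [inner_sub_right, ← h3]
      ring
    rw [this]
    refine (Complex.re_le_norm _).trans ((norm_inner_le_norm _ _).trans ?_)
    exact mul_le_mul_of_nonneg_left
      ((norm_sub_le _ _).trans (by linarith [hA.norm_le ξ v])) (norm_nonneg _)
  have h6 : c₁ * (rho ξ ^ 2 * ‖w‖) ≤ ‖F‖ + a₂ * (rho ξ * ‖g‖) := by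
    have h7 : a₂ * rho ξ ^ 2 * ‖v‖ ≤ a₂ * (rho ξ * ‖g‖) := by
      calc a₂ * rho ξ ^ 2 * ‖v‖ = a₂ * (rho ξ * (rho ξ * ‖v‖)) := by ring
        _ ≤ _ := by gcongr
    rcases (norm_nonneg w).eq_or_lt with h0 | h0
    · rw [← h0, mul_zero, mul_zero]
      positivity
    · refine le_of_mul_le_mul_left ?_ h0
      calc ‖w‖ * (c₁ * (rho ξ ^ 2 * ‖w‖)) = c₁ * rho ξ ^ 2 * ‖w‖ ^ 2 := by ring
        _ ≤ ‖w‖ * (‖F‖ + a₂ * rho ξ ^ 2 * ‖v‖) := h4.trans h5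
        _ ≤ _ := by gcongr
  set X := ‖F‖ + rho ξ * ‖g‖ with hX
  have hgX : rho ξ * ‖g‖ ≤ X := by rw [hX]; linarith [norm_nonneg F]
  have hFX : ‖F‖ ≤ X := by
    have : 0 ≤ rho ξ * ‖g‖ := by positivity
    rw [hX]; linarith
  have hX0 : 0 ≤ X := (norm_nonneg F).trans hFX
  have h7 : rho ξ ^ 2 * ‖w‖ ≤ c₁⁻¹ * (1 + a₂) * X := by
    rw [mul_assoc, inv_mul_eq_div, le_div_iff₀ hc]
    have : a₂ * (rho ξ * ‖g‖) ≤ a₂ * X := by gcongr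
    linarith
  have h8 : rho ξ ^ 2 * ‖v‖ ≤ X := by
    calc rho ξ ^ 2 * ‖v‖ = rho ξ * (rho ξ * ‖v‖) := by ring
      _ ≤ rho ξ * ‖g‖ := by gcongr
      _ ≤ X := hgX
  have h9 : rho ξ ^ 2 * ‖u‖ ≤ (c₁⁻¹ * (1 + a₂) + 1) * X := by
    have h10 : ‖u‖ ≤ ‖w‖ + ‖v‖ := by
      conv_lhs => rw [hu]
      exact norm_add_le _ _
    calc rho ξ ^ 2 * ‖u‖ ≤ rho ξ ^ 2 * (‖w‖ + ‖v‖) := by gcongr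
      _ = rho ξ ^ 2 * ‖w‖ + rho ξ ^ 2 * ‖v‖ := by ring
      _ ≤ _ := by linarith
  have hk : 0 ≤ c₁⁻¹ * (1 + a₂) + 1 := by positivity
  constructor
  · refine h9.trans (mul_le_mul_of_nonneg_right ?_ hX0)
    unfold stokesConst
    nlinarith [mul_nonneg ha hk]
  · have h11 : (2 * Real.pi * Complex.I * p) • cvec ξ = F - A ξ u := by
      rw [← h1]
      abel
    have h12 := congrArg norm h11
    have h13 : ‖(2 * Real.pi * Complex.I : ℂ)‖ = 2 * Real.pi := by simp [abs_of_pos Real.pi_pos]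
    rw [norm_smul, norm_mul, h13] at h12
    calc rho ξ * ‖p‖ ≤ 2 * Real.pi * ‖cvec ξ‖ * ‖p‖ :=
          mul_le_mul_of_nonneg_right (rho_le_two_pi_norm hξ) (norm_nonneg _)
      _ = ‖F - A ξ u‖ := by rw [← h12]; ring
      _ ≤ ‖F‖ + ‖A ξ u‖ := norm_sub_le _ _
      _ ≤ X + a₂ * (rho ξ ^ 2 * ‖u‖) := by linarith [hA.norm_le ξ u]
      _ ≤ X + a₂ * ((c₁⁻¹ * (1 + a₂) + 1) * X) := by gcongr
      _ ≤ _ := by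
        unfold stokesConst
        nlinarith [mul_nonneg hk hX0]

/-! ### The symbol of the viscous operator -/

section Symbol

variable {n : ℕ} (a : Fin n → Fin n → Fin n → Fin n → ℝ)

/-- The symbol of `-𝔏`, without the factor `4 π²`, on real vectors. -/
def realSymbol (η p : Fin n → ℝ) (k : Fin n) : ℝ :=
  ∑ α, η α * ∑ j, ∑ β, a k j α β * ((η j * p β + η β * p j) / 2)

/-- The stress is symmetric in `k` and `α`, so contracting it with `p ⊗ η` equals contracting it
with the symmetric part of that matrix. -/
theorem sum_mul_realSymbol (ha : TensorSymmetric a) (η p : Fin n → ℝ) :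
    ∑ k, p k * realSymbol a η p k = ∑ k, ∑ j, ∑ α, ∑ β,
      a k j α β * ((η k * p α + η α * p k) / 2) * ((η j * p β + η β * p j) / 2) := by
  set X : Fin n → Fin n → ℝ := fun k α => ∑ j, ∑ β, a k j α β * ((η j * p β + η β * p j) / 2)
    with hX
  have hsymm : ∀ k α, X k α = X α k := fun k α =>
    Finset.sum_congr rfl fun j _ => Finset.sum_congr rfl fun β _ => by rw [(ha k j α β).1]
  have h1 : ∑ k, p k * realSymbol a η p k = ∑ k, ∑ α, η α * p k * X k α := by
    refine Finset.sum_congr rfl fun k _ => ?_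
    rw [realSymbol, Finset.mul_sum]
    exact Finset.sum_congr rfl fun α _ => by ring
  have h2 : ∑ k, ∑ α, η α * p k * X k α = ∑ k, ∑ α, η k * p α * X k α := by
    rw [Finset.sum_comm]
    exact Finset.sum_congr rfl fun k _ => Finset.sum_congr rfl fun α _ => by rw [hsymm]
  have h3 : ∑ k, ∑ j, ∑ α, ∑ β,
      a k j α β * ((η k * p α + η α * p k) / 2) * ((η j * p β + η β * p j) / 2)
      = ∑ k, ∑ α, ((η k * p α + η α * p k) / 2) * X k α := by
    refine Finset.sum_congr rfl fun k _ => ?_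
    rw [Finset.sum_comm]
    refine Finset.sum_congr rfl fun α _ => ?_
    rw [hX, Finset.mul_sum]
    refine Finset.sum_congr rfl fun j _ => ?_
    rw [Finset.mul_sum]
    exact Finset.sum_congr rfl fun β _ => by ring
  have h4 : ∑ k, ∑ α, ((η k * p α + η α * p k) / 2) * X k α
      = (∑ k, ∑ α, η k * p α * X k α + ∑ k, ∑ α, η α * p k * X k α) / 2 := by
    rw [← Finset.sum_add_distrib, Finset.sum_div]
    refine Finset.sum_congr rfl fun k _ => ?_
    rw [← Finset.sum_add_distrib, Finset.sum_div]
    exact Finset.sum_congr rfl fun α _ => by ring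
  rw [h3, h4, h1, ← h2]
  ring

/-- Expanding the square leaves a cross term proportional to `(η · p)²`, which vanishes. -/
theorem sum_sq_strain (η p : Fin n → ℝ) (h : ∑ k, η k * p k = 0) :
    ∑ k, ∑ α, ((η k * p α + η α * p k) / 2) ^ 2 = (∑ k, η k ^ 2) * (∑ k, p k ^ 2) / 2 := by
  have h1 : ∀ k α, ((η k * p α + η α * p k) / 2) ^ 2
      = η k ^ 2 * p α ^ 2 / 4 + p k ^ 2 * η α ^ 2 / 4 + (η k * p k) * (η α * p α) / 2 :=
    fun k α => by ring
  simp only [h1, Finset.sum_add_distrib, ← Finset.sum_div, ← Finset.sum_mul_sum, h]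
  ring

theorem realSymbol_coercive (ha : TensorSymmetric a) {CA : ℝ} (hell : TensorElliptic a CA)
    (η p : Fin n → ℝ) (h : ∑ k, η k * p k = 0) :
    (∑ k, η k ^ 2) * (∑ k, p k ^ 2) / 2 ≤ CA * ∑ k, p k * realSymbol a η p k := by
  rw [sum_mul_realSymbol a ha, ← sum_sq_strain η p h]
  refine hell (fun k α => (η k * p α + η α * p k) / 2) ?_ ?_
  · ext k α
    show (η α * p k + η k * p α) / 2 = (η k * p α + η α * p k) / 2
    ring
  · show ∑ k, (η k * p k + η k * p k) / 2 = 0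
    rw [← Finset.sum_div, Finset.sum_add_distrib, h]
    simp

/-- The symbol of `-𝔏`, as a function. -/
def viscFun (ξ : Fin n → ℤ) (v : Vec n) (k : Fin n) : ℂ :=
  4 * Real.pi ^ 2 * ∑ α, ξ α * ∑ j, ∑ β, a k j α β * ((ξ j * v β + ξ β * v j) / 2)

/-- The symbol of `-𝔏`. -/
def viscSymbol (ξ : Fin n → ℤ) : Vec n →L[ℂ] Vec n :=
  LinearMap.toContinuousLinearMap
    { toFun := fun v => WithLp.toLp 2 (viscFun a ξ v)
      map_add' := fun v w => by
        ext k
        show viscFun a ξ (v + w) k = viscFun a ξ v k + viscFun a ξ w k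
        simp only [viscFun, PiLp.add_apply]
        rw [← mul_add, ← Finset.sum_add_distrib]
        congr 1
        refine Finset.sum_congr rfl fun α _ => ?_
        rw [← mul_add, ← Finset.sum_add_distrib]
        congr 1
        refine Finset.sum_congr rfl fun j _ => ?_
        rw [← Finset.sum_add_distrib]
        exact Finset.sum_congr rfl fun β _ => by ring
      map_smul' := fun c v => by
        ext k
        show viscFun a ξ (c • v) k = c * viscFun a ξ v k
        simp only [viscFun, PiLp.smul_apply, smul_eq_mul]
        rw [mul_left_comm]
        congr 1
        rw [Finset.mul_sum]
        refine Finset.sum_congr rfl fun α _ => ?_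
        rw [mul_left_comm]
        congr 1
        rw [Finset.mul_sum]
        refine Finset.sum_congr rfl fun j _ => ?_
        rw [Finset.mul_sum]
        exact Finset.sum_congr rfl fun β _ => by ring }

theorem viscSymbol_apply (ξ : Fin n → ℤ) (v : Vec n) (k : Fin n) :
    viscSymbol a ξ v k = viscFun a ξ v k := rfl

theorem viscFun_re (ξ : Fin n → ℤ) (v : Vec n) (k : Fin n) :
    (viscFun a ξ v k).re
      = 4 * Real.pi ^ 2 * realSymbol a (fun i => (ξ i : ℝ)) (fun i => (v i).re) k := by
  have h1 : (4 * Real.pi ^ 2 : ℂ) = ((4 * Real.pi ^ 2 : ℝ) : ℂ) := by push_cast; rfl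
  have h2 : ∀ (m : ℤ) (z : ℂ), ((m : ℂ) * z).re = m * z.re := fun m z => by
    rw [← Complex.ofReal_intCast, Complex.re_ofReal_mul]
  rw [viscFun, h1, Complex.re_ofReal_mul, Complex.re_sum, realSymbol]
  simp only [h2, Complex.re_sum, Complex.re_ofReal_mul, Complex.div_ofNat_re, Complex.add_re]

theorem viscFun_im (ξ : Fin n → ℤ) (v : Vec n) (k : Fin n) :
    (viscFun a ξ v k).im
      = 4 * Real.pi ^ 2 * realSymbol a (fun i => (ξ i : ℝ)) (fun i => (v i).im) k := by
  have h1 : (4 * Real.pi ^ 2 : ℂ) = ((4 * Real.pi ^ 2 : ℝ) : ℂ) := by push_cast; rfl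
  have h2 : ∀ (m : ℤ) (z : ℂ), ((m : ℂ) * z).im = m * z.im := fun m z => by
    rw [← Complex.ofReal_intCast, Complex.im_ofReal_mul]
  rw [viscFun, h1, Complex.im_ofReal_mul, Complex.im_sum, realSymbol]
  simp only [h2, Complex.im_sum, Complex.im_ofReal_mul, Complex.div_ofNat_im, Complex.add_im]

theorem abs_tensor_le (k j α β : Fin n) : |a k j α β| ≤ ‖a‖ :=
  (norm_le_pi_norm (a k j α) β).trans ((norm_le_pi_norm (a k j) α).trans
    ((norm_le_pi_norm (a k) j).trans (norm_le_pi_norm a k)))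

theorem norm_vec_le {v : Vec n} {c : ℝ} (hc : 0 ≤ c) (h : ∀ k, ‖v k‖ ≤ c) : ‖v‖ ≤ n * c := by
  refine abs_le_of_sq_le_sq' ?_ (by positivity) |>.2
  rw [EuclideanSpace.norm_sq_eq]
  calc ∑ k, ‖v k‖ ^ 2 ≤ ∑ _k : Fin n, c ^ 2 :=
        Finset.sum_le_sum fun k _ => pow_le_pow_left₀ (norm_nonneg _) (h k) 2
    _ = n * c ^ 2 := by simp
    _ ≤ n * (n * c ^ 2) := by
        rcases Nat.eq_zero_or_pos n with h0 | h0
        · simp [h0]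
        · have : (1 : ℝ) ≤ n := by exact_mod_cast h0
          have h2 : 0 ≤ (n : ℝ) * c ^ 2 := by positivity
          nlinarith
    _ = _ := by ring

theorem norm_viscFun_le (ξ : Fin n → ℤ) (v : Vec n) (k : Fin n) :
    ‖viscFun a ξ v k‖ ≤ 4 * Real.pi ^ 2 * (n ^ 3 * ‖a‖) * rho ξ ^ 2 * ‖v‖ := by
  have hr := rho_pos ξ
  have hv : ∀ i, ‖v i‖ ≤ ‖v‖ := fun i => PiLp.norm_apply_le v i
  have hξ : ∀ i, ‖(ξ i : ℂ)‖ ≤ rho ξ := fun i => by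
    rw [Complex.norm_intCast]
    exact abs_coord_le_rho ξ i
  have h1 : ∀ j β, ‖((ξ j * v β + ξ β * v j) / 2 : ℂ)‖ ≤ rho ξ * ‖v‖ := fun j β => by
    rw [norm_div, Complex.norm_ofNat, div_le_iff₀ two_pos]
    refine (norm_add_le _ _).trans ?_
    rw [norm_mul, norm_mul]
    have := mul_le_mul (hξ j) (hv β) (norm_nonneg _) hr.le
    have := mul_le_mul (hξ β) (hv j) (norm_nonneg _) hr.le
    linarith
  have h2 : ∀ α, ‖(ξ α * ∑ j, ∑ β, a k j α β * ((ξ j * v β + ξ β * v j) / 2) : ℂ)‖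
      ≤ rho ξ * (n * (n * (‖a‖ * (rho ξ * ‖v‖)))) := fun α => by
    rw [norm_mul]
    refine mul_le_mul (hξ α) ?_ (norm_nonneg _) hr.le
    refine (norm_sum_le_of_le (f := fun j => ∑ β, (a k j α β : ℂ) * ((ξ j * v β + ξ β * v j) / 2))
      Finset.univ (n := fun _ => n * (‖a‖ * (rho ξ * ‖v‖))) fun j _ => ?_).trans (by simp)
    refine (norm_sum_le_of_le (f := fun β => (a k j α β : ℂ) * ((ξ j * v β + ξ β * v j) / 2))
      Finset.univ (n := fun _ => ‖a‖ * (rho ξ * ‖v‖)) fun β _ => ?_).trans (by simp)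
    rw [norm_mul, Complex.norm_real]
    exact mul_le_mul (abs_tensor_le a k j α β) (h1 j β) (norm_nonneg _) (norm_nonneg _)
  have h3 := norm_sum_le_of_le Finset.univ fun α (_ : α ∈ Finset.univ) => h2 α
  have h4 : ‖(4 * Real.pi ^ 2 : ℂ)‖ = 4 * Real.pi ^ 2 := by simp
  rw [viscFun, norm_mul, h4]
  refine (mul_le_mul_of_nonneg_left h3 (by positivity)).trans (le_of_eq ?_)
  simp only [Finset.sum_const, Finset.card_univ, Fintype.card_fin, nsmul_eq_mul]
  ring

/-- The tensor is real, so real and imaginary parts decouple in the real part of the form. Each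
contributes `4π² |ξ|² / (2 CA)` times its squared length, and `ρ² ≤ 2 |ξ|²` reduces the constant to
`π² / CA`. -/
theorem isEllipticSymbol_viscSymbol (ha : TensorSymmetric a) {CA : ℝ} (hCA : 0 < CA)
    (hell : TensorElliptic a CA) : IsEllipticSymbol (viscSymbol a) (Real.pi ^ 2 / CA)
      (n * (4 * Real.pi ^ 2 * (n ^ 3 * ‖a‖))) where
  pos := div_pos (pow_pos Real.pi_pos 2) hCA
  nonneg := by positivity
  norm_le ξ v := by
    refine (norm_vec_le (by have := rho_pos ξ; positivity) (norm_viscFun_le a ξ v)).trans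
      (le_of_eq (by ring))
  coercive ξ hξ v hv := by
    rw [inner_cvec] at hv
    have h2 : ∀ (m : ℤ) (z : ℂ), ((m : ℂ) * z).re = m * z.re := fun m z => by
      rw [← Complex.ofReal_intCast, Complex.re_ofReal_mul]
    have h3 : ∀ (m : ℤ) (z : ℂ), ((m : ℂ) * z).im = m * z.im := fun m z => by
      rw [← Complex.ofReal_intCast, Complex.im_ofReal_mul]
    have hre := congrArg Complex.re hv
    have him := congrArg Complex.im hv
    simp only [Complex.re_sum, Complex.im_sum, h2, h3, Complex.zero_re, Complex.zero_im] at hre him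
    have c1 := realSymbol_coercive a ha hell _ _ hre
    have c2 := realSymbol_coercive a ha hell _ _ him
    have hinner : (inner ℂ v (viscSymbol a ξ v)).re = 4 * Real.pi ^ 2 *
        (∑ k, (v k).re * realSymbol a (fun i => (ξ i : ℝ)) (fun i => (v i).re) k
          + ∑ k, (v k).im * realSymbol a (fun i => (ξ i : ℝ)) (fun i => (v i).im) k) := by
      rw [PiLp.inner_apply, Complex.re_sum, ← Finset.sum_add_distrib, Finset.mul_sum]
      refine Finset.sum_congr rfl fun k _ => ?_
      rw [viscSymbol_apply, RCLike.inner_apply, Complex.mul_re, Complex.conj_re, Complex.conj_im,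
        viscFun_re, viscFun_im]
      ring
    have hnorm : ‖v‖ ^ 2 = ∑ k, (v k).re ^ 2 + ∑ k, (v k).im ^ 2 := by
      rw [EuclideanSpace.norm_sq_eq, ← Finset.sum_add_distrib]
      refine Finset.sum_congr rfl fun k _ => ?_
      rw [Complex.sq_norm, Complex.normSq_apply]
      ring
    rw [hinner]
    have h4 := rho_sq_le hξ
    rw [norm_cvec_sq] at h4
    set S := ∑ i, (ξ i : ℝ) ^ 2
    have h5 : S * ‖v‖ ^ 2 / 2 ≤ CA * (∑ k, (v k).re * realSymbol a (fun i => (ξ i : ℝ)) (fun i => (v i).re) k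
          + ∑ k, (v k).im * realSymbol a (fun i => (ξ i : ℝ)) (fun i => (v i).im) k) := by
      rw [hnorm]
      linarith
    have hpi := Real.pi_pos
    rw [div_mul_eq_mul_div, div_mul_eq_mul_div, div_le_iff₀ hCA]
    calc Real.pi ^ 2 * rho ξ ^ 2 * ‖v‖ ^ 2 ≤ Real.pi ^ 2 * (2 * S) * ‖v‖ ^ 2 := by gcongr
      _ = 4 * Real.pi ^ 2 * (S * ‖v‖ ^ 2 / 2) := by ring
      _ ≤ 4 * Real.pi ^ 2 * _ := mul_le_mul_of_nonneg_left h5 (by positivity)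
      _ = _ := by ring

end Symbol

/-! ### The Oseen system for sequences of Fourier coefficients -/

section Energy

variable {n : ℕ} {A : (Fin n → ℤ) → Vec n →L[ℂ] Vec n} {c₁ a₂ : ℝ} (U : Fin n → PSmooth n)

/-- The projection onto divergence-free sequences. -/
def lerayOp (n : ℕ) : Ell n (Vec n) →L[ℂ] Ell n (Vec n) := diagOp leray 1 norm_leray_le

theorem lerayOp_apply (x : Ell n (Vec n)) (ξ : Fin n → ℤ) : lerayOp n x ξ = leray ξ (x ξ) :=
  diagOp_apply _ _ _ x ξ

theorem inner_lerayOp (x y : Ell n (Vec n)) :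
    inner ℂ x (lerayOp n y) = inner ℂ (lerayOp n x) y := by
  rw [lp.inner_eq_tsum, lp.inner_eq_tsum]
  refine tsum_congr fun ξ => ?_
  rw [lerayOp_apply, lerayOp_apply, inner_leray]

theorem inner_embOp (x y : Ell n (Vec n)) :
    inner ℂ x (embOp n y) = inner ℂ (embOp n x) y := by
  rw [lp.inner_eq_tsum, lp.inner_eq_tsum]
  refine tsum_congr fun ξ => ?_
  rw [embOp_apply, embOp_apply, inner_smul_left (x ξ) (y ξ), inner_smul_right (x ξ) (y ξ), Complex.conj_ofReal]

/-- The diagonal part of the energy operator. -/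
def energyDiag (A : (Fin n → ℤ) → Vec n →L[ℂ] Vec n) (ξ : Fin n → ℤ) : Vec n →L[ℂ] Vec n :=
  (((rho ξ ^ 2)⁻¹ : ℝ) : ℂ) • (leray ξ ∘L A ξ ∘L leray ξ) + (ContinuousLinearMap.id ℂ _ - leray ξ)

theorem energyDiag_apply (ξ : Fin n → ℤ) (v : Vec n) : energyDiag A ξ v
    = (((rho ξ ^ 2)⁻¹ : ℝ) : ℂ) • leray ξ (A ξ (leray ξ v)) + (v - leray ξ v) := rfl

theorem norm_leray_apply_le (ξ : Fin n → ℤ) (v : Vec n) : ‖leray ξ v‖ ≤ ‖v‖ := by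
  simpa using (leray ξ).le_of_opNorm_le (norm_leray_le ξ) v

theorem IsEllipticSymbol.norm_energyDiag_le (hA : IsEllipticSymbol A c₁ a₂) (ξ : Fin n → ℤ) :
    ‖energyDiag A ξ‖ ≤ a₂ + 2 := by
  have ha := hA.nonneg
  have hr := rho_pos ξ
  refine ContinuousLinearMap.opNorm_le_bound _ (by positivity) fun v => ?_
  rw [energyDiag_apply]
  have h1 : ‖(((rho ξ ^ 2)⁻¹ : ℝ) : ℂ) • leray ξ (A ξ (leray ξ v))‖ ≤ a₂ * ‖v‖ := by
    rw [norm_smul, Complex.norm_real, Real.norm_of_nonneg (by positivity), inv_mul_le_iff₀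
      (by positivity)]
    calc ‖leray ξ (A ξ (leray ξ v))‖ ≤ a₂ * rho ξ ^ 2 * ‖leray ξ v‖ :=
          (norm_leray_apply_le _ _).trans (hA.norm_le _ _)
      _ ≤ a₂ * rho ξ ^ 2 * ‖v‖ := by gcongr; exact norm_leray_apply_le _ _
      _ = _ := by ring
  have h2 := norm_leray_apply_le ξ v
  calc _ ≤ a₂ * ‖v‖ + (‖v‖ + ‖leray ξ v‖) := (norm_add_le _ _).trans (add_le_add h1 (norm_sub_le _ _))
    _ ≤ _ := by linarith

/-- The operator of the energy form, `P (A + U · ∇) P + (1 - P)`, on `H¹` identified with `ℓ²`. -/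
def energyOp (hA : IsEllipticSymbol A c₁ a₂) : Ell n (Vec n) →L[ℂ] Ell n (Vec n) :=
  diagOp (energyDiag A) _ hA.norm_energyDiag_le
    + lerayOp n ∘L embOp n ∘L advOp U 1 ∘L lerayOp n

theorem energyOp_apply (hA : IsEllipticSymbol A c₁ a₂) (x : Ell n (Vec n)) (ξ : Fin n → ℤ) :
    energyOp U hA x ξ = energyDiag A ξ (x ξ)
      + leray ξ (((rho ξ ^ (-1 : ℝ) : ℝ) : ℂ) • advOp U 1 (lerayOp n x) ξ) := by
  rw [← embOp_apply, ← lerayOp_apply, ← diagOp_apply (energyDiag A) _ hA.norm_energyDiag_le]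
  rfl

variable {U}

/-- Advection drops out by skewness after both projections and the embedding are moved to the left
entry. On the diagonal, the symbol is coercive on the divergence-free part and the identity acts on
the rest, including the zero frequency. -/
theorem energyOp_coercive (hU : RealDivFree U) (hA : IsEllipticSymbol A c₁ a₂)
    (x : Ell n (Vec n)) : min c₁ 1 * ‖x‖ ^ 2 ≤ (inner ℂ x (energyOp U hA x)).re := by
  have h1 : (inner ℂ x (energyOp U hA x)).re
      = (inner ℂ x (diagOp (energyDiag A) _ hA.norm_energyDiag_le x)).re := by
    have : energyOp U hA x = diagOp (energyDiag A) _ hA.norm_energyDiag_le x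
      + lerayOp n (embOp n (advOp U 1 (lerayOp n x))) := rfl
    rw [this, inner_add_right, inner_lerayOp, inner_embOp, Complex.add_re,
      ← inner_conj_symm (embOp n (lerayOp n x)), Complex.conj_re, re_inner_advOp hU, add_zero]
  have h2 : HasSum (fun ξ => (inner ℂ (x ξ) (energyDiag A ξ (x ξ))).re)
      (inner ℂ x (diagOp (energyDiag A) _ hA.norm_energyDiag_le x)).re := by
    have h := Complex.hasSum_re (lp.hasSum_inner (𝕜 := ℂ) x
      (diagOp (energyDiag A) _ hA.norm_energyDiag_le x))
    simpa only [diagOp_apply] using h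
  have h3 : ∀ ξ, min c₁ 1 * ‖x ξ‖ ^ 2 ≤ (inner ℂ (x ξ) (energyDiag A ξ (x ξ))).re := fun ξ => by
    have hr := rho_pos ξ
    have e1 : (inner ℂ (x ξ) (x ξ - leray ξ (x ξ))).re = ‖x ξ - leray ξ (x ξ)‖ ^ 2 := by
      have : inner ℂ (leray ξ (x ξ)) (x ξ - leray ξ (x ξ)) = 0 := by
        rw [inner_leray, map_sub, leray_leray, sub_self, inner_zero_right]
      have h4 : inner ℂ (x ξ) (x ξ - leray ξ (x ξ))
          = inner ℂ (x ξ - leray ξ (x ξ)) (x ξ - leray ξ (x ξ)) := by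
        conv_rhs => rw [inner_sub_left, this, sub_zero]
      rw [h4]
      exact inner_self_eq_norm_sq (𝕜 := ℂ) _
    have e2 : c₁ * ‖leray ξ (x ξ)‖ ^ 2
        ≤ (rho ξ ^ 2)⁻¹ * (inner ℂ (leray ξ (x ξ)) (A ξ (leray ξ (x ξ)))).re := by
      by_cases hξ : ξ = 0
      · have : leray ξ (x ξ) = 0 := by simp [leray, hξ]
        simp [this]
      · rw [le_inv_mul_iff₀ (by positivity)]
        have := hA.coercive ξ hξ _ (inner_cvec_leray ξ (x ξ))
        linarith
    rw [energyDiag_apply, inner_add_right, inner_smul_right, ← inner_leray, Complex.add_re,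
      Complex.re_ofReal_mul, e1, norm_sq_leray_add ξ (x ξ)]
    have h5 : min c₁ 1 * ‖leray ξ (x ξ)‖ ^ 2 ≤ c₁ * ‖leray ξ (x ξ)‖ ^ 2 :=
      mul_le_mul_of_nonneg_right (min_le_left _ _) (sq_nonneg _)
    have h6 : min c₁ 1 * ‖x ξ - leray ξ (x ξ)‖ ^ 2 ≤ 1 * ‖x ξ - leray ξ (x ξ)‖ ^ 2 :=
      mul_le_mul_of_nonneg_right (min_le_right _ _) (sq_nonneg _)
    linarith
  rw [h1, ell_norm_sq, ← h2.tsum_eq, ← tsum_mul_left]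
  exact ((ell_summable_sq x).mul_left _).tsum_le_tsum h3 h2.summable

theorem le_norm_energyOp (hU : RealDivFree U) (hA : IsEllipticSymbol A c₁ a₂)
    (x : Ell n (Vec n)) : min c₁ 1 * ‖x‖ ≤ ‖energyOp U hA x‖ := by
  have h := (energyOp_coercive hU hA x).trans
    ((Complex.re_le_norm _).trans (norm_inner_le_norm _ _))
  rcases (norm_nonneg x).eq_or_lt with h0 | h0
  · rw [← h0, mul_zero]
    exact norm_nonneg _
  · refine le_of_mul_le_mul_left ?_ h0
    linarith

/-- The Lax–Milgram argument: a bounded coercive operator on a Hilbert space is invertible. -/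
theorem energyOp_surjective (hU : RealDivFree U) (hA : IsEllipticSymbol A c₁ a₂) :
    Function.Surjective (energyOp U hA) := by
  have hc : 0 < min c₁ 1 := lt_min hA.pos one_pos
  have h := ContinuousLinearMap.isUnit_of_forall_le_norm_inner_map (energyOp U hA)
    (c := ⟨min c₁ 1, hc.le⟩) hc fun x => by
      rw [← norm_inner_symm, mul_comm]
      exact (energyOp_coercive hU hA x).trans (Complex.re_le_norm _)
  exact (ContinuousLinearMap.isUnit_iff_bijective.1 h).2

end Energy

/-! ### The system for sequences and its Stokes estimate -/

section System

variable {n : ℕ} {A : (Fin n → ℤ) → Vec n →L[ℂ] Vec n} {c₁ a₂ : ℝ} {U : Fin n → PSmooth n}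

/-- The Oseen system for the sequences of Fourier coefficients. -/
def Solves (A : (Fin n → ℤ) → Vec n →L[ℂ] Vec n) (U : Fin n → PSmooth n)
    (u : (Fin n → ℤ) → Vec n) (p : (Fin n → ℤ) → ℂ) (f : (Fin n → ℤ) → Vec n)
    (g : (Fin n → ℤ) → ℂ) : Prop :=
  ∀ ξ, A ξ (u ξ) + (2 * Real.pi * Complex.I * p ξ) • cvec ξ + advSeq U u ξ = f ξ ∧
    2 * Real.pi * Complex.I * inner ℂ (cvec ξ) (u ξ) = g ξ

theorem advSeq_add {s : ℝ} {c d : (Fin n → ℤ) → Vec n} (hc : HMem s c) (hd : HMem s d)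
    (ξ : Fin n → ℤ) : advSeq U (fun ξ => c ξ + d ξ) ξ = advSeq U c ξ + advSeq U d ξ := by
  have h := (hc.hasSum_advSeq (U := U) ξ).1.add (hd.hasSum_advSeq (U := U) ξ).1
  rw [← h.tsum_eq]
  exact tsum_congr fun ζ => smul_add _ _ _

/-- In divergence form the advection term has zero mean, term by term. This is the compatibility
condition at frequency zero. -/
theorem advSeq_zero (hU : RealDivFree U) (c : (Fin n → ℤ) → Vec n) : advSeq U c 0 = 0 := by
  refine (tsum_congr fun ζ => ?_).trans tsum_zero
  have h : advSymbol U ζ 0 = 0 := by simp [advSymbol]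
  rw [advSymbol_sub_self hU, h, zero_smul]

theorem IsEllipticSymbol.hMem_symbol (hA : IsEllipticSymbol A c₁ a₂) {s : ℝ}
    {u : (Fin n → ℤ) → Vec n} (hu : HMem s u) :
    HMem (s - 2) (fun ξ => A ξ (u ξ)) ∧ hNorm (s - 2) (fun ξ => A ξ (u ξ)) ≤ a₂ * hNorm s u :=
  hu.of_le hA.nonneg fun ξ => by
    have h : rho ξ ^ s = rho ξ ^ (s - 2) * rho ξ ^ 2 := by
      rw [← Real.rpow_natCast, ← Real.rpow_add (rho_pos ξ)]
      norm_num
    have := mul_le_mul_of_nonneg_left (hA.norm_le ξ (u ξ)) (rho_rpow_pos ξ (s - 2)).le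
    rw [h]
    linarith

/-- The part of a field that is orthogonal to the divergence-free ones is controlled by the
divergence. -/
theorem hMem_sub_leray {s : ℝ} {u : (Fin n → ℤ) → Vec n} {g : (Fin n → ℤ) → ℂ}
    (hu : u 0 = 0) (hg : HMem (s - 1) g)
    (h : ∀ ξ, 2 * Real.pi * Complex.I * inner ℂ (cvec ξ) (u ξ) = g ξ) :
    HMem s (fun ξ => u ξ - leray ξ (u ξ)) ∧
      hNorm s (fun ξ => u ξ - leray ξ (u ξ)) ≤ 1 * hNorm (s - 1) g :=
  hg.of_le zero_le_one fun ξ => by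
    by_cases hξ : ξ = 0
    -- At frequency zero `leray` is zero rather than the identity, so the difference is `u 0`, which
    -- vanishes by assumption.
    · subst hξ
      have := mul_nonneg (rho_rpow_pos (0 : Fin n → ℤ) (s - 1)).le (norm_nonneg (g 0))
      simpa [hu] using this
    · have h1 := norm_sub_leray_le hξ (u ξ)
      rw [h ξ] at h1
      have h2 : rho ξ ^ s = rho ξ ^ (s - 1) * rho ξ := by
        rw [← Real.rpow_add_one (rho_pos ξ).ne', sub_add_cancel]
      rw [h2, one_mul, mul_assoc]
      exact mul_le_mul_of_nonneg_left h1 (rho_rpow_pos ξ _).le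

/-- The Stokes estimate for sequences. -/
theorem Solves.stokes_le (hA : IsEllipticSymbol A c₁ a₂) {s : ℝ} {u : (Fin n → ℤ) → Vec n}
    {p : (Fin n → ℤ) → ℂ} {f : (Fin n → ℤ) → Vec n} {g : (Fin n → ℤ) → ℂ}
    (h : Solves A U u p f g) (hu : u 0 = 0) (hp : p 0 = 0)
    (hF : HMem (s - 2) fun ξ => f ξ - advSeq U u ξ) (hg : HMem (s - 1) g) :
    (HMem s u ∧ hNorm s u ≤ stokesConst c₁ a₂ * hNorm (s - 2) (fun ξ => f ξ - advSeq U u ξ)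
      + stokesConst c₁ a₂ * hNorm (s - 1) g) ∧
    (HMem (s - 1) p ∧
      hNorm (s - 1) p ≤ stokesConst c₁ a₂ * hNorm (s - 2) (fun ξ => f ξ - advSeq U u ξ)
      + stokesConst c₁ a₂ * hNorm (s - 1) g) := by
  have hc := hA.stokesConst_pos
  have key := fun (ξ : Fin n → ℤ) (hξ : ξ ≠ 0) =>
    hA.stokes_le hξ (F := f ξ - advSeq U u ξ) (by rw [← (h ξ).1]; abel) (h ξ).2
  have e1 : ∀ ξ : Fin n → ℤ, rho ξ ^ s = rho ξ ^ (s - 2) * rho ξ ^ 2 := fun ξ => by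
    rw [← Real.rpow_natCast, ← Real.rpow_add (rho_pos ξ)]
    norm_num
  have e2 : ∀ ξ : Fin n → ℤ, rho ξ ^ (s - 1) = rho ξ ^ (s - 2) * rho ξ := fun ξ => by
    rw [← Real.rpow_add_one (rho_pos ξ).ne']
    ring_nf
  constructor
  · refine HMem.of_le_add hF hg hc.le hc.le fun ξ => ?_
    by_cases hξ : ξ = 0
    · subst hξ
      rw [hu, norm_zero, mul_zero]
      have := rho_rpow_pos (0 : Fin n → ℤ)
      have := this (s - 1)
      have := rho_rpow_pos (0 : Fin n → ℤ) (s - 2)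
      positivity
    · rw [e1, e2]
      have := mul_le_mul_of_nonneg_left (key ξ hξ).1 (rho_rpow_pos ξ (s - 2)).le
      linarith
  · refine HMem.of_le_add hF hg hc.le hc.le fun ξ => ?_
    by_cases hξ : ξ = 0
    · subst hξ
      rw [hp, norm_zero, mul_zero]
      have := rho_rpow_pos (0 : Fin n → ℤ) (s - 1)
      have := rho_rpow_pos (0 : Fin n → ℤ) (s - 2)
      positivity
    · rw [e2]
      have := mul_le_mul_of_nonneg_left (key ξ hξ).2 (rho_rpow_pos ξ (s - 2)).le
      linarith

end System

/-! ### Energy estimate, bootstrapping and existence -/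

section Solvability

variable {n : ℕ} {A : (Fin n → ℤ) → Vec n →L[ℂ] Vec n} {c₁ a₂ : ℝ} {U : Fin n → PSmooth n}

/-- On divergence-free fields the complementary part `1 - P` vanishes, and `energyOp` is the
projected Oseen operator from `H¹` to `H^{-1}`, with both spaces identified with `ℓ²`. -/
theorem energyOp_toEll (hA : IsEllipticSymbol A c₁ a₂) {w : (Fin n → ℤ) → Vec n}
    (hw : HMem 1 w) (hP : ∀ ξ, leray ξ (w ξ) = w ξ) (ξ : Fin n → ℤ) :
    energyOp U hA hw.toEll ξ
      = ((rho ξ ^ (1 - 2 : ℝ) : ℝ) : ℂ) • leray ξ (A ξ (w ξ) + advSeq U w ξ) := by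
  have hx : lerayOp n hw.toEll = hw.toEll := lp.ext (funext fun ξ => by
    rw [lerayOp_apply, hw.toEll_apply, map_smul, hP])
  rw [energyOp_apply, hx, (hw.hasSum_advSeq ξ).2, energyDiag_apply, hw.toEll_apply]
  have h1 : (rho ξ ^ 2)⁻¹ * rho ξ = rho ξ ^ (1 - 2 : ℝ) := by
    have := rho_pos ξ
    rw [show (1 - 2 : ℝ) = -1 by norm_num, Real.rpow_neg_one]
    field_simp
  have h2 : rho ξ ^ (-1 : ℝ) = rho ξ ^ (1 - 2 : ℝ) := by norm_num
  rw [map_smul, hP, sub_self, add_zero, map_smul, map_smul, smul_smul, ← Complex.ofReal_mul,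
    Real.rpow_one, h1, h2, sub_self, Real.rpow_zero, Complex.ofReal_one, one_smul, map_smul,
    ← smul_add, ← map_add]

theorem hMem_leray {s : ℝ} {u : (Fin n → ℤ) → Vec n} (hu : HMem s u) :
    HMem s (fun ξ => leray ξ (u ξ)) :=
  (hu.of_le zero_le_one fun ξ => by
    rw [one_mul]
    exact mul_le_mul_of_nonneg_left (norm_leray_apply_le _ _) (rho_rpow_pos ξ s).le).1

theorem norm_lerayOp_apply_le (x : Ell n (Vec n)) : ‖lerayOp n x‖ ≤ ‖x‖ := by
  simpa using (lerayOp n).le_of_opNorm_le (norm_shiftOp_le 0 leray 1 norm_leray_le) x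

/-- The data of the energy identity for the divergence-free part. -/
theorem hMem_residual (hA : IsEllipticSymbol A c₁ a₂) {f v : (Fin n → ℤ) → Vec n}
    (hf : HMem (1 - 2) f) (hv : HMem 1 v) :
    HMem (1 - 2) (fun ξ => f ξ - (A ξ (v ξ) + advSeq U v ξ)) ∧
      hNorm (1 - 2) (fun ξ => f ξ - (A ξ (v ξ) + advSeq U v ξ))
        ≤ hNorm (1 - 2) f + (a₂ + ‖advOp U 1‖) * hNorm 1 v := by
  have h1 := hA.hMem_symbol hv
  have h2 := hv.advSeq (U := U)
  have h3 := h2.1.mono (t := 1 - 2) (by norm_num)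
  have h4 := h1.1.add h3.1
  have h5 := hf.sub h4.1
  exact ⟨h5.1, by linarith [h5.2, h4.2, h3.2, h2.2, h1.2]⟩

/-- The constant of the a priori estimate in `H¹`. -/
def energyConst (U : Fin n → PSmooth n) (c₁ a₂ : ℝ) : ℝ :=
  (min c₁ 1)⁻¹ * (1 + (a₂ + ‖advOp U 1‖)) + 1

/-- The part `v` along the frequencies is controlled by `g`. Projecting the equation kills the
pressure and leaves an `energyOp` equation for the divergence-free part `w`, with `v` moved into the
data; coercivity bounds `w`. -/
theorem Solves.energy_le (hU : RealDivFree U) (hA : IsEllipticSymbol A c₁ a₂)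
    {u : (Fin n → ℤ) → Vec n} {p : (Fin n → ℤ) → ℂ} {f : (Fin n → ℤ) → Vec n}
    {g : (Fin n → ℤ) → ℂ} (h : Solves A U u p f g) (hu0 : u 0 = 0) (hu : HMem 1 u)
    (hf : HMem (1 - 2) f) (hg : HMem (1 - 1) g) :
    hNorm 1 u ≤ energyConst U c₁ a₂ * (hNorm (1 - 2) f + hNorm (1 - 1) g) := by
  have hv := hMem_sub_leray (s := 1) hu0 hg fun ξ => (h ξ).2
  set v : (Fin n → ℤ) → Vec n := fun ξ => u ξ - leray ξ (u ξ) with hvdef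
  have hw := hMem_leray hu
  set w : (Fin n → ℤ) → Vec n := fun ξ => leray ξ (u ξ) with hwdef
  have hr := hMem_residual (U := U) hA hf hv.1
  have huwv : u = fun ξ => w ξ + v ξ := by
    funext ξ
    simp only [hvdef, hwdef]
    abel
  have hadv : ∀ ξ, advSeq U u ξ = advSeq U w ξ + advSeq U v ξ := fun ξ => by
    conv_lhs => rw [huwv]
    exact advSeq_add hw hv.1 ξ
  have hEq : energyOp U hA hw.toEll = lerayOp n hr.1.toEll := lp.ext (funext fun ξ => by
    rw [energyOp_toEll hA hw fun ξ => leray_leray ξ _, lerayOp_apply, hr.1.toEll_apply, map_smul]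
    congr 1
    have h1 := congrArg (leray ξ) (h ξ).1
    have h2 : u ξ = w ξ + v ξ := congrFun huwv ξ
    rw [hadv, h2] at h1
    rw [map_add, map_add, map_smul, leray_cvec, smul_zero, add_zero] at h1
    rw [map_sub, ← h1]
    simp only [map_add]
    abel)
  have hc : 0 < min c₁ 1 := lt_min hA.pos one_pos
  have h3 : hNorm 1 w ≤ (min c₁ 1)⁻¹ * hNorm (1 - 2) (fun ξ => f ξ - (A ξ (v ξ) + advSeq U v ξ)) := by
    rw [inv_mul_eq_div, le_div_iff₀ hc, mul_comm, ← hw.norm_toEll, ← hr.1.norm_toEll]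
    refine (le_norm_energyOp hU hA _).trans ?_
    rw [hEq]
    exact norm_lerayOp_apply_le _
  have h4 := (hw.add hv.1).2
  rw [← huwv] at h4
  set X := hNorm (1 - 2) f + hNorm (1 - 1) g with hX
  have hf0 := hNorm_nonneg (1 - 2) f
  have hg0 := hNorm_nonneg (1 - 1) g
  have hvX : hNorm 1 v ≤ X := by linarith [hv.2]
  have hfX : hNorm (1 - 2) f ≤ X := by linarith
  have hk : 0 ≤ a₂ + ‖advOp U 1‖ := add_nonneg hA.nonneg (norm_nonneg _)
  have h5 : hNorm (1 - 2) (fun ξ => f ξ - (A ξ (v ξ) + advSeq U v ξ))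
      ≤ (1 + (a₂ + ‖advOp U 1‖)) * X := by
    linarith [hr.2, mul_le_mul_of_nonneg_left hvX hk]
  have h6 := mul_le_mul_of_nonneg_left h5 (inv_nonneg.2 hc.le)
  unfold energyConst
  linarith

/-- With `u` in `H^t`, the advection term lies in `H^{t-1}`, which is contained in `H^{s-2}` as `s -
1 ≤ t`. It can thus be treated as data for the Stokes estimate at level `s`. -/
theorem Solves.regularity_step (hA : IsEllipticSymbol A c₁ a₂)
    {u : (Fin n → ℤ) → Vec n} {p : (Fin n → ℤ) → ℂ} {f : (Fin n → ℤ) → Vec n}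
    {g : (Fin n → ℤ) → ℂ} (h : Solves A U u p f g) (hu0 : u 0 = 0) (hp0 : p 0 = 0) {s t C : ℝ}
    (hts : t ≤ s) (hst : s - 1 ≤ t) (hC : 0 ≤ C) (hf : HMem (s - 2) f) (hg : HMem (s - 1) g)
    (hu : HMem t u) (hle : hNorm t u ≤ C * (hNorm (t - 2) f + hNorm (t - 1) g)) :
    HMem s u ∧ HMem (s - 1) p ∧ hNorm s u + hNorm (s - 1) p
      ≤ 2 * stokesConst c₁ a₂ * (2 + ‖advOp U t‖ * C) * (hNorm (s - 2) f + hNorm (s - 1) g) := by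
  have h1 := hu.advSeq (U := U)
  have h2 := h1.1.mono (t := s - 2) (by linarith)
  have h3 := hf.sub h2.1
  have h4 := h.stokes_le hA hu0 hp0 h3.1 hg
  refine ⟨h4.1.1, h4.2.1, ?_⟩
  have hσ := hA.stokesConst_pos
  set X := hNorm (s - 2) f + hNorm (s - 1) g with hX
  have hf0 := hNorm_nonneg (s - 2) f
  have hg0 := hNorm_nonneg (s - 1) g
  have h5 : hNorm t u ≤ C * X := hle.trans (mul_le_mul_of_nonneg_left (add_le_add
    (hf.mono (by linarith)).2 (hg.mono (by linarith)).2) hC)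
  have h6 := mul_le_mul_of_nonneg_left h5 (norm_nonneg (advOp U t))
  have h7 : hNorm (s - 2) (fun ξ => f ξ - advSeq U u ξ) ≤ (1 + ‖advOp U t‖ * C) * X := by
    linarith [h3.2, h2.2, h1.2]
  have h8 := mul_le_mul_of_nonneg_left h7 hσ.le
  have h9 : stokesConst c₁ a₂ * hNorm (s - 1) g ≤ stokesConst c₁ a₂ * X :=
    mul_le_mul_of_nonneg_left (by linarith) hσ.le
  linarith [h4.1.2, h4.2.2]

/-- Regularity and a priori estimates in all spaces. -/
theorem exists_apriori (hU : RealDivFree U) (hc₁ : 0 < c₁) (ha₂ : 0 ≤ a₂) (m : ℕ) :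
    ∀ s : ℝ, 1 ≤ s → s ≤ 1 + m → ∃ C, 0 < C ∧
      ∀ A : (Fin n → ℤ) → Vec n →L[ℂ] Vec n, IsEllipticSymbol A c₁ a₂ → ∀ u p f g,
        Solves A U u p f g → u 0 = 0 → p 0 = 0 → HMem 1 u → HMem (s - 2) f → HMem (s - 1) g →
        HMem s u ∧ HMem (s - 1) p ∧
          hNorm s u + hNorm (s - 1) p ≤ C * (hNorm (s - 2) f + hNorm (s - 1) g) := by
  have hσ : 0 < stokesConst c₁ a₂ := by unfold stokesConst; positivity
  induction m with
  | zero =>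
    intro s hs hs'
    obtain rfl : s = 1 := le_antisymm (by simpa using hs') hs
    have hE : 0 < energyConst U c₁ a₂ := by
      have : 0 < min c₁ 1 := lt_min hc₁ one_pos
      unfold energyConst
      positivity
    refine ⟨2 * stokesConst c₁ a₂ * (2 + ‖advOp U 1‖ * energyConst U c₁ a₂), by positivity,
      fun A hA u p f g h hu0 hp0 hu hf hg => ?_⟩
    -- The step with `t = s = 1` gains nothing for `u`; it supplies the pressure bound.
    exact h.regularity_step hA hu0 hp0 le_rfl (by norm_num) hE.le hf hg hu
      (h.energy_le hU hA hu0 hu hf hg)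
  | succ m ih =>
    intro s hs hs'
    push_cast at hs'
    -- The maximum keeps the previous level at or above the energy space, so noninteger `s` needs no
    -- separate treatment.
    obtain ⟨C, hC, H⟩ := ih (max (s - 1) 1) (le_max_right _ _)
      (max_le (by linarith) (by linarith [m.cast_nonneg (α := ℝ)]))
    refine ⟨2 * stokesConst c₁ a₂ * (2 + ‖advOp U (max (s - 1) 1)‖ * C), by positivity,
      fun A hA u p f g h hu0 hp0 hu hf hg => ?_⟩
    have hts : max (s - 1) 1 ≤ s := max_le (by linarith) hs
    obtain ⟨h1, -, h3⟩ := H A hA u p f g h hu0 hp0 hu (hf.mono (by linarith)).1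
      (hg.mono (by linarith)).1
    exact h.regularity_step hA hu0 hp0 hts (le_max_left _ _) hC.le hf hg h1
      ((le_add_of_nonneg_right (hNorm_nonneg _ _)).trans h3)

/-- Solvability in the energy space. -/
theorem exists_solves_one (hU : RealDivFree U) (hA : IsEllipticSymbol A c₁ a₂)
    {f : (Fin n → ℤ) → Vec n} {g : (Fin n → ℤ) → ℂ} (hf : HMem (1 - 2) f) (hg : HMem (1 - 1) g)
    (hf0 : f 0 = 0) (hg0 : g 0 = 0) :
    ∃ u p, HMem 1 u ∧ u 0 = 0 ∧ p 0 = 0 ∧ Solves A U u p f g := by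
  have hI : (2 * Real.pi * Complex.I : ℂ) ≠ 0 := by simp [Real.pi_ne_zero, Complex.I_ne_zero]
  have hnz : ∀ ξ : Fin n → ℤ, ξ ≠ 0 → ((‖cvec ξ‖ : ℂ) ^ 2) ≠ 0 := fun ξ hξ =>
    pow_ne_zero 2 (by exact_mod_cast (norm_cvec_pos hξ).ne')
  -- The gradient field with divergence `g`. It reduces the problem to a divergence-free unknown.
  set v : (Fin n → ℤ) → Vec n := fun ξ =>
    (g ξ / (2 * Real.pi * Complex.I) / (‖cvec ξ‖ : ℂ) ^ 2) • cvec ξ with hvdef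
  have hv0 : v 0 = 0 := by simp [hvdef, cvec_zero]
  have hvg : ∀ ξ, 2 * Real.pi * Complex.I * inner ℂ (cvec ξ) (v ξ) = g ξ := fun ξ => by
    by_cases hξ : ξ = 0
    · subst hξ
      rw [hv0, inner_zero_right, mul_zero, hg0]
    · rw [hvdef, inner_smul_right, inner_self_eq_norm_sq_to_K]
      simp only [Complex.coe_algebraMap]
      rw [div_mul_cancel₀ _ (hnz ξ hξ), mul_div_cancel₀ _ hI]
  have hvP : ∀ ξ, leray ξ (v ξ) = 0 := fun ξ => by
    rw [hvdef, map_smul, leray_cvec, smul_zero]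
  have hv := (hMem_sub_leray (s := 1) hv0 hg hvg).1
  simp only [hvP, sub_zero] at hv
  have hr := (hMem_residual (U := U) hA hf hv).1
  obtain ⟨x, hx⟩ := energyOp_surjective hU hA (lerayOp n hr.toEll)
  have hxξ := fun ξ => congrFun (congrArg (fun y : Ell n (Vec n) => (y : (Fin n → ℤ) → Vec n)) hx) ξ
  -- Projecting the equation and subtracting the result from it isolates the `1 - P` part of `x`,
  -- which must be zero because the right-hand side is already projected.
  have hxP : ∀ ξ, leray ξ (x ξ) = x ξ := fun ξ => by
    have h1 := hxξ ξ
    simp only [energyOp_apply, lerayOp_apply, energyDiag_apply] at h1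
    have h2 := congrArg (leray ξ) h1
    simp only [map_add, map_sub, map_smul, leray_leray, sub_self, add_zero] at h2
    simp only [map_smul] at h1
    rw [← h2] at h1
    have h3 : x ξ - leray ξ (x ξ) = 0 := by
      have h4 := sub_eq_zero.2 h1
      rw [← h4]
      abel
    exact (sub_eq_zero.1 h3).symm
  set w : (Fin n → ℤ) → Vec n := fun ξ => ((rho ξ ^ (-1 : ℝ) : ℝ) : ℂ) • x ξ with hwdef
  have hxw : ∀ ξ, x ξ = ((rho ξ ^ (1 : ℝ) : ℝ) : ℂ) • w ξ := fun ξ => by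
    rw [hwdef, smul_smul, ← Complex.ofReal_mul, ← Real.rpow_add (rho_pos ξ)]
    norm_num
  have hw := (hNorm_eq_norm x hxw).1
  have hwx : hw.toEll = x := lp.ext (funext fun ξ => (hxw ξ).symm)
  have hwP : ∀ ξ, leray ξ (w ξ) = w ξ := fun ξ => by rw [hwdef, map_smul, hxP]
  have hw0 : w 0 = 0 := by
    rw [← hwP]
    simp [leray]
  have hwc : ∀ ξ, inner ℂ (cvec ξ) (w ξ) = 0 := fun ξ => by rw [← hwP, inner_cvec_leray]
  set u : (Fin n → ℤ) → Vec n := fun ξ => w ξ + v ξ with hudef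
  have hu : HMem 1 u := (hw.add hv).1
  have hu0 : u 0 = 0 := by
    show w 0 + v 0 = 0
    rw [hw0, hv0, add_zero]
  have hres : ∀ ξ, leray ξ (f ξ - A ξ (u ξ) - advSeq U u ξ) = 0 := fun ξ => by
    have h1 := hxξ ξ
    simp only [← hwx] at h1
    rw [energyOp_toEll hA hw hwP, lerayOp_apply, hr.toEll_apply, map_smul (leray ξ)] at h1
    have h0 : ((rho ξ ^ (1 - 2 : ℝ) : ℝ) : ℂ) ≠ 0 := by
      exact_mod_cast (rho_rpow_pos ξ (1 - 2)).ne'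
    have h2 := smul_right_injective _ h0 h1
    rw [hudef, advSeq_add hw hv]
    simp only [map_sub, map_add] at h2 ⊢
    have h4 := sub_eq_zero.2 h2
    rw [← neg_eq_zero, ← h4]
    abel
  -- The residual of the momentum equation has no component orthogonal to `ξ`, so for `ξ ≠ 0` it is
  -- a multiple of `ξ`, and that multiple defines the pressure. At `ξ = 0` the formula gives zero.
  refine ⟨u, fun ξ => inner ℂ (cvec ξ) (f ξ - A ξ (u ξ) - advSeq U u ξ)
    / (2 * Real.pi * Complex.I) / (‖cvec ξ‖ : ℂ) ^ 2, hu, hu0, by simp [cvec_zero], fun ξ => ⟨?_, ?_⟩⟩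
  · by_cases hξ : ξ = 0
    · subst hξ
      rw [advSeq_zero hU, hu0, hf0, map_zero, cvec_zero, smul_zero, add_zero, add_zero]
    · have h1 := sub_leray hξ (f ξ - A ξ (u ξ) - advSeq U u ξ)
      rw [hres, sub_zero] at h1
      have h2 : 2 * Real.pi * Complex.I * (inner ℂ (cvec ξ) (f ξ - A ξ (u ξ) - advSeq U u ξ)
          / (2 * Real.pi * Complex.I) / (‖cvec ξ‖ : ℂ) ^ 2)
          = inner ℂ (cvec ξ) (f ξ - A ξ (u ξ) - advSeq U u ξ) / (‖cvec ξ‖ : ℂ) ^ 2 := by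
        rw [mul_div_assoc', mul_div_cancel₀ _ hI]
      rw [h2, ← h1]
      abel
  · rw [hudef, inner_add_right, hwc, zero_add, hvg]

/-- Solvability of the Oseen system for sequences, with estimates. -/
theorem exists_solves (hU : RealDivFree U) (hc₁ : 0 < c₁) (ha₂ : 0 ≤ a₂) {s : ℝ} (hs : 1 ≤ s) :
    ∃ C, 0 < C ∧ ∀ A : (Fin n → ℤ) → Vec n →L[ℂ] Vec n, IsEllipticSymbol A c₁ a₂ →
      (∀ f g, HMem (s - 2) f → HMem (s - 1) g → f 0 = 0 → g 0 = 0 →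
        ∃ u p, HMem s u ∧ HMem (s - 1) p ∧ u 0 = 0 ∧ p 0 = 0 ∧ Solves A U u p f g) ∧
      ∀ u p f g, Solves A U u p f g → u 0 = 0 → p 0 = 0 → HMem s u → HMem (s - 2) f →
        HMem (s - 1) g →
        hNorm s u + hNorm (s - 1) p ≤ C * (hNorm (s - 2) f + hNorm (s - 1) g) := by
  obtain ⟨C, hC, H⟩ := exists_apriori (n := n) hU hc₁ ha₂ ⌈s⌉₊ s hs
    ((Nat.le_ceil s).trans (by linarith))
  refine ⟨C, hC, fun A hA => ⟨fun f g hf hg hf0 hg0 => ?_, fun u p f g h hu0 hp0 hu hf hg => ?_⟩⟩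
  · obtain ⟨u, p, hu, hu0, hp0, h⟩ := exists_solves_one hU hA
      (hf.mono (t := 1 - 2) (by linarith)).1 (hg.mono (t := 1 - 1) (by linarith)).1 hf0 hg0
    have h1 := H A hA u p f g h hu0 hp0 hu hf hg
    exact ⟨u, p, h1.1, h1.2.1, hu0, hp0, h⟩
  · exact (H A hA u p f g h hu0 hp0 (hu.mono hs).1 hf hg).2.2

end Solvability

/-! ### From distributions to sequences -/

section Bridge

variable {n : ℕ}

/-- The vector of Fourier coefficients of a vector distribution. -/
def vecCoeff (u : Fin n → PDist n) (ξ : Fin n → ℤ) : Vec n :=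
  WithLp.toLp 2 fun k => fourierCoeff (u k) ξ

theorem vecCoeff_apply (u : Fin n → PDist n) (ξ : Fin n → ℤ) (k : Fin n) :
    vecCoeff u ξ k = fourierCoeff (u k) ξ := rfl

theorem mem_Hdot_iff {s : ℝ} {g : PDist n} :
    g ∈ Hdot n s ↔ HMem s (fourierCoeff g) ∧ fourierCoeff g 0 = 0 :=
  and_congr Iff.rfl (mem_zeroMean_iff g)

theorem weight_vecCoeff (s : ℝ) (u : Fin n → PDist n) (ξ : Fin n → ℤ) :
    rho ξ ^ (2 * s) * ‖vecCoeff u ξ‖ ^ 2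
      = ∑ k, rho ξ ^ (2 * s) * ‖fourierCoeff (u k) ξ‖ ^ 2 := by
  rw [EuclideanSpace.norm_sq_eq, Finset.mul_sum]
  rfl

theorem hMem_vecCoeff_iff {s : ℝ} {u : Fin n → PDist n} :
    HMem s (vecCoeff u) ↔ ∀ k, HMem s (fourierCoeff (u k)) := by
  constructor
  · intro h k
    exact (h.of_le zero_le_one fun ξ => by
      rw [one_mul]
      exact mul_le_mul_of_nonneg_left (PiLp.norm_apply_le (vecCoeff u ξ) k)
        (rho_rpow_pos ξ s).le).1
  · intro h
    exact (summable_sum fun k _ => h k).congr fun ξ => (weight_vecCoeff s u ξ).symm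

theorem mem_HdotVec_iff {s : ℝ} {u : Fin n → PDist n} :
    u ∈ HdotVec n s ↔ HMem s (vecCoeff u) ∧ vecCoeff u 0 = 0 := by
  have h0 : vecCoeff u 0 = 0 ↔ ∀ k, fourierCoeff (u k) 0 = 0 :=
    ⟨fun h k => congrArg (fun v : Vec n => v k) h, fun h => by
      ext k
      exact h k⟩
  rw [hMem_vecCoeff_iff, h0, ← forall_and]
  simp only [HdotVec, Submodule.mem_pi, Set.mem_univ, true_implies, mem_Hdot_iff]

/-- Summability is needed to exchange the finite sum with the series, since `tsum` is zero on
divergent components. -/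
theorem normHVec_eq {s : ℝ} {u : Fin n → PDist n} (h : HMem s (vecCoeff u)) :
    normHVec s u = hNorm s (vecCoeff u) := by
  unfold normHVec hNorm normSqH
  rw [← Summable.tsum_finsetSum fun k _ => hMem_vecCoeff_iff.1 h k]
  congr 1
  exact tsum_congr fun ξ => (weight_vecCoeff s u ξ).symm

theorem HMem.polyBounded {E : Type} [NormedAddCommGroup E] {s : ℝ} {c : (Fin n → ℤ) → E}
    (h : HMem s c) {d : (Fin n → ℤ) → ℂ} (hd : ∀ ξ, ‖d ξ‖ ≤ ‖c ξ‖) : PolyBounded d := by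
  refine ⟨⌈-s⌉₊, hNorm s c, hNorm_nonneg _ _, fun ξ => (hd ξ).trans ?_⟩
  have h1 := h.norm_le ξ
  have h2 := rpow_rho_le_pow ξ (Nat.le_ceil (-s))
  have h3 : rho ξ ^ (-s) * rho ξ ^ s = 1 := by
    rw [← Real.rpow_add (rho_pos ξ), neg_add_cancel, Real.rpow_zero]
  calc ‖c ξ‖ = rho ξ ^ (-s) * (rho ξ ^ s * ‖c ξ‖) := by rw [← mul_assoc, h3, one_mul]
    _ ≤ rho ξ ^ ⌈-s⌉₊ * hNorm s c := mul_le_mul h2 h1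
        (mul_nonneg (rho_rpow_pos ξ s).le (norm_nonneg _)) (pow_nonneg (rho_pos ξ).le _)
    _ = _ := mul_comm _ _

theorem exists_fourierCoeff_eq {s : ℝ} {c : (Fin n → ℤ) → ℂ} (h : HMem s c) :
    ∃ g : PDist n, fourierCoeff g = c :=
  ⟨ofCoeff c (h.polyBounded fun _ => le_rfl), funext (fourierCoeff_ofCoeff c _)⟩

theorem exists_vecCoeff_eq {s : ℝ} {c : (Fin n → ℤ) → Vec n} (h : HMem s c) :
    ∃ u : Fin n → PDist n, vecCoeff u = c := by
  have hp : ∀ k, PolyBounded fun ξ => c ξ k := fun k => h.polyBounded fun ξ => PiLp.norm_apply_le (c ξ) k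
  refine ⟨fun k => ofCoeff _ (hp k), funext fun ξ => ?_⟩
  ext k
  exact fourierCoeff_ofCoeff _ _ ξ

theorem vecCoeff_injective {u v : Fin n → PDist n} (h : ∀ ξ, vecCoeff u ξ = vecCoeff v ξ) :
    u = v :=
  funext fun k => fourierCoeff_injective fun ξ => congrArg (fun w : Vec n => w k) (h ξ)

variable (a : Fin n → Fin n → Fin n → Fin n → ℝ) {U : Fin n → PSmooth n}

theorem fourierCoeff_viscous (u : Fin n → PDist n) (k : Fin n) (ξ : Fin n → ℤ) :
    fourierCoeff (viscous a u k) ξ = -viscSymbol a ξ (vecCoeff u ξ) k := by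
  rw [viscSymbol_apply, viscFun, viscous, fourierCoeff_sum, Finset.mul_sum, ← Finset.sum_neg_distrib]
  refine Finset.sum_congr rfl fun α _ => ?_
  rw [fourierCoeff_pderiv, fourierCoeff_sum]
  have h : ∀ j, fourierCoeff (∑ β, (a k j α β : ℂ) • strain u j β) ξ
      = 2 * Real.pi * Complex.I * ∑ β, (a k j α β : ℂ)
        * ((ξ j * vecCoeff u ξ β + ξ β * vecCoeff u ξ j) / 2) := fun j => by
    rw [fourierCoeff_sum, Finset.mul_sum]
    refine Finset.sum_congr rfl fun β _ => ?_
    rw [fourierCoeff_smul, strain, fourierCoeff_smul, fourierCoeff_add, fourierCoeff_pderiv,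
      fourierCoeff_pderiv, vecCoeff_apply, vecCoeff_apply]
    ring
  simp only [h, ← Finset.mul_sum]
  linear_combination (4 * Real.pi ^ 2 * ξ α * ∑ j, ∑ β, (a k j α β : ℂ)
    * ((ξ j * vecCoeff u ξ β + ξ β * vecCoeff u ξ j) / 2)) * Complex.I_sq

theorem fourierCoeff_advect {s : ℝ} {u : Fin n → PDist n} (h : HMem s (vecCoeff u)) (k : Fin n)
    (ξ : Fin n → ℤ) : fourierCoeff (advect U u k) ξ = advSeq U (vecCoeff u) ξ k := by
  have h1 : HasSum (fun ζ => ∑ j, coeff (U j) ζ * fourierCoeff (pderiv j (u k)) (ξ - ζ))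
      (fourierCoeff (advect U u k) ξ) := by
    rw [advect, fourierCoeff_sum]
    exact hasSum_sum fun j _ => hasSum_fourierCoeff_mulSmooth (U j) (pderiv j (u k)) ξ
  have h2 := (h.hasSum_advSeq (U := U) ξ).1.mapL (EuclideanSpace.proj (𝕜 := ℂ) k)
  refine h1.unique ?_
  refine (congrArg (fun f => HasSum f _) (funext fun ζ => ?_)).mpr h2
  show _ = advSymbol U ζ (ξ - ζ) * fourierCoeff (u k) (ξ - ζ)
  rw [advSymbol, Finset.sum_mul]
  refine Finset.sum_congr rfl fun j _ => ?_
  rw [fourierCoeff_pderiv]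
  ring

/-- Equality of distributions is equality of Fourier coefficients. Membership of `u` in some `H^s`
is what makes the vector-valued convolution series converge. -/
theorem oseen_eq_iff {s : ℝ} {u f : Fin n → PDist n} {p g : PDist n} (h : HMem s (vecCoeff u)) :
    oseen a U (u, p) = (f, g) ↔
      Solves (viscSymbol a) U (vecCoeff u) (fourierCoeff p) (vecCoeff f) (fourierCoeff g) := by
  have h1 : ∀ ξ k, fourierCoeff ((oseen a U (u, p)).1 k) ξ
      = (viscSymbol a ξ (vecCoeff u ξ) + (2 * Real.pi * Complex.I * fourierCoeff p ξ) • cvec ξ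
        + advSeq U (vecCoeff u) ξ) k := fun ξ k => by
    show fourierCoeff (-viscous a u k + pderiv k p + advect U u k) ξ
      = viscSymbol a ξ (vecCoeff u ξ) k + (2 * Real.pi * Complex.I * fourierCoeff p ξ) * ξ k
        + advSeq U (vecCoeff u) ξ k
    rw [fourierCoeff_add, fourierCoeff_add, fourierCoeff_neg, fourierCoeff_viscous,
      fourierCoeff_advect h, fourierCoeff_pderiv]
    ring
  have h2 : ∀ ξ, fourierCoeff (oseen a U (u, p)).2 ξ
      = 2 * Real.pi * Complex.I * inner ℂ (cvec ξ) (vecCoeff u ξ) := fun ξ => by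
    show fourierCoeff (∑ j, pderiv j (u j)) ξ = _
    rw [fourierCoeff_sum, inner_cvec, Finset.mul_sum]
    refine Finset.sum_congr rfl fun j _ => ?_
    rw [fourierCoeff_pderiv, vecCoeff_apply]
    ring
  constructor
  · intro H ξ
    rw [← h2, H]
    refine ⟨?_, rfl⟩
    ext k
    rw [← h1, H]
    rfl
  · intro H
    refine Prod.ext (vecCoeff_injective fun ξ => ?_) (fourierCoeff_injective fun ξ => ?_)
    · ext k
      rw [vecCoeff_apply, h1, (H ξ).1]
    · rw [h2, (H ξ).2]

/-- This is the boundedness of the operator, including that its values have zero mean. Gradient and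
divergence contribute `2π` each, which is covered by the `4π` in the constant. -/
theorem Solves.hMem_data {A : (Fin n → ℤ) → Vec n →L[ℂ] Vec n} {c₁ a₂ s : ℝ}
    (hU : RealDivFree U) (hA : IsEllipticSymbol A c₁ a₂) {u f : (Fin n → ℤ) → Vec n}
    {p g : (Fin n → ℤ) → ℂ} (h : Solves A U u p f g) (hu0 : u 0 = 0) (hu : HMem s u)
    (hp : HMem (s - 1) p) : f 0 = 0 ∧ g 0 = 0 ∧ HMem (s - 2) f ∧ HMem (s - 1) g ∧
      hNorm (s - 2) f + hNorm (s - 1) g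
        ≤ (a₂ + ‖advOp U s‖ + 4 * Real.pi) * (hNorm s u + hNorm (s - 1) p) := by
  have h2pi : ‖(2 * Real.pi * Complex.I : ℂ)‖ = 2 * Real.pi := by simp [abs_of_pos Real.pi_pos]
  have hpi := Real.pi_pos
  have h1 := hA.hMem_symbol hu
  have h2 := hu.advSeq (U := U)
  have h3 := h2.1.mono (t := s - 2) (by linarith)
  have h4 : HMem (s - 2) (fun ξ => (2 * Real.pi * Complex.I * p ξ) • cvec ξ) ∧
      hNorm (s - 2) (fun ξ => (2 * Real.pi * Complex.I * p ξ) • cvec ξ)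
        ≤ 2 * Real.pi * hNorm (s - 1) p := hp.of_le (by positivity) fun ξ => by
    have e : rho ξ ^ (s - 1) = rho ξ ^ (s - 2) * rho ξ := by
      rw [← Real.rpow_add_one (rho_pos ξ).ne']
      ring_nf
    have := norm_cvec_le ξ
    have := rho_rpow_pos ξ (s - 2)
    rw [norm_smul, norm_mul, h2pi, e]
    calc rho ξ ^ (s - 2) * (2 * Real.pi * ‖p ξ‖ * ‖cvec ξ‖)
        ≤ rho ξ ^ (s - 2) * (2 * Real.pi * ‖p ξ‖ * rho ξ) := by gcongr
      _ = _ := by ring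
  have h5 : HMem (s - 1) g ∧ hNorm (s - 1) g ≤ 2 * Real.pi * hNorm s u :=
    hu.of_le (by positivity) fun ξ => by
      have e : rho ξ ^ s = rho ξ ^ (s - 1) * rho ξ := by
        rw [← Real.rpow_add_one (rho_pos ξ).ne', sub_add_cancel]
      have h6 := norm_inner_le_norm (𝕜 := ℂ) (cvec ξ) (u ξ)
      have := norm_cvec_le ξ
      have := rho_rpow_pos ξ (s - 1)
      rw [← (h ξ).2, norm_mul, h2pi, e]
      calc rho ξ ^ (s - 1) * (2 * Real.pi * ‖inner ℂ (cvec ξ) (u ξ)‖)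
          ≤ rho ξ ^ (s - 1) * (2 * Real.pi * (rho ξ * ‖u ξ‖)) := by
            gcongr
            exact h6.trans (by gcongr)
        _ = _ := by ring
  have h6 := h1.1.add h4.1
  have h7 := h6.1.add h3.1
  have hf : f = fun ξ => A ξ (u ξ) + (2 * Real.pi * Complex.I * p ξ) • cvec ξ + advSeq U u ξ :=
    funext fun ξ => ((h ξ).1).symm
  refine ⟨?_, ?_, hf ▸ h7.1, h5.1, ?_⟩
  · rw [← (h 0).1, advSeq_zero hU, hu0, map_zero, cvec_zero, smul_zero, add_zero, add_zero]
  · rw [← (h 0).2, hu0, inner_zero_right, mul_zero]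
  · have h8 : hNorm (s - 2) f ≤ _ := hf ▸ h7.2
    have hu' := hNorm_nonneg s u
    have hp' := hNorm_nonneg (s - 1) p
    have h9 : 0 ≤ (a₂ + ‖advOp U s‖ + 2 * Real.pi) * hNorm (s - 1) p :=
      mul_nonneg (by have := hA.nonneg; positivity) hp'
    have h10 : 0 ≤ 2 * Real.pi * hNorm s u := by positivity
    linarith [h6.2, h3.2, h2.2, h1.2, h4.2, h5.2]

theorem mem_PairSpace_iff {s t : ℝ} {x : (Fin n → PDist n) × PDist n} :
    x ∈ PairSpace n s t ↔ (HMem s (vecCoeff x.1) ∧ vecCoeff x.1 0 = 0) ∧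
      HMem t (fourierCoeff x.2) ∧ fourierCoeff x.2 0 = 0 := by
  rw [← mem_HdotVec_iff, ← mem_Hdot_iff]
  rfl

theorem pairNorm_eq {s t : ℝ} {x : (Fin n → PDist n) × PDist n} (h : x ∈ PairSpace n s t) :
    pairNorm s t x = hNorm s (vecCoeff x.1) + hNorm t (fourierCoeff x.2) := by
  rw [pairNorm, normHVec_eq (mem_PairSpace_iff.1 h).1.1]
  rfl

variable {a}

theorem oseen_bounded {c₁ a₂ : ℝ} (hU : RealDivFree U) (hA : IsEllipticSymbol (viscSymbol a) c₁ a₂)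
    {s : ℝ} {x : (Fin n → PDist n) × PDist n} (hx : x ∈ PairSpace n s (s - 1)) :
    oseen a U x ∈ PairSpace n (s - 2) (s - 1) ∧ pairNorm (s - 2) (s - 1) (oseen a U x)
      ≤ (a₂ + ‖advOp U s‖ + 4 * Real.pi) * pairNorm s (s - 1) x := by
  obtain ⟨⟨hu, hu0⟩, hp, -⟩ := mem_PairSpace_iff.1 hx
  have h1 := ((oseen_eq_iff a (U := U) (u := x.1) (p := x.2) (f := (oseen a U x).1)
    (g := (oseen a U x).2) hu).1 rfl).hMem_data hU hA hu0 hu hp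
  have h2 : oseen a U x ∈ PairSpace n (s - 2) (s - 1) :=
    mem_PairSpace_iff.2 ⟨⟨h1.2.2.1, h1.1⟩, h1.2.2.2.1, h1.2.1⟩
  refine ⟨h2, ?_⟩
  rw [pairNorm_eq h2, pairNorm_eq hx]
  exact h1.2.2.2.2

theorem hNorm_eq_zero {E : Type} [NormedAddCommGroup E] {s : ℝ} {c : (Fin n → ℤ) → E}
    (h : HMem s c) (h0 : hNorm s c ≤ 0) (ξ : Fin n → ℤ) : c ξ = 0 := by
  have h1 := (h.norm_le ξ).trans h0
  have h2 := rho_rpow_pos ξ s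
  exact norm_le_zero_iff.1 (nonpos_of_mul_nonpos_right h1 h2)

/-- Solvability of the Oseen system with estimates, for distributions. -/
theorem exists_oseen_solution {c₁ a₂ : ℝ} (hU : RealDivFree U) (hc₁ : 0 < c₁) (ha₂ : 0 ≤ a₂)
    {s : ℝ} (hs : 1 ≤ s) : ∃ C, 0 < C ∧ ∀ a : Fin n → Fin n → Fin n → Fin n → ℝ,
      IsEllipticSymbol (viscSymbol a) c₁ a₂ →
      (∀ y ∈ PairSpace n (s - 2) (s - 1), ∃ x ∈ PairSpace n s (s - 1), oseen a U x = y) ∧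
      (∀ x ∈ PairSpace n s (s - 1),
        pairNorm s (s - 1) x ≤ C * pairNorm (s - 2) (s - 1) (oseen a U x)) ∧
      ∀ x ∈ PairSpace n s (s - 1), oseen a U x = 0 → x = 0 := by
  obtain ⟨C, hC, H⟩ := exists_solves hU hc₁ ha₂ hs
  refine ⟨C, hC, fun a hA => ?_⟩
  have hest : ∀ x ∈ PairSpace n s (s - 1),
      pairNorm s (s - 1) x ≤ C * pairNorm (s - 2) (s - 1) (oseen a U x) := fun x hx => by
    have hy := (oseen_bounded hU hA hx).1
    rw [pairNorm_eq hx, pairNorm_eq hy]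
    obtain ⟨⟨hu, hu0⟩, hp, hp0⟩ := mem_PairSpace_iff.1 hx
    obtain ⟨⟨hf, -⟩, hg, -⟩ := mem_PairSpace_iff.1 hy
    exact (H _ hA).2 _ _ _ _ ((oseen_eq_iff a (U := U) (u := x.1) (p := x.2)
      (f := (oseen a U x).1) (g := (oseen a U x).2) hu).1 rfl) hu0 hp0 hu hf hg
  refine ⟨fun y hy => ?_, hest, fun x hx h0 => ?_⟩
  · obtain ⟨⟨hf, hf0⟩, hg, hg0⟩ := mem_PairSpace_iff.1 hy
    obtain ⟨u, p, hu, hp, hu0, hp0, h⟩ := (H _ hA).1 _ _ hf hg hf0 hg0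
    obtain ⟨u, rfl⟩ := exists_vecCoeff_eq hu
    obtain ⟨p, rfl⟩ := exists_fourierCoeff_eq hp
    exact ⟨(u, p), mem_PairSpace_iff.2 ⟨⟨hu, hu0⟩, hp, hp0⟩, (oseen_eq_iff a hu).2 h⟩
  · have h1 := hest x hx
    have hz : pairNorm (s - 2) (s - 1) (0 : (Fin n → PDist n) × PDist n) = 0 := by
      have h2 : ∀ t, normSqH t (0 : PDist n) = 0 := fun t => by
        have : ∀ ξ, fourierCoeff (0 : PDist n) ξ = 0 := fun _ => rfl
        simp [normSqH, this]
      simp [pairNorm, normHVec, normH, h2]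
    rw [h0, hz, mul_zero, pairNorm_eq hx] at h1
    obtain ⟨⟨hu, -⟩, hp, -⟩ := mem_PairSpace_iff.1 hx
    have hu' := hNorm_nonneg s (vecCoeff x.1)
    have hp' := hNorm_nonneg (s - 1) (fourierCoeff x.2)
    refine Prod.ext (vecCoeff_injective fun ξ => ?_) (fourierCoeff_injective fun ξ => ?_)
    · rw [hNorm_eq_zero hu (by linarith)]
      rfl
    · rw [hNorm_eq_zero hp (by linarith)]
      rfl

/-! ### Real distributions -/

/-- The complex conjugate of a pair. -/
def conjPair (x : (Fin n → PDist n) × PDist n) : (Fin n → PDist n) × PDist n :=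
  (fun k => conjHom n (x.1 k), conjHom n x.2)

theorem realPair_iff (x : (Fin n → PDist n) × PDist n) : RealPair x ↔ conjPair x = x := by
  unfold RealPair conjPair
  simp only [isReal_iff, Prod.ext_iff, funext_iff]

/-- The operator has real coefficients: `a` is real and `U` is real-valued. -/
theorem oseen_conjPair (hU : RealDivFree U) (x : (Fin n → PDist n) × PDist n) :
    oseen a U (conjPair x) = conjPair (oseen a U x) := by
  refine Prod.ext (funext fun k => ?_) ?_
  · show -viscous a (fun k => conjHom n (x.1 k)) k + pderiv k (conjHom n x.2)
      + advect U (fun k => conjHom n (x.1 k)) k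
      = conjHom n (-viscous a x.1 k + pderiv k x.2 + advect U x.1 k)
    have h1 : viscous a (fun k => conjHom n (x.1 k)) k = conjHom n (viscous a x.1 k) := by
      simp only [viscous, strain, map_sum, conjHom_pderiv, conjHom_smul, map_add,
        Complex.conj_ofReal, map_div₀, map_one, map_ofNat]
    have h2 : advect U (fun k => conjHom n (x.1 k)) k = conjHom n (advect U x.1 k) := by
      simp only [advect, map_sum, conjHom_mulSmooth (hU.1 _), conjHom_pderiv]
    rw [h1, h2, map_add, map_add, map_neg, conjHom_pderiv]
  · show ∑ j, pderiv j (conjHom n (x.1 j)) = conjHom n (∑ j, pderiv j (x.1 j))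
    simp only [map_sum, conjHom_pderiv]

theorem hMem_conjHom {s : ℝ} {g : PDist n} (h : HMem s (fourierCoeff g)) :
    HMem s (fourierCoeff (conjHom n g)) := by
  have h1 := (Equiv.neg (Fin n → ℤ)).summable_iff.2 h
  refine Summable.congr h1 fun ξ => ?_
  show rho (-ξ) ^ (2 * s) * ‖fourierCoeff g (-ξ)‖ ^ 2 = _
  rw [rho_neg, fourierCoeff_conjHom, Complex.norm_conj]

theorem conjPair_mem {s t : ℝ} {x : (Fin n → PDist n) × PDist n} (hx : x ∈ PairSpace n s t) :
    conjPair x ∈ PairSpace n s t := by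
  have h : ∀ {r : ℝ} {g : PDist n}, g ∈ Hdot n r → conjHom n g ∈ Hdot n r := fun hg => by
    rw [mem_Hdot_iff] at hg ⊢
    refine ⟨hMem_conjHom hg.1, ?_⟩
    rw [fourierCoeff_conjHom, neg_zero, hg.2, map_zero]
  exact ⟨fun k hk => h (hx.1 k hk), h hx.2⟩

/-! ### Smooth distributions -/

theorem IsSmooth.hMem {g : PDist n} (h : IsSmooth g) (s : ℝ) : HMem s (fourierCoeff g) := by
  -- The extra `n` powers become the `2n` required for summability after squaring.
  obtain ⟨K, hK⟩ := (isSmooth_iff g).1 h (n + ⌈s⌉₊)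
  refine summable_of_rho_pow_mul_le
    (fun ξ => mul_nonneg (rho_rpow_pos ξ _).le (sq_nonneg _)) (K := K ^ 2) fun ξ => ?_
  have hr := rho_pos ξ
  rw [← weight_sq, pow_mul', ← mul_pow]
  refine pow_le_pow_left₀ (by have := rho_rpow_pos ξ s; positivity) ?_ 2
  refine le_trans ?_ (hK ξ)
  rw [← mul_assoc, pow_add]
  have := rpow_rho_le_pow ξ (Nat.le_ceil s)
  gcongr

/-- Each weighted coefficient is bounded by the norm of the whole sequence, so no Sobolev embedding
is needed. -/
theorem isSmooth_of_hMem {g : PDist n} {s : ℝ} (h : ∀ r, s ≤ r → HMem r (fourierCoeff g)) :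
    IsSmooth g := by
  refine (isSmooth_iff g).2 fun N => ⟨hNorm (max s N) (fourierCoeff g), fun ξ => ?_⟩
  have h1 := (h (max s N) (le_max_left _ _)).norm_le ξ
  refine le_trans (mul_le_mul_of_nonneg_right ?_ (norm_nonneg _)) h1
  rw [← Real.rpow_natCast]
  exact Real.rpow_le_rpow_of_exponent_le (one_le_rho ξ) (le_max_right _ _)

theorem SmoothPair.mem {y : (Fin n → PDist n) × PDist n} (h : SmoothPair y) (s t : ℝ) :
    y ∈ PairSpace n s t :=
  ⟨fun k _ => mem_Hdot_iff.2 ⟨(h.1 k).1.hMem s, (mem_zeroMean_iff _).1 (h.1 k).2⟩,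
    mem_Hdot_iff.2 ⟨h.2.1.hMem t, (mem_zeroMean_iff _).1 h.2.2⟩⟩

theorem smoothPair_of_mem {x : (Fin n → PDist n) × PDist n} {s : ℝ}
    (h : ∀ r, s ≤ r → x ∈ PairSpace n r (r - 1)) : SmoothPair x := by
  refine ⟨fun k => ⟨isSmooth_of_hMem (s := s) fun r hr => ((h r hr).1 k trivial).1,
    ((h s le_rfl).1 k trivial).2⟩, isSmooth_of_hMem (s := s - 1) fun r hr => ?_, (h s le_rfl).2.2⟩
  have := (h (r + 1) (by linarith)).2.1
  rwa [add_sub_cancel_right] at this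

theorem PairSpace_mono {s t s' t' : ℝ} (hs : s ≤ s') (ht : t ≤ t')
    {x : (Fin n → PDist n) × PDist n} (hx : x ∈ PairSpace n s' t') : x ∈ PairSpace n s t := by
  rw [mem_PairSpace_iff] at hx ⊢
  exact ⟨⟨(hx.1.1.mono hs).1, hx.1.2⟩, (hx.2.1.mono ht).1, hx.2.2⟩

theorem exists_oseen_bound {a : Fin n → Fin n → Fin n → Fin n → ℝ} {U : Fin n → PSmooth n}
    {c₁ a₂ : ℝ} (hU : RealDivFree U) (hA : IsEllipticSymbol (viscSymbol a) c₁ a₂) (s : ℝ) :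
    ∃ K : ℝ, ∀ x ∈ PairSpace n s (s - 1),
      pairNorm (s - 2) (s - 1) (oseen a U x) ≤ K * pairNorm s (s - 1) x :=
  ⟨_, fun _ hx => (oseen_bounded hU hA hx).2⟩

/-- A linear map that restricts to a bijection between two submodules is an equivalence between
them. -/
theorem exists_linearEquiv_of_bijOn {R M N : Type*} [Ring R] [AddCommGroup M] [AddCommGroup N]
    [Module R M] [Module R N] (S : M →ₗ[R] N) {p : Submodule R M} {q : Submodule R N}
    (h : ∀ x ∈ p, S x ∈ q) (hinj : ∀ x ∈ p, ∀ y ∈ p, S x = S y → x = y)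
    (hsurj : ∀ y ∈ q, ∃ x ∈ p, S x = y) :
    ∃ T : p ≃ₗ[R] q, (∀ x, (T x).1 = S x.1) ∧ ∀ y, S (T.symm y).1 = y.1 := by
  have hT : Function.Bijective (S.restrict h) := by
    refine ⟨fun x y hxy => Subtype.ext (hinj _ x.2 _ y.2 (congrArg Subtype.val hxy)), fun y => ?_⟩
    obtain ⟨x, hx, hxy⟩ := hsurj y.1 y.2
    exact ⟨⟨x, hx⟩, Subtype.ext hxy⟩
  exact ⟨LinearEquiv.ofBijective _ hT, fun x => rfl,
    fun y => congrArg Subtype.val ((LinearEquiv.ofBijective _ hT).apply_symm_apply y)⟩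

end Bridge

end PeriodicOseen

end

/-! ### The main theorem -/

set_option maxHeartbeats 400000 in
theorem mainTheorem9 (n : ℕ) (hn : 2 ≤ n) (U : Fin n → PSmooth n) (hU : RealDivFree U)
    (s : ℝ) (hs : 1 ≤ s) (CA : ℝ) (hCA : 0 < CA) (A₀ : ℝ) :
    -- the constant depends only on `n`, `U`, `s`, `CA` and on the norm `A₀` of the tensor
    ∃ C : ℝ, 0 < C ∧
      -- `‖a‖` is the maximum of the `|a k j α β|`
      ∀ a : Fin n → Fin n → Fin n → Fin n → ℝ, TensorSymmetric a → TensorElliptic a CA → ‖a‖ = A₀ →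
        -- unique solvability, with the estimate
        (∀ f ∈ HdotVec n (s - 2), ∀ g ∈ Hdot n (s - 1),
          (∃! x : (Fin n → PDist n) × PDist n,
            (x.1 ∈ HdotVec n s ∧ x.2 ∈ Hdot n (s - 1)) ∧ oseen a U x = (f, g)) ∧
          ∀ u ∈ HdotVec n s, ∀ p ∈ Hdot n (s - 1), oseen a U (u, p) = (f, g) →
            normHVec s u + normH (s - 1) p ≤ C * (normHVec (s - 2) f + normH (s - 1) g)) ∧
        -- `S_U` is an isomorphism: a linear bijection, bounded together with its inverse
        (∃ T : PairSpace n s (s - 1) ≃ₗ[ℂ] PairSpace n (s - 2) (s - 1),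
          (∀ x, (T x).1 = oseen a U x.1) ∧
          (∃ K : ℝ, ∀ x, pairNorm (s - 2) (s - 1) (T x).1 ≤ K * pairNorm s (s - 1) x.1) ∧
          (∃ K : ℝ, ∀ y, pairNorm s (s - 1) (T.symm y).1 ≤ K * pairNorm (s - 2) (s - 1) y.1)) ∧
        -- the same holds in the spaces of real distributions
        (∀ x ∈ PairSpace n s (s - 1), RealPair x ↔ RealPair (oseen a U x)) ∧
        -- smooth data give smooth solutions
        (∀ y : (Fin n → PDist n) × PDist n, SmoothPair y →
          (∃ x ∈ PairSpace n s (s - 1), oseen a U x = y) ∧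
          ∀ x ∈ PairSpace n s (s - 1), oseen a U x = y → SmoothPair x) := by
  have hc₁ : 0 < Real.pi ^ 2 / CA := div_pos (pow_pos Real.pi_pos 2) hCA
  -- The constants are fixed before the tensor is introduced, when the sign of `A₀` is not yet
  -- known; the absolute value keeps the bound nonnegative.
  have ha₂ : 0 ≤ (n : ℝ) * (4 * Real.pi ^ 2 * (n ^ 3 * |A₀|)) := by positivity
  obtain ⟨C, hC, H⟩ := exists_oseen_solution hU hc₁ ha₂ hs
  refine ⟨C, hC, fun a ha hell hnorm => ?_⟩
  have hA : IsEllipticSymbol (viscSymbol a) (Real.pi ^ 2 / CA)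
      (n * (4 * Real.pi ^ 2 * (n ^ 3 * |A₀|))) := by
    rw [← hnorm, abs_of_nonneg (norm_nonneg a)]
    exact isEllipticSymbol_viscSymbol a ha hCA hell
  obtain ⟨hex, hest, hzero⟩ := H a hA
  have hinj : ∀ x ∈ PairSpace n s (s - 1), ∀ y ∈ PairSpace n s (s - 1),
      oseen a U x = oseen a U y → x = y := fun x hx y hy h =>
    sub_eq_zero.1 (hzero _ (Submodule.sub_mem _ hx hy) (by rw [map_sub, h, sub_self]))
  refine ⟨fun f hf g hg => ⟨?_, fun u hu p hp h => ?_⟩, ?_, fun x hx => ?_, fun y hy => ?_⟩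
  · obtain ⟨x, hx, h⟩ := hex (f, g) ⟨hf, hg⟩
    exact ⟨x, ⟨hx, h⟩, fun y hy => hinj y hy.1 x hx (hy.2.trans h.symm)⟩
  · have h1 := hest (u, p) ⟨hu, hp⟩
    rw [h] at h1
    exact h1
  · obtain ⟨T, hT, hT'⟩ := exists_linearEquiv_of_bijOn (oseen a U)
      (fun x hx => (oseen_bounded hU hA hx).1) hinj hex
    refine ⟨T, hT, ?_, C, fun y => ?_⟩
    · obtain ⟨K, hK⟩ := exists_oseen_bound (a := a) hU hA s
      refine ⟨K, fun x => ?_⟩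
      rw [hT]
      exact hK x.1 x.2
    · rw [← hT' y]
      exact hest (T.symm y).1 (T.symm y).2
  · rw [realPair_iff, realPair_iff, ← oseen_conjPair hU]
    -- If the data are real, the conjugate of a solution solves the same system in the same space,
    -- and injectivity identifies the two.
    exact ⟨fun h => by rw [h], fun h => hinj _ (conjPair_mem hx) _ hx h⟩
  · refine ⟨hex y (hy.mem _ _), fun x hx h => smoothPair_of_mem (s := s) fun r hr => ?_⟩
    -- Solving anew in `H^r` gives a solution that also lies in `H^s`, so uniqueness there transfers
    -- the higher regularity to `x`.
    obtain ⟨C', -, H'⟩ := exists_oseen_solution hU hc₁ ha₂ (hs.trans hr)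
    obtain ⟨z, hz, hzy⟩ := (H' a hA).1 y (hy.mem _ _)
    have : x = z := hinj x hx z (PairSpace_mono hr (by linarith) hz) (h.trans hzy.symm)
    exact this ▸ hz
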